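/- **Setting.** Fix unary and binary predicate symbols and a countably infinite set of individual names. An ontology $\mathcal O$ is a finite set of first-order sentences (with equality) over the predicate symbols. A data instance $\mathcal A$ is a non-empty finite set of atoms $\top(a)$, $A(a)$, $P(a,b)$ over individual names; $\mathrm{ind}(\mathcal A)$ is the set of names occurring in it and $|\mathcal A|$ its number of atoms. Structures interpret all individual names, distinct names by distinct elements. A domain query is a conjunctive query (CQ) $q(x)$ with one answer variable or the inconsistency query $\bot(x)$; $\mathcal O,\mathcal A\models q(a)$ means that $q(a)$ holds in all models of $\mathcal O$ and $\mathcal A$; $q_1\models_{\mathcal O}q_2$ means that $\mathcal O,\mathcal A\models q_1(a)$ implies $\mathcal O,\mathcal A\models q_2(a)$ for all $\mathcal A$ and $a\in\mathrm{ind}(\mathcal A)$, and $\equiv_{\mathcal O}$ is containment in both directions. $\mathcal O$ *admits containment reduction* if every CQ $q(x)$ has a pointed data instance $(\hat q,a)$ with: (1) $q$ is satisfiable w.r.t. $\mathcal O$ iff $\mathcal O$ and $\hat q$ are; (2) there is a homomorphism $q\to\hat q$ mapping $x$ to $a$ and the variables of $q$ onto $\mathrm{ind}(\hat q)$; (3)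 if $q$ is satisfiable w.r.t. $\mathcal O$, then for all CQs $q'$, $q\models_{\mathcal O}q'$ iff $\mathcal O,\hat q\models q'(a)$. A pair $E=(E^+,E^-)$ of finite sets of pointed data instances *uniquely characterises* $q$ within a class if $q$ is entailed by all examples in $E^+$ and by none in $E^-$ ($q$ *fits* $E$), and every query of the class that fits $E$ is equivalent to $q$ w.r.t. $\mathcal O$. The characterisation is *singular$^+$* if $E^+=\{(\hat q,a)\}$ for some $(\hat q,a)$ satisfying (1)–(3). Let $\mathcal Q$ be a class of domain queries closed under $\wedge$. $\mathcal O$ *admits (polynomial-size) singular$^+$ characterisations within $\mathcal Q$* if every $q\in\mathcal Q$ that is satisfiable w.r.t. $\mathcal O$ has a singular$^+$ characterisation within $\mathcal Q$ (of size at most $f(|q|)$ for a fixed polynomial $f$). Here $|q|$ is the number of symbols of $q$, and the size of an example set is the sum of the sizes of its data instances. **Temporal queries.** A temporal data instance is a sequence $\mathcal D=\mathcal A_0,\dots,\mathcal A_n$ of data instances with the same individuals, with $\mathcal A_\ell=\{\top(a)\mid a\in\mathrm{ind}(\mathcal D)\}$ for $\ell>n$; its size is $\sum_{i\le n}|\mathcal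 A_i|$. $\mathrm{LTL}_p^{\bigcirc\Diamond\Diamond_r}(\mathcal Q)$ is the class of path queries $r_0\wedge o_1(r_1\wedge o_2(r_2\wedge\dots\wedge o_nr_n))$ with $r_i\in\mathcal Q$ and $o_i\in\{\bigcirc,\Diamond,\Diamond_r\}$ (next; at some later moment; now or later); $n$ is the temporal depth; $\mathrm{LTL}_p^{\bigcirc\Diamond}(\mathcal Q)$ is the subclass without $\Diamond_r$. Entailment $\mathcal O,\mathcal D,\ell,a\models q$ is defined for $\mathcal O,\mathcal D$ satisfiable (i.e. $\mathcal O$ and $\mathcal A_i$ satisfiable for every $i\le n$) inductively, with $\mathcal O,\mathcal D,\ell,a\models r$ iff $\mathcal O,\mathcal A_\ell\models r(a)$ for $r\in\mathcal Q$; otherwise everything is entailed. Equivalence and unique characterisation are defined as above, with pointed temporal data instances and entailment at time $0$. A path query is satisfiable w.r.t. $\mathcal O$ if it is entailed at time $0$ in some temporal data instance satisfiable with $\mathcal O$. Divide a path query into blocks, $q=q_0\mathcal R_1q_1\dots\mathcal R_nq_n$, where block $q_i$ consists of domain queries $r^i_0,\dots,r^i_{k_i}$ at consecutive time points, and $\mathcal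 R_i$ is a non-empty sequence of relations $<$ (for $\Diamond$) and $\le$ (for $\Diamond_r$) through intermediate points that carry no condition (only queries $\equiv_{\mathcal O}\top$). Block $q_i$ is primitive if $k_i=0$. The query is in *normal form* w.r.t. $\mathcal O$ if: (n1) $r^i_0\not\equiv_{\mathcal O}\top$ if $i>0$, and $r^i_{k_i}\not\equiv_{\mathcal O}\top$ if $i>0$ or $k_i>0$; (n2) each $\mathcal R_i$ is a single $\le$ or a sequence of $<$; (n3) $r^i_{k_i}\not\models_{\mathcal O}r^{i+1}_0$ if $q_{i+1}$ is primitive and $\mathcal R_{i+1}$ is $\le$; (n4) $r^{i+1}_0\not\models_{\mathcal O}r^i_{k_i}$ if $i>0$, $q_i$ is primitive and $\mathcal R_{i+1}$ is $\le$; (n5) $r^i_{k_i}\wedge r^{i+1}_0$ is satisfiable w.r.t. $\mathcal O$ if $\mathcal R_{i+1}$ is $\le$. A *lone conjunct* is a primitive block $q_i$, $i>0$, whose query $r^i_0$ is meet-reducible: $r^i_0\equiv_{\mathcal O}s_1\wedge s_2$ for some $s_1,s_2\in\mathcal Q$ with $r^i_0\not\equiv_{\mathcal O}s_1$ and $r^i_0\not\equiv_{\mathcal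 O}s_2$. A query in $\mathrm{LTL}_p^{\bigcirc\Diamond\Diamond_r}(\mathcal Q)$ is *safe* w.r.t. $\mathcal O$ if it is equivalent w.r.t. $\mathcal O$ to a query in $\mathrm{LTL}_p^{\bigcirc\Diamond\Diamond_r}(\mathcal Q)$ in normal form without lone conjuncts. **Theorem.** Suppose that $\mathcal O$ admits containment reduction and admits singular$^+$ characterisations within $\mathcal Q$. Then: (i) A query $q\in\mathrm{LTL}_p^{\bigcirc\Diamond\Diamond_r}(\mathcal Q)$ that is satisfiable w.r.t. $\mathcal O$ is uniquely characterisable within $\mathrm{LTL}_p^{\bigcirc\Diamond\Diamond_r}(\mathcal Q)$ w.r.t. $\mathcal O$ iff $q$ is safe w.r.t. $\mathcal O$. (ii) If $\mathcal O$ admits polynomial-size singular$^+$ characterisations within $\mathcal Q$, then there is a polynomial $f$ such that every satisfiable $q\in\mathrm{LTL}_p^{\bigcirc\Diamond\Diamond_r}(\mathcal Q)$ that is uniquely characterisable within $\mathrm{LTL}_p^{\bigcirc\Diamond\Diamond_r}(\mathcal Q)$ is uniquely characterised within this class by an example set of size at most $f(|q|)$. (iii) If $\mathcal O$ admits polynomial-size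 singular$^+$ characterisations within $\mathcal Q$, then there is a polynomial $f$ such that, for all $n$, every satisfiable $q\in\mathrm{LTL}_p^{\bigcirc\Diamond\Diamond_r}(\mathcal Q)$ of temporal depth at most $n$ is uniquely characterised, within the class of queries in $\mathrm{LTL}_p^{\bigcirc\Diamond\Diamond_r}(\mathcal Q)$ of temporal depth at most $n$, by an example set of size at most $f(|q|+n)$. (iv) Every satisfiable $q\in\mathrm{LTL}_p^{\bigcirc\Diamond}(\mathcal Q)$ is uniquely characterisable within $\mathrm{LTL}_p^{\bigcirc\Diamond}(\mathcal Q)$ w.r.t. $\mathcal O$. If $\mathcal O$ admits polynomial-size singular$^+$ characterisations within $\mathcal Q$, then there is a polynomial $f$ such that every such $q$ is uniquely characterised within $\mathrm{LTL}_p^{\bigcirc\Diamond}(\mathcal Q)$ by an example set of size at most $f(|q|)$. -/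

import Mathlib

namespace TemporalQuery

open FirstOrder

/-! ### Signatures, structures, ontologies, data instances

`U` and `B` are the types of unary and binary predicate symbols. Individual names form the
countably infinite set `ℕ`; query variables are also numbered by `ℕ`. -/

/-- Predicate symbols by arity. -/
inductive PredSym (U B : Type) : ℕ → Type
  | unary (A : U) : PredSym U B 1
  | binary (P : B) : PredSym U B 2

/-- The first-order language (with equality) of the signature. -/
def predLang (U B : Type) : Language := ⟨fun _ => Empty, PredSym U B⟩

/-- An ontology: a finite set of first-order sentences over the signature. -/
abbrev Ontology (U B : Type) := Finset (predLang U B).Sentence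

/-- A structure interpreting the predicate symbols and the individual names, distinct names
being interpreted by distinct elements. (Identifying `name a` with `a` gives the standard name
assumption.) -/
structure Interp (U B : Type) where
  Dom : Type
  unary : U → Dom → Prop
  binary : B → Dom → Dom → Prop
  name : ℕ → Dom
  name_injective : Function.Injective name

/-- The underlying first-order structure. -/
@[reducible] def Interp.foStructure {U B : Type} (I : Interp U B) :
    (predLang U B).Structure I.Dom where
  funMap := fun {_} f _ => nomatch f
  RelMap := fun {_} r => match r with
    | PredSym.unary A => fun v => I.unary A (v 0)
    | PredSym.binary P => fun v => I.binary P (v 0) (v 1)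

/-- `I` is a model of the ontology `O`. -/
def Interp.ModelsOnt {U B : Type} (I : Interp U B) (O : Ontology U B) : Prop :=
  ∀ φ ∈ O, @Language.Sentence.Realize (predLang U B) I.Dom I.foStructure φ

/-- Atoms `⊤(t)`, `A(t)`, `P(t,t')` over a set `T` of terms. The terms are individual names in
data instances and variables in queries. -/
inductive Atom (U B T : Type)
  | top (t : T)
  | unary (A : U) (t : T)
  | binary (P : B) (t t' : T)

namespace Atom

variable {U B : Type}

/-- The terms of an atom. -/
def terms : Atom U B ℕ → Finset ℕ
  | top t => {t}
  | unary _ t => {t}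
  | binary _ t t' => {t, t'}

/-- Renaming of terms. -/
def map (f : ℕ → ℕ) : Atom U B ℕ → Atom U B ℕ
  | top t => top (f t)
  | unary A t => unary A (f t)
  | binary P t t' => binary P (f t) (f t')

/-- Number of symbols (predicate symbol and terms). -/
def size : Atom U B ℕ → ℕ
  | top _ => 2
  | unary _ _ => 2
  | binary _ _ _ => 3

/-- Truth of an atom in `I` under an assignment of the terms. -/
def Sat (I : Interp U B) (v : ℕ → I.Dom) : Atom U B ℕ → Prop
  | top _ => True
  | unary A t => I.unary A (v t)
  | binary P t t' => I.binary P (v t) (v t')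

theorem terms_nonempty (α : Atom U B ℕ) : α.terms.Nonempty := by
  cases α <;> simp [terms]

end Atom

/-- A data instance: a non-empty finite set of atoms over individual names. -/
structure DataInstance (U B : Type) where
  atoms : Finset (Atom U B ℕ)
  nonempty : atoms.Nonempty

namespace DataInstance

variable {U B : Type}

/-- The individual names that occur in `A`. -/
def ind (A : DataInstance U B) : Finset ℕ := A.atoms.biUnion Atom.terms

theorem ind_nonempty (A : DataInstance U B) : A.ind.Nonempty := by
  obtain ⟨α, hα⟩ := A.nonempty
  obtain ⟨t, ht⟩ := α.terms_nonempty
  exact ⟨t, Finset.mem_biUnion.2 ⟨α, hα, ht⟩⟩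

/-- The number of atoms. -/
def size (A : DataInstance U B) : ℕ := A.atoms.card

/-- The data instance `{⊤(a) | a ∈ J}`. -/
def trivialOn (U B : Type) (J : Finset ℕ) (hJ : J.Nonempty) : DataInstance U B where
  atoms := J.map ⟨Atom.top, fun _ _ h => by cases h; rfl⟩
  nonempty := by simpa using hJ

end DataInstance

/-- `I` is a model of the data instance `A`. -/
def Interp.ModelsData {U B : Type} (I : Interp U B) (A : DataInstance U B) : Prop :=
  ∀ α ∈ A.atoms, α.Sat I I.name

/-- `O` and `A` have a common model. -/
def DataSatisfiable {U B : Type} (O : Ontology U B) (A : DataInstance U B) : Prop :=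
  ∃ I : Interp U B, I.ModelsOnt O ∧ I.ModelsData A

/-- A pointed data instance `(A, a)` with `a ∈ ind A`. -/
structure PointedData (U B : Type) where
  data : DataInstance U B
  pt : ℕ
  pt_mem : pt ∈ data.ind

/-! ### Domain queries -/

/-- A conjunctive query, given by its list of conjuncts, with the variable `0` as its only answer
variable; all other variables are existentially quantified. -/
structure CQ (U B : Type) where
  atoms : List (Atom U B ℕ)

namespace CQ

variable {U B : Type}

/-- The variables of `q`, including the answer variable. -/
def vars (q : CQ U B) : Set ℕ := {y | y = 0 ∨ ∃ α ∈ q.atoms, y ∈ α.terms}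

/-- Number of symbols. -/
def size (q : CQ U B) : ℕ := 1 + (q.atoms.map Atom.size).sum

/-- `I ⊨ q(d)`. -/
def Sat (I : Interp U B) (q : CQ U B) (d : I.Dom) : Prop :=
  ∃ v : ℕ → I.Dom, v 0 = d ∧ ∀ α ∈ q.atoms, α.Sat I v

/-- Renaming of the bound variables: odd numbers. -/
def renameLeft : ℕ → ℕ
  | 0 => 0
  | n + 1 => 2 * n + 1

/-- Renaming of the bound variables: positive even numbers. -/
def renameRight : ℕ → ℕ
  | 0 => 0
  | n + 1 => 2 * n + 2

/-- The conjunction `q₁(x) ∧ q₂(x)`: the answer variables are identified and the bound variables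
are renamed apart. -/
def conj (q₁ q₂ : CQ U B) : CQ U B :=
  ⟨q₁.atoms.map (Atom.map renameLeft) ++ q₂.atoms.map (Atom.map renameRight)⟩

end CQ

/-- A domain query: a conjunctive query or the inconsistency query `⊥(x)`. -/
inductive DomainQuery (U B : Type)
  | cq (q : CQ U B)
  | bot

namespace DomainQuery

variable {U B : Type}

/-- The query `⊤(x)`. -/
def top : DomainQuery U B := cq ⟨[Atom.top 0]⟩

/-- Number of symbols. -/
def size : DomainQuery U B → ℕ
  | cq q => q.size
  | bot => 1

/-- `I ⊨ q(d)`. -/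
def Sat (I : Interp U B) : DomainQuery U B → I.Dom → Prop
  | cq q, d => q.Sat I d
  | bot, _ => False

/-- Conjunction. -/
def conj : DomainQuery U B → DomainQuery U B → DomainQuery U B
  | cq q₁, cq q₂ => cq (q₁.conj q₂)
  | bot, _ => bot
  | cq _, bot => bot

end DomainQuery

section Domain

variable {U B : Type}

/-- `O, A ⊨ q(a)`: `a` is a certain answer to `q` over `A` with respect to `O`. -/
def Entails (O : Ontology U B) (A : DataInstance U B) (q : DomainQuery U B) (a : ℕ) : Prop :=
  ∀ I : Interp U B, I.ModelsOnt O → I.ModelsData A → q.Sat I (I.name a)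

/-- `O ∪ {q(x)}` has a model. -/
def Satisfiable (O : Ontology U B) (q : DomainQuery U B) : Prop :=
  ∃ I : Interp U B, I.ModelsOnt O ∧ ∃ d : I.Dom, q.Sat I d

/-- Containment `q₁ ⊨_O q₂`. -/
def Contained (O : Ontology U B) (q₁ q₂ : DomainQuery U B) : Prop :=
  ∀ p : PointedData U B, Entails O p.data q₁ p.pt → Entails O p.data q₂ p.pt

/-- Equivalence with respect to `O`. -/
def Equivalent (O : Ontology U B) (q₁ q₂ : DomainQuery U B) : Prop :=
  Contained O q₁ q₂ ∧ Contained O q₂ q₁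

/-- There is a surjective homomorphism from `q` to `p.data` that maps the answer variable
to `p.pt`. -/
def HasSurjHom (q : CQ U B) (p : PointedData U B) : Prop :=
  ∃ h : ℕ → ℕ, h 0 = p.pt ∧ h '' q.vars = (p.data.ind : Set ℕ) ∧
    (∀ A y, Atom.unary A y ∈ q.atoms → Atom.unary A (h y) ∈ p.data.atoms) ∧
    (∀ P y z, Atom.binary P y z ∈ q.atoms → Atom.binary P (h y) (h z) ∈ p.data.atoms)

/-- `p` is a pointed data instance `(q̂, a)` to which containment in other queries reduces. -/
structure IsHat (O : Ontology U B) (q : CQ U B) (p : PointedData U B) : Prop where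
  sat_iff : Satisfiable O (.cq q) ↔ DataSatisfiable O p.data
  surj_hom : HasSurjHom q p
  contained_iff : Satisfiable O (.cq q) →
    ∀ q' : CQ U B, Contained O (.cq q) (.cq q') ↔ Entails O p.data (.cq q') p.pt

/-- `O` admits containment reduction. -/
def AdmitsContainmentReduction (O : Ontology U B) : Prop :=
  ∀ q : CQ U B, ∃ p : PointedData U B, IsHat O q p

/-- Example sets of pointed data instances. -/
structure DomainExamples (U B : Type) where
  pos : Finset (PointedData U B)
  neg : Finset (PointedData U B)

/-- The size of an example set: the total size of its data instances. -/
def DomainExamples.size (E : DomainExamples U B) : ℕ :=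
  ∑ p ∈ E.pos, p.data.size + ∑ p ∈ E.neg, p.data.size

/-- `q` fits `E` with respect to `O`. -/
def DomainExamples.FitBy (E : DomainExamples U B) (O : Ontology U B) (q : DomainQuery U B) :
    Prop :=
  (∀ p ∈ E.pos, Entails O p.data q p.pt) ∧ ∀ p ∈ E.neg, ¬ Entails O p.data q p.pt

/-- `E` uniquely characterises `q` with respect to `O` within `Q`. -/
def DomainExamples.Characterises (E : DomainExamples U B) (O : Ontology U B)
    (Q : Set (DomainQuery U B)) (q : DomainQuery U B) : Prop :=
  E.FitBy O q ∧ ∀ q' ∈ Q, E.FitBy O q' → Equivalent O q q'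

/-- `E` is a singular⁺ characterisation of `q`: its only positive example is some `(q̂, a)`. -/
def DomainExamples.IsSingularPlus (E : DomainExamples U B) (O : Ontology U B)
    (Q : Set (DomainQuery U B)) (q : CQ U B) : Prop :=
  (∃ p : PointedData U B, IsHat O q p ∧ E.pos = {p}) ∧ E.Characterises O Q (.cq q)

/-- Every query in `Q` that is satisfiable with respect to `O` has a singular⁺ characterisation
within `Q`. (Satisfiable queries are never `⊥`.) -/
def AdmitsSingularPlus (O : Ontology U B) (Q : Set (DomainQuery U B)) : Prop :=
  ∀ q : CQ U B, .cq q ∈ Q → Satisfiable O (.cq q) →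
    ∃ E : DomainExamples U B, E.IsSingularPlus O Q q

/-- As before, with characterisations of size polynomial in the size of the query. -/
def AdmitsPolySingularPlus (O : Ontology U B) (Q : Set (DomainQuery U B)) : Prop :=
  ∃ f : Polynomial ℕ, ∀ q : CQ U B, .cq q ∈ Q → Satisfiable O (.cq q) →
    ∃ E : DomainExamples U B, E.IsSingularPlus O Q q ∧ E.size ≤ f.eval q.size

/-- `Q` is closed under conjunction. -/
def ConjClosed (Q : Set (DomainQuery U B)) : Prop :=
  ∀ q₁ ∈ Q, ∀ q₂ ∈ Q, q₁.conj q₂ ∈ Q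

/-- `r` is meet-reducible with respect to `O` within `Q`. -/
def MeetReducible (O : Ontology U B) (Q : Set (DomainQuery U B)) (r : DomainQuery U B) : Prop :=
  ∃ r₁ ∈ Q, ∃ r₂ ∈ Q, Equivalent O r (r₁.conj r₂) ∧ ¬ Equivalent O r r₁ ∧ ¬ Equivalent O r r₂

end Domain

/-! ### Temporal data and path queries -/

/-- A temporal data instance `A₀, …, A_max`, all `A_i` having the same individuals. -/
structure TemporalData (U B : Type) where
  max : ℕ
  facts : Fin (max + 1) → DataInstance U B
  ind_eq : ∀ i, (facts i).ind = (facts 0).ind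

namespace TemporalData

variable {U B : Type}

/-- The individuals of `D`. -/
def ind (D : TemporalData U B) : Finset ℕ := (D.facts 0).ind

/-- The data instance at time `ℓ`, which is `{⊤(a) | a ∈ ind D}` for `ℓ > max`. -/
def slice (D : TemporalData U B) (ℓ : ℕ) : DataInstance U B :=
  if h : ℓ < D.max + 1 then D.facts ⟨ℓ, h⟩
  else DataInstance.trivialOn U B D.ind (D.facts 0).ind_nonempty

/-- The total number of timestamped atoms. -/
def size (D : TemporalData U B) : ℕ := ∑ i, (D.facts i).size

/-- `O` and `D` are satisfiable. -/
def SatisfiableWrt (D : TemporalData U B) (O : Ontology U B) : Prop :=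
  ∀ i, DataSatisfiable O (D.facts i)

end TemporalData

/-- A pointed temporal data instance. -/
structure PointedTemporalData (U B : Type) where
  data : TemporalData U B
  pt : ℕ
  pt_mem : pt ∈ data.ind

/-- The temporal operators `◯` (next), `◇` (some time later), `◇_r` (now or later). -/
inductive TempOp
  | next
  | later
  | nowOrLater

/-- A path query `r₀ ∧ o₁(r₁ ∧ o₂(r₂ ∧ … ∧ oₙ rₙ))`: `head` is `r₀` and `tail` is
`(o₁, r₁), …, (oₙ, rₙ)`. -/
structure PathQuery (U B : Type) where
  head : DomainQuery U B
  tail : List (TempOp × DomainQuery U B)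

namespace PathQuery

variable {U B : Type}

/-- Truth at time `ℓ` of `r₀ ∧ o₁(r₁ ∧ …)`, for `D` satisfiable with respect to `O`. -/
def HoldsFrom (O : Ontology U B) (D : TemporalData U B) (a : ℕ) :
    ℕ → DomainQuery U B → List (TempOp × DomainQuery U B) → Prop
  | ℓ, r, [] => Entails O (D.slice ℓ) r a
  | ℓ, r, (.next, r') :: qs =>
      Entails O (D.slice ℓ) r a ∧ HoldsFrom O D a (ℓ + 1) r' qs
  | ℓ, r, (.later, r') :: qs =>
      Entails O (D.slice ℓ) r a ∧ ∃ m, ℓ < m ∧ HoldsFrom O D a m r' qs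
  | ℓ, r, (.nowOrLater, r') :: qs =>
      Entails O (D.slice ℓ) r a ∧ ∃ m, ℓ ≤ m ∧ HoldsFrom O D a m r' qs

/-- `O, D, ℓ, a ⊨ q`; everything is entailed if `O` and `D` are not satisfiable. -/
def EntailedAt (q : PathQuery U B) (O : Ontology U B) (D : TemporalData U B) (ℓ a : ℕ) : Prop :=
  D.SatisfiableWrt O → HoldsFrom O D a ℓ q.head q.tail

/-- Number of symbols: the domain queries, and one conjunction sign and one operator for each
further step. -/
def size (q : PathQuery U B) : ℕ := q.head.size + (q.tail.map fun s => s.2.size + 2).sum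

/-- Temporal depth. -/
def depth (q : PathQuery U B) : ℕ := q.tail.length

end PathQuery

section Temporal

variable {U B : Type}

/-- The class of path queries over `Q` with temporal operators in `Φ`. -/
def LTLp (Φ : Set TempOp) (Q : Set (DomainQuery U B)) : Set (PathQuery U B) :=
  {q | q.head ∈ Q ∧ ∀ s ∈ q.tail, s.1 ∈ Φ ∧ s.2 ∈ Q}

/-- Containment of path queries, evaluated at time `0`. -/
def TContained (O : Ontology U B) (q₁ q₂ : PathQuery U B) : Prop :=
  ∀ p : PointedTemporalData U B, q₁.EntailedAt O p.data 0 p.pt → q₂.EntailedAt O p.data 0 p.pt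

/-- Equivalence of path queries with respect to `O`. -/
def TEquivalent (O : Ontology U B) (q₁ q₂ : PathQuery U B) : Prop :=
  TContained O q₁ q₂ ∧ TContained O q₂ q₁

/-- `q` is satisfiable with respect to `O`: it holds at time `0` in some temporal data instance
that is satisfiable with respect to `O`. -/
def TSatisfiable (O : Ontology U B) (q : PathQuery U B) : Prop :=
  ∃ p : PointedTemporalData U B, p.data.SatisfiableWrt O ∧ q.EntailedAt O p.data 0 p.pt

/-- Example sets of pointed temporal data instances. -/
structure TemporalExamples (U B : Type) where
  pos : Finset (PointedTemporalData U B)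
  neg : Finset (PointedTemporalData U B)

/-- The size of an example set: the total size of its temporal data instances. -/
def TemporalExamples.size (E : TemporalExamples U B) : ℕ :=
  ∑ p ∈ E.pos, p.data.size + ∑ p ∈ E.neg, p.data.size

/-- `q` fits `E` with respect to `O`. -/
def TemporalExamples.FitBy (E : TemporalExamples U B) (O : Ontology U B) (q : PathQuery U B) :
    Prop :=
  (∀ p ∈ E.pos, q.EntailedAt O p.data 0 p.pt) ∧ ∀ p ∈ E.neg, ¬ q.EntailedAt O p.data 0 p.pt

/-- `E` uniquely characterises `q` with respect to `O` within the class `C`. -/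
def TemporalExamples.Characterises (E : TemporalExamples U B) (O : Ontology U B)
    (C : Set (PathQuery U B)) (q : PathQuery U B) : Prop :=
  E.FitBy O q ∧ ∀ q' ∈ C, E.FitBy O q' → TEquivalent O q q'

/-- `q` is uniquely characterisable with respect to `O` within `C`. -/
def UniquelyCharacterisable (O : Ontology U B) (C : Set (PathQuery U B)) (q : PathQuery U B) :
    Prop :=
  ∃ E : TemporalExamples U B, E.Characterises O C q

/-- All queries in `S` have characterisations within `C` whose size is bounded by one polynomial
in the size of the query. -/
def PolyCharacterisable (O : Ontology U B) (C S : Set (PathQuery U B)) : Prop :=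
  ∃ f : Polynomial ℕ, ∀ q ∈ S, ∃ E : TemporalExamples U B,
    E.Characterises O C q ∧ E.size ≤ f.eval q.size

/-- The queries in `C` of temporal depth at most `n`. -/
def depthAtMost (C : Set (PathQuery U B)) (n : ℕ) : Set (PathQuery U B) := {q ∈ C | q.depth ≤ n}

/-- For every `n`, all satisfiable queries in `C` of temporal depth at most `n` have
characterisations within the class of queries in `C` of temporal depth at most `n`, and their size
is bounded by one polynomial in the size of the query and `n`. -/
def PolyCharacterisableBoundedDepth (O : Ontology U B) (C : Set (PathQuery U B)) : Prop :=
  ∃ f : Polynomial ℕ, ∀ n : ℕ, ∀ q ∈ depthAtMost C n, TSatisfiable O q →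
    ∃ E : TemporalExamples U B,
      E.Characterises O (depthAtMost C n) q ∧ E.size ≤ f.eval (q.size + n)

end Temporal

/-! ### Blocks, normal form, safety -/

/-- A block `r₀(s₀) suc(s₀,s₁) r₁(s₁) … r_k(s_k)`: `first` is `r₀` and `rest` is `r₁, …, r_k`. -/
structure Block (U B : Type) where
  first : DomainQuery U B
  rest : List (DomainQuery U B)

/-- The query `r_k` at the last point of a block. -/
def Block.last {U B : Type} (b : Block U B) : DomainQuery U B := b.rest.getLastD b.first

/-- A block is primitive if it has only one point. -/
def Block.Primitive {U B : Type} (b : Block U B) : Prop := b.rest = []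

/-- The relations `<` and `≤` between time points. -/
inductive TimeRel
  | lt
  | le

/-- The operator that expresses a relation: `◇` for `<` and `◇_r` for `≤`. -/
def TimeRel.op : TimeRel → TempOp
  | lt => .later
  | le => .nowOrLater

/-- A non-empty sequence `R₁(t₀,t₁) … R_m(t_{m-1},t_m)` leading from the last point `t₀` of a block
to the first point `t_m` of the next one: `inner` lists `R₁, …, R_{m-1}` together with the queries
at `t₁, …, t_{m-1}`, and `final` is `R_m`. The intermediate points carry no condition, that is,
only queries equivalent to `⊤` (see `BlockForm.FreeInner`). -/
structure Connector (U B : Type) where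
  inner : List (TimeRel × DomainQuery U B)
  final : TimeRel

/-- The connector is a single `≤`. -/
def Connector.IsLe {U B : Type} (c : Connector U B) : Prop := c.inner = [] ∧ c.final = .le

/-- The connector is a sequence of `<`. -/
def Connector.IsLtSeq {U B : Type} (c : Connector U B) : Prop :=
  (∀ s ∈ c.inner, s.1 = .lt) ∧ c.final = .lt

/-- A query `q₀ R₁ q₁ … Rₙ qₙ` divided into blocks: `conn i` connects block `i` to
block `i + 1`. -/
structure BlockForm (U B : Type) where
  n : ℕ
  block : Fin (n + 1) → Block U B
  conn : Fin n → Connector U B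

namespace BlockForm

variable {U B : Type}

/-- The `suc`-steps within a block. -/
def blockSteps (b : Block U B) : List (TempOp × DomainQuery U B) :=
  b.rest.map fun r => (TempOp.next, r)

/-- The steps through a connector to the first point of the next block. -/
def connSteps (c : Connector U B) (b : Block U B) : List (TempOp × DomainQuery U B) :=
  (c.inner.map fun s => (s.1.op, s.2)) ++ [(c.final.op, b.first)]

/-- The path query represented by a block form. -/
def toPath (F : BlockForm U B) : PathQuery U B where
  head := (F.block 0).first
  tail := blockSteps (F.block 0) ++
    (List.ofFn fun i : Fin F.n =>
      connSteps (F.conn i) (F.block i.succ) ++ blockSteps (F.block i.succ)).flatten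

/-- The intermediate points of the connectors carry no condition. -/
def FreeInner (F : BlockForm U B) (O : Ontology U B) : Prop :=
  ∀ i, ∀ s ∈ (F.conn i).inner, Equivalent O s.2 DomainQuery.top

/-- Normal form with respect to `O`. -/
structure IsNormal (F : BlockForm U B) (O : Ontology U B) : Prop where
  free : F.FreeInner O
  n1_first : ∀ i, i ≠ 0 → ¬ Equivalent O (F.block i).first DomainQuery.top
  n1_last : ∀ i, (i ≠ 0 ∨ ¬ (F.block i).Primitive) →
    ¬ Equivalent O (F.block i).last DomainQuery.top
  n2 : ∀ i, (F.conn i).IsLe ∨ (F.conn i).IsLtSeq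
  n3 : ∀ i : Fin F.n, (F.block i.succ).Primitive → (F.conn i).IsLe →
    ¬ Contained O (F.block i.castSucc).last (F.block i.succ).first
  n4 : ∀ i : Fin F.n, i.castSucc ≠ 0 → (F.block i.castSucc).Primitive → (F.conn i).IsLe →
    ¬ Contained O (F.block i.succ).first (F.block i.castSucc).last
  n5 : ∀ i : Fin F.n, (F.conn i).IsLe →
    Satisfiable O ((F.block i.castSucc).last.conj (F.block i.succ).first)

/-- Block `i` is a lone conjunct with respect to `O` within `Q`. -/
def IsLoneConjunct (F : BlockForm U B) (O : Ontology U B) (Q : Set (DomainQuery U B))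
    (i : Fin (F.n + 1)) : Prop :=
  i ≠ 0 ∧ (F.block i).Primitive ∧ MeetReducible O Q (F.block i).first

end BlockForm

/-- `q` is safe with respect to `O`: it is equivalent to a path query over `Q` in normal form
without lone conjuncts. -/
def Safe {U B : Type} (O : Ontology U B) (Q : Set (DomainQuery U B)) (q : PathQuery U B) : Prop :=
  ∃ F : BlockForm U B, F.toPath ∈ LTLp Set.univ Q ∧ F.IsNormal O ∧
    (∀ i, ¬ F.IsLoneConjunct O Q i) ∧ TEquivalent O q F.toPath

end TemporalQuery

open TemporalQuery

/-! The truth of a path query depends only on the trace of the data, that is, on which domain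
queries hold at which times. At this level every path query has a normal form whose size is linear
in its depth: blocks of consecutive points, where block `i + 1` starts at least `d i` points after
the end of block `i`, and `d i = 0` expresses `≤` (`exists_normal`). A singular⁺ characterisation of
a domain query `r` supplies letters: a data instance `r̂` that entails exactly the consequences of
`r`, and finitely many instances that do not entail `r` but among which every strictly weaker query
of `Q` is entailed somewhere (`exists_isSplit`).

Replace each query of a normal form `q` by its letter `r̂` and separate the blocks by long empty
gaps. The resulting word is rigid: if some blocks are replaced by another finite word, every match
of `q` still has to put those blocks inside the replacement (`modify_rigid`). So the word can be
damaged locally in ways that provably destroy `q`. The examples are finitely many such words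
(`Candidate`), positive or negative according to whether `q` holds. Let a normal form `p` agree with
`q` on them. Then `p` matches the undamaged word, and by induction on the blocks of `q` each of them
must coincide with the block of `p` of the same index, since otherwise `p` would survive a damage
that `q` does not. Words with prescribed gaps then determine the distances (`stronger_of_agree`).

The only obstacle is a primitive non-initial block `r` of `q`, where `p` could place several queries
linked by `≤`, each strictly weaker than `r`. There are three ways out (`fixed_of_primitive`). If
`r` is not meet-reducible, the conjunction of these queries is still strictly weaker than `r`, so a
single negative letter satisfies them all. If `p` has no `≤`, there is only one of them. If `p` has
fewer than `N` steps, the list of negative letters repeated `N` times accommodates them one after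
the other. These cases yield the sufficiency of safety, the class without `◇_r`, and bounded depth,
respectively.

Conversely, let `r` be equivalent to `r₁ ∧ r₂` with both conjuncts strictly weaker. Replace `r` by
`r₁ ≤ r₂ ≤ r₁ ≤ r₂ ≤ …`, longer than all given examples. By the pigeonhole principle `r₁` and `r₂`
meet at one point of each example that satisfies the new query, so the examples cannot tell it from
`q`; yet a word alternating between the letters of `r₁` and `r₂` shows that it is not equivalent to
`q` (`not_uniquelyCharacterisable`). -/

namespace TemporalQuery
open FirstOrder

variable {U B : Type}

/-! ### Conjunction, renaming of individuals, trivial data -/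

theorem Atom.sat_map (I : Interp U B) (v : ℕ → I.Dom) (f : ℕ → ℕ) (α : Atom U B ℕ) :
    (α.map f).Sat I v ↔ α.Sat I (v ∘ f) := by
  cases α <;> simp [Atom.map, Atom.Sat]

theorem CQ.sat_conj (I : Interp U B) (q₁ q₂ : CQ U B) (d : I.Dom) :
    (q₁.conj q₂).Sat I d ↔ q₁.Sat I d ∧ q₂.Sat I d := by
  constructor
  · rintro ⟨v, hv, h⟩
    simp only [CQ.conj, List.mem_append, List.mem_map] at h
    refine ⟨⟨v ∘ CQ.renameLeft, by simpa [CQ.renameLeft] using hv, fun α hα => ?_⟩,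
      ⟨v ∘ CQ.renameRight, by simpa [CQ.renameRight] using hv, fun α hα => ?_⟩⟩
    · exact (Atom.sat_map I v _ α).1 (h _ (Or.inl ⟨α, hα, rfl⟩))
    · exact (Atom.sat_map I v _ α).1 (h _ (Or.inr ⟨α, hα, rfl⟩))
  · rintro ⟨⟨v, hv, h⟩, ⟨w, hw, h'⟩⟩
    -- Odd numbers decode the variables renamed by `renameLeft`, even ones those renamed by
    -- `renameRight`; `0` is treated as even, which is harmless because `v` and `w` agree there.
    let u : ℕ → I.Dom := fun m => if m % 2 = 1 then v ((m + 1) / 2) else w (m / 2)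
    have h1 : u ∘ CQ.renameLeft = v := by
      funext m
      cases m with
      | zero => simp [u, CQ.renameLeft, hv, hw]
      | succ m =>
        have e : (2 * m + 1 + 1) / 2 = m + 1 := by omega
        have e' : (2 * m + 1) % 2 = 1 := by omega
        simp only [u, Function.comp, CQ.renameLeft, e, e', if_true]
    have h2 : u ∘ CQ.renameRight = w := by
      funext m
      cases m with
      | zero => simp [u, CQ.renameRight]
      | succ m =>
        have e : (2 * m + 2) / 2 = m + 1 := by omega
        have e' : ¬ (2 * m + 2) % 2 = 1 := by omega
        simp only [u, Function.comp, CQ.renameRight, e, e', if_false]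
    refine ⟨u, by simpa [u] using hw, fun α hα => ?_⟩
    simp only [CQ.conj, List.mem_append, List.mem_map] at hα
    rcases hα with ⟨β, hβ, rfl⟩ | ⟨β, hβ, rfl⟩
    · rw [Atom.sat_map, h1]; exact h β hβ
    · rw [Atom.sat_map, h2]; exact h' β hβ

theorem DomainQuery.sat_conj (I : Interp U B) (r s : DomainQuery U B) (d : I.Dom) :
    (r.conj s).Sat I d ↔ r.Sat I d ∧ s.Sat I d := by
  cases r <;> cases s <;> simp [DomainQuery.conj, DomainQuery.Sat, CQ.sat_conj]

theorem Atom.size_map (f : ℕ → ℕ) (α : Atom U B ℕ) : (α.map f).size = α.size := by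
  cases α <;> rfl

theorem DomainQuery.size_conj (r s : DomainQuery U B) : (r.conj s).size ≤ r.size + s.size := by
  rcases r with q | _ <;> rcases s with q' | _ <;>
    simp [DomainQuery.conj, DomainQuery.size, CQ.size, CQ.conj, Function.comp_def, Atom.size_map]
  simp only [show (fun x : Atom U B ℕ => x.size) = Atom.size from rfl]
  omega

theorem entails_conj {O : Ontology U B} {A : DataInstance U B} {r s : DomainQuery U B} {a : ℕ} :
    Entails O A (r.conj s) a ↔ Entails O A r a ∧ Entails O A s a := by
  simp only [Entails, DomainQuery.sat_conj]
  exact ⟨fun h => ⟨fun I h1 h2 => (h I h1 h2).1, fun I h1 h2 => (h I h1 h2).2⟩,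
    fun h I h1 h2 => ⟨h.1 I h1 h2, h.2 I h1 h2⟩⟩

theorem Contained.refl (O : Ontology U B) (r : DomainQuery U B) : Contained O r r :=
  fun _ h => h

theorem Contained.trans {O : Ontology U B} {r s t : DomainQuery U B} (h : Contained O r s)
    (h' : Contained O s t) : Contained O r t := fun p hp => h' p (h p hp)

theorem contained_conj_left (O : Ontology U B) (r s : DomainQuery U B) :
    Contained O (r.conj s) r := fun _ h => (entails_conj.1 h).1

theorem contained_conj_right (O : Ontology U B) (r s : DomainQuery U B) :
    Contained O (r.conj s) s := fun _ h => (entails_conj.1 h).2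

theorem contained_conj {O : Ontology U B} {r s t : DomainQuery U B} (h : Contained O t r)
    (h' : Contained O t s) : Contained O t (r.conj s) :=
  fun p hp => entails_conj.2 ⟨h p hp, h' p hp⟩

theorem entails_top (O : Ontology U B) (A : DataInstance U B) (a : ℕ) :
    Entails O A DomainQuery.top a := by
  intro I _ _
  exact ⟨fun _ => I.name a, rfl, fun α hα => by
    simp only [List.mem_singleton] at hα; subst hα; trivial⟩

theorem contained_top (O : Ontology U B) (r : DomainQuery U B) :
    Contained O r DomainQuery.top := fun p _ => entails_top O p.data p.pt

/-- `r` carries no condition: it is equivalent to `⊤`. -/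
def IsTop (O : Ontology U B) (r : DomainQuery U B) : Prop := Equivalent O r DomainQuery.top

theorem isTop_iff {O : Ontology U B} {r : DomainQuery U B} :
    IsTop O r ↔ Contained O DomainQuery.top r :=
  ⟨fun h => h.2, fun h => ⟨contained_top O r, h⟩⟩

theorem IsTop.contained {O : Ontology U B} {r : DomainQuery U B} (h : IsTop O r)
    (s : DomainQuery U B) : Contained O s r := (contained_top O s).trans (isTop_iff.1 h)

/-- Change of the interpretation of the individual names by a permutation. -/
@[reducible] def Interp.rename (I : Interp U B) (g : Equiv.Perm ℕ) : Interp U B :=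
  { I with name := I.name ∘ g, name_injective := I.name_injective.comp g.injective }

theorem Interp.rename_modelsOnt {I : Interp U B} {O : Ontology U B} (g : Equiv.Perm ℕ)
    (h : I.ModelsOnt O) : (I.rename g).ModelsOnt O := h

theorem Interp.rename_cqSat {I : Interp U B} (g : Equiv.Perm ℕ) (q : CQ U B) (d : I.Dom) :
    q.Sat (I.rename g) d ↔ q.Sat I d := by
  unfold CQ.Sat
  refine exists_congr fun v => and_congr Iff.rfl (forall₂_congr fun α _ => ?_)
  cases α <;> rfl

theorem Interp.rename_sat {I : Interp U B} (g : Equiv.Perm ℕ) (r : DomainQuery U B) (d : I.Dom) :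
    r.Sat (I.rename g) d ↔ r.Sat I d := by
  cases r with
  | cq q => exact Interp.rename_cqSat g q d
  | bot => exact Iff.rfl

/-- Ontologies and queries mention no individual names, so a permutation of the names changes the
truth of neither. In any model of `O` the name `a` can be made to denote what `p.pt` denotes, and
the facts `⊤(b)` stay true. -/
theorem isTop_of_entails_trivialOn {O : Ontology U B} {r : DomainQuery U B} {J : Finset ℕ}
    {hJ : J.Nonempty} {a : ℕ} (h : Entails O (DataInstance.trivialOn U B J hJ) r a) :
    IsTop O r := by
  refine isTop_iff.2 fun p _ I hI _ => ?_
  have := h (I.rename (Equiv.swap a p.pt)) (Interp.rename_modelsOnt _ hI) (by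
    intro α hα
    simp only [DataInstance.trivialOn, Finset.mem_map] at hα
    obtain ⟨b, _, rfl⟩ := hα
    trivial)
  have e := (Interp.rename_sat (I := I) (Equiv.swap a p.pt) r _).1 this
  simpa using e

theorem ind_trivialOn (J : Finset ℕ) (hJ : J.Nonempty) :
    (DataInstance.trivialOn U B J hJ).ind = J := by
  ext a
  simp only [DataInstance.ind, DataInstance.trivialOn, Finset.mem_biUnion, Finset.mem_map]
  constructor
  · rintro ⟨_, ⟨b, hb, rfl⟩, h⟩
    exact Finset.mem_singleton.1 h ▸ hb
  · exact fun h => ⟨_, ⟨a, h, rfl⟩, Finset.mem_singleton_self a⟩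

theorem IsTop.entails {O : Ontology U B} {r : DomainQuery U B} (h : IsTop O r)
    {A : DataInstance U B} {a : ℕ} (ha : a ∈ A.ind) : Entails O A r a :=
  isTop_iff.1 h ⟨A, a, ha⟩ (entails_top O A a)

theorem Contained.entails {O : Ontology U B} {r s : DomainQuery U B} (h : Contained O r s)
    {A : DataInstance U B} {a : ℕ} (ha : a ∈ A.ind) (h' : Entails O A r a) : Entails O A s a :=
  h ⟨A, a, ha⟩ h'

theorem satisfiable_of_entails {O : Ontology U B} {A : DataInstance U B} {r : DomainQuery U B}
    {a : ℕ} (hA : DataSatisfiable O A) (h : Entails O A r a) : Satisfiable O r := by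
  obtain ⟨I, h1, h2⟩ := hA
  exact ⟨I, h1, _, h I h1 h2⟩

theorem dataSatisfiable_of_not_entails {O : Ontology U B} {A : DataInstance U B}
    {r : DomainQuery U B} {a : ℕ} (h : ¬ Entails O A r a) : DataSatisfiable O A := by
  simp only [Entails, not_forall] at h
  obtain ⟨I, h1, h2, _⟩ := h
  exact ⟨I, h1, h2⟩

theorem dataSatisfiable_trivialOn {O : Ontology U B} {A : DataInstance U B} {J : Finset ℕ}
    (hJ : J.Nonempty) (hA : DataSatisfiable O A) :
    DataSatisfiable O (DataInstance.trivialOn U B J hJ) := by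
  obtain ⟨I, h1, _⟩ := hA
  refine ⟨I, h1, fun α hα => ?_⟩
  simp only [DataInstance.trivialOn, Finset.mem_map] at hα
  obtain ⟨b, _, rfl⟩ := hα
  trivial

/-! ### Letters: data instances over a fixed set of individuals with answer `0` -/

theorem exists_perm_lt (n : ℕ) (s : Finset ℕ) (hs : s.card ≤ n) :
    ∃ g : Equiv.Perm ℕ, ∀ a ∈ s, g a < n := by
  induction s using Finset.induction_on with
  | empty => exact ⟨1, by simp⟩
  | insert a s ha ih =>
    rw [Finset.card_insert_of_notMem ha] at hs
    obtain ⟨g, hg⟩ := ih (by omega)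
    have : ∃ b ∈ Finset.range n, b ∉ s.image g := by
      apply Finset.exists_mem_notMem_of_card_lt_card
      calc _ ≤ s.card := Finset.card_image_le
        _ < _ := by simpa using hs
    obtain ⟨b, hb, hbs⟩ := this
    refine ⟨g.trans (Equiv.swap (g a) b), fun c hc => ?_⟩
    rcases Finset.mem_insert.1 hc with rfl | hc
    · simpa using hb
    · have h1 : g c ≠ g a := fun h => ha (g.injective h ▸ hc)
      have h2 : g c ≠ b := fun h => hbs (Finset.mem_image.2 ⟨c, hc, h⟩)
      simpa [Equiv.swap_apply_of_ne_of_ne h1 h2] using hg c hc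

theorem exists_perm_lt_zero (n : ℕ) (s : Finset ℕ) (hs : s.card ≤ n) (a : ℕ) (ha : a ∈ s) :
    ∃ g : Equiv.Perm ℕ, g a = 0 ∧ ∀ b ∈ s, g b < n := by
  obtain ⟨g, hg⟩ := exists_perm_lt n s hs
  refine ⟨g.trans (Equiv.swap (g a) 0), by simp, fun b hb => ?_⟩
  have h1 := hg a ha
  have h2 := hg b hb
  simp only [Equiv.trans_apply, Equiv.swap_apply_def]
  split_ifs <;> omega

theorem DataInstance.card_ind_le (A : DataInstance U B) : A.ind.card ≤ 2 * A.size := by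
  rw [mul_comm]
  apply Finset.card_biUnion_le_card_mul
  intro α _
  cases α with
  | top t => simp [Atom.terms]
  | unary A t => simp [Atom.terms]
  | binary P t t' => exact Finset.card_le_two

theorem Atom.terms_map (g : ℕ → ℕ) (α : Atom U B ℕ) : (α.map g).terms = α.terms.image g := by
  cases α <;> simp [Atom.map, Atom.terms, Finset.image_insert]

/-- The slices of temporal data must share their individuals, so all instances are moved to the
individuals `0, …, 2S` with answer `0`. Since `S` atoms contain at most `2S` names, a permutation of
the names achieves this, and the missing individuals are added by atoms `⊤(b)`, which carry no
information. Models of the two instances correspond by reinterpreting the names. -/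
theorem DataInstance.exists_renamed (O : Ontology U B) (S : ℕ) (p : PointedData U B)
    (hp : p.data.size ≤ S) :
    ∃ x : DataInstance U B, x.ind = Finset.range (2 * S + 1) ∧ x.size ≤ 3 * S + 1 ∧
      (DataSatisfiable O p.data → DataSatisfiable O x) ∧
      ∀ r, Entails O x r 0 ↔ Entails O p.data r p.pt := by
  classical
  obtain ⟨g, hg0, hg⟩ := exists_perm_lt_zero (2 * S + 1) p.data.ind
    (by have := p.data.card_ind_le; omega) p.pt p.pt_mem
  let x : DataInstance U B :=
    ⟨p.data.atoms.image (Atom.map g) ∪ (Finset.range (2 * S + 1)).image Atom.top,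
      by obtain ⟨α, hα⟩ := p.data.nonempty
         exact ⟨_, Finset.mem_union_left _ (Finset.mem_image_of_mem _ hα)⟩⟩
  have key : ∀ I : Interp U B, I.ModelsData x ↔ (I.rename g).ModelsData p.data := by
    intro I
    have hs : ∀ α : Atom U B ℕ, (α.map g).Sat I I.name ↔ α.Sat (I.rename g) (I.rename g).name := by
      intro α; cases α <;> rfl
    constructor
    · intro h α hα
      exact (hs α).1 (h _ (Finset.mem_union_left _ (Finset.mem_image_of_mem _ hα)))
    · intro h α hα
      rcases Finset.mem_union.1 hα with hα | hα
      · obtain ⟨β, hβ, rfl⟩ := Finset.mem_image.1 hα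
        exact (hs β).2 (h β hβ)
      · obtain ⟨b, _, rfl⟩ := Finset.mem_image.1 hα
        trivial
  have key' : ∀ I : Interp U B, I.ModelsData p.data → (I.rename g.symm).ModelsData x := by
    intro I h
    rw [key]
    have : (I.rename g.symm).rename g = I := by
      cases I; simp [Interp.rename, Function.comp_assoc]
    rwa [this]
  refine ⟨x, ?_, ?_, ?_, fun r => ⟨fun h I h1 h2 => ?_, fun h I h1 h2 => ?_⟩⟩
  · ext b
    simp only [DataInstance.ind, Finset.mem_biUnion]
    constructor
    · rintro ⟨α, hα, hb⟩
      rcases Finset.mem_union.1 hα with hα | hα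
      · obtain ⟨β, hβ, rfl⟩ := Finset.mem_image.1 hα
        rw [Atom.terms_map] at hb
        obtain ⟨c, hc, rfl⟩ := Finset.mem_image.1 hb
        exact Finset.mem_range.2 (hg c (Finset.mem_biUnion.2 ⟨β, hβ, hc⟩))
      · obtain ⟨c, hc, rfl⟩ := Finset.mem_image.1 hα
        simp only [Atom.terms, Finset.mem_singleton] at hb
        exact hb ▸ hc
    · intro hb
      exact ⟨Atom.top b, Finset.mem_union_right _ (Finset.mem_image_of_mem _ hb),
        by simp [Atom.terms]⟩
  · calc x.size ≤ _ := Finset.card_union_le _ _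
      _ ≤ p.data.atoms.card + (Finset.range (2 * S + 1)).card :=
        add_le_add Finset.card_image_le Finset.card_image_le
      _ ≤ S + (2 * S + 1) := by
        rw [Finset.card_range]; exact Nat.add_le_add_right hp _
      _ = _ := by ring
  · rintro ⟨I, h1, h2⟩
    exact ⟨I.rename g.symm, Interp.rename_modelsOnt _ h1, key' I h2⟩
  · have := (Interp.rename_sat g.symm r _).1
      (h (I.rename g.symm) (Interp.rename_modelsOnt _ h1) (key' I h2))
    have e : g.symm 0 = p.pt := by rw [← hg0]; simp
    simpa [e] using this
  · have := (Interp.rename_sat g r _).1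
      (h (I.rename g) (Interp.rename_modelsOnt _ h1) ((key I).1 h2))
    simpa [hg0] using this

/-- A letter: a satisfiable data instance with individuals `0, …, 2S` and bounded size. -/
structure IsLetter (O : Ontology U B) (S : ℕ) (x : DataInstance U B) : Prop where
  ind_eq : x.ind = Finset.range (2 * S + 1)
  size_le : x.size ≤ 3 * S + 1
  sat : DataSatisfiable O x

/-- The letter without information. -/
def emptyLetter (U B : Type) (S : ℕ) : DataInstance U B :=
  DataInstance.trivialOn U B (Finset.range (2 * S + 1)) (Finset.nonempty_range_iff.2 (Nat.succ_ne_zero _))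

theorem ind_emptyLetter (S : ℕ) : (emptyLetter U B S).ind = Finset.range (2 * S + 1) :=
  ind_trivialOn _ _

theorem isLetter_empty {O : Ontology U B} {A : DataInstance U B} (hA : DataSatisfiable O A)
    (S : ℕ) : IsLetter O S (emptyLetter U B S) :=
  ⟨ind_emptyLetter S, by simp [emptyLetter, DataInstance.trivialOn, DataInstance.size]; omega,
    dataSatisfiable_trivialOn _ hA⟩

theorem entails_empty_iff {O : Ontology U B} {S : ℕ} {r : DomainQuery U B} :
    Entails O (emptyLetter U B S) r 0 ↔ IsTop O r :=
  ⟨isTop_of_entails_trivialOn, fun h => h.entails (by rw [ind_emptyLetter]; simp)⟩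

/-- The letters of `r`: `h` is `r̂`, and `N` consists of negative examples. -/
structure IsSplit (O : Ontology U B) (Q : Set (DomainQuery U B)) (S : ℕ) (r : DomainQuery U B)
    (h : DataInstance U B) (N : Finset (DataInstance U B)) : Prop where
  letter : IsLetter O S h
  entails_iff : ∀ s, Entails O h s 0 ↔ Contained O r s
  neg_letter : ∀ x ∈ N, IsLetter O S x
  neg_not : ∀ x ∈ N, ¬ Entails O x r 0
  neg_of : ∀ s ∈ Q, Contained O r s → ¬ Contained O s r → ∃ x ∈ N, Entails O x s 0
  card_le : N.card ≤ S

/-- A query that is strictly weaker than `q` is entailed by `q̂`, the only positive example. Were it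
entailed by no negative example, it would fit `E` and be equivalent to `q`. Negative examples are
satisfiable because unsatisfiable data would entail `q`, and there are at most `S` of them because
each contains an atom. -/
theorem exists_isSplit {O : Ontology U B} {Q : Set (DomainQuery U B)} {S : ℕ} {q : CQ U B}
    (hq : Satisfiable O (.cq q)) {E : DomainExamples U B} (hE : E.IsSingularPlus O Q q)
    (hS : E.size ≤ S) : ∃ h N, IsSplit O Q S (.cq q) h N := by
  classical
  obtain ⟨⟨p, hp, hpos⟩, hfit, hchar⟩ := hE
  have hsize : p.data.size + ∑ p ∈ E.neg, p.data.size ≤ S := by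
    simpa [DomainExamples.size, hpos] using hS
  have hneg : ∀ p ∈ E.neg, p.data.size ≤ S := fun p' hp' =>
    (Finset.single_le_sum (f := fun p : PointedData U B => p.data.size)
      (fun _ _ => Nat.zero_le _) hp').trans (by omega)
  obtain ⟨h, h1, h2, h3, h4⟩ := DataInstance.exists_renamed O S p (by omega)
  have hpsat : DataSatisfiable O p.data := hp.sat_iff.1 hq
  -- Containment reduction speaks of conjunctive queries only. The query `⊥` is entailed neither by
  -- the satisfiable `q̂` nor, for the same reason, by `q`.
  have hhat : ∀ s, Entails O p.data s p.pt ↔ Contained O (.cq q) s := by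
    intro s
    cases s with
    | cq q' => exact (hp.contained_iff hq q').symm
    | bot =>
      have hno : ¬ Entails O p.data .bot p.pt := by
        obtain ⟨I, hI, hI'⟩ := hpsat
        exact fun h => h I hI hI'
      refine ⟨fun h => (hno h).elim, fun h => h p ?_⟩
      exact (hp.contained_iff hq q).1 (Contained.refl O _)
  have hren : ∀ p' : PointedData U B, ∃ x : DataInstance U B, p' ∈ E.neg → IsLetter O S x ∧
      ∀ r, Entails O x r 0 ↔ Entails O p'.data r p'.pt := by
    intro p'
    by_cases hp' : p' ∈ E.neg
    · obtain ⟨x, hx1, hx2, hx3, hx4⟩ := DataInstance.exists_renamed O S p' (hneg p' hp')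
      exact ⟨x, fun _ => ⟨⟨hx1, hx2, hx3 (dataSatisfiable_of_not_entails (hfit.2 p' hp'))⟩, hx4⟩⟩
    · exact ⟨p'.data, fun h => (hp' h).elim⟩
  choose f hf using hren
  refine ⟨h, E.neg.image f, ⟨h1, h2, h3 hpsat⟩, fun s => (h4 s).trans (hhat s), ?_, ?_, ?_, ?_⟩
  · intro x hx
    obtain ⟨p', hp', rfl⟩ := Finset.mem_image.1 hx
    exact (hf p' hp').1
  · intro x hx
    obtain ⟨p', hp', rfl⟩ := Finset.mem_image.1 hx
    rw [(hf p' hp').2]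
    exact hfit.2 p' hp'
  · intro s hs hqs hsq
    by_contra! hcon
    refine hsq (hchar s hs ⟨?_, ?_⟩).2
    · rw [hpos]
      intro p' hp'
      rw [Finset.mem_singleton.1 hp']
      exact (hhat s).2 hqs
    · intro p' hp' hent
      exact hcon (f p') (Finset.mem_image_of_mem f hp') (((hf p' hp').2 s).2 hent)
  · calc _ ≤ E.neg.card := Finset.card_image_le
      _ = ∑ p ∈ E.neg, 1 := by simp
      _ ≤ ∑ p ∈ E.neg, p.data.size := Finset.sum_le_sum fun p _ =>
          Finset.card_pos.2 p.data.nonempty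
      _ ≤ S := by omega

/-! ### Traces -/

/-- A trace records which domain queries hold at which time points. -/
abbrev Trace (U B : Type) := ℕ → DomainQuery U B → Prop

/-- The trace of a temporal data instance. -/
def TemporalData.trace (D : TemporalData U B) (O : Ontology U B) (a : ℕ) : Trace U B :=
  fun ℓ r => Entails O (D.slice ℓ) r a

/-- Properties shared by the traces of satisfiable temporal data instances. -/
structure GoodTrace (O : Ontology U B) (V : Trace U B) : Prop where
  mono : ∀ {ℓ r s}, Contained O r s → V ℓ r → V ℓ s
  top : ∀ {ℓ r}, IsTop O r → V ℓ r
  conj : ∀ {ℓ r s}, V ℓ r → V ℓ s → V ℓ (r.conj s)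
  sat : ∀ {ℓ r}, V ℓ r → Satisfiable O r

theorem TemporalData.ind_slice (D : TemporalData U B) (ℓ : ℕ) : (D.slice ℓ).ind = D.ind := by
  unfold TemporalData.slice
  split_ifs
  · exact D.ind_eq _
  · exact ind_trivialOn _ _

theorem TemporalData.sat_slice {D : TemporalData U B} {O : Ontology U B}
    (hD : D.SatisfiableWrt O) (ℓ : ℕ) : DataSatisfiable O (D.slice ℓ) := by
  unfold TemporalData.slice
  split_ifs
  · exact hD _
  · exact dataSatisfiable_trivialOn _ (hD 0)

theorem goodTrace_trace {D : TemporalData U B} {O : Ontology U B} {a : ℕ}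
    (hD : D.SatisfiableWrt O) (ha : a ∈ D.ind) : GoodTrace O (D.trace O a) where
  mono h h' := h.entails ((D.ind_slice _).symm ▸ ha) h'
  top h := h.entails ((D.ind_slice _).symm ▸ ha)
  conj h h' := entails_conj.2 ⟨h, h'⟩
  sat h := satisfiable_of_entails (TemporalData.sat_slice hD _) h

/-- The relation between time points expressed by a temporal operator. -/
def TempOp.Rel : TempOp → ℕ → ℕ → Prop
  | next, ℓ, m => m = ℓ + 1
  | later, ℓ, m => ℓ < m
  | nowOrLater, ℓ, m => ℓ ≤ m

/-- The steps `o₁ r₁, o₂ r₂, …` can be taken from time `ℓ` on. -/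
def StepsHold (V : Trace U B) : ℕ → List (TempOp × DomainQuery U B) → Prop
  | _, [] => True
  | ℓ, (o, r) :: qs => ∃ m, o.Rel ℓ m ∧ V m r ∧ StepsHold V m qs

theorem holdsFrom_iff (O : Ontology U B) (D : TemporalData U B) (a : ℕ)
    (qs : List (TempOp × DomainQuery U B)) : ∀ (ℓ : ℕ) (r : DomainQuery U B),
    PathQuery.HoldsFrom O D a ℓ r qs ↔ D.trace O a ℓ r ∧ StepsHold (D.trace O a) ℓ qs := by
  induction qs with
  | nil => intro ℓ r; simp [PathQuery.HoldsFrom, StepsHold, TemporalData.trace]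
  | cons p qs ih =>
    intro ℓ r
    obtain ⟨o, r'⟩ := p
    cases o <;> simp [PathQuery.HoldsFrom, StepsHold, TempOp.Rel, ih, TemporalData.trace]

/-- Truth of a path query in a trace at time `0`. -/
def PathQuery.HoldsIn (q : PathQuery U B) (V : Trace U B) : Prop :=
  V 0 q.head ∧ StepsHold V 0 q.tail

theorem PathQuery.entailedAt_iff (q : PathQuery U B) (O : Ontology U B) (D : TemporalData U B)
    (a : ℕ) : q.EntailedAt O D 0 a ↔ (D.SatisfiableWrt O → q.HoldsIn (D.trace O a)) := by
  unfold PathQuery.EntailedAt PathQuery.HoldsIn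
  simp only [holdsFrom_iff]

theorem tEquivalent_of_holdsIn {O : Ontology U B} {q q' : PathQuery U B}
    (h : ∀ V, GoodTrace O V → (q.HoldsIn V ↔ q'.HoldsIn V)) : TEquivalent O q q' := by
  have key : ∀ p : PointedTemporalData U B,
      q.EntailedAt O p.data 0 p.pt ↔ q'.EntailedAt O p.data 0 p.pt := by
    intro p
    simp only [PathQuery.entailedAt_iff]
    exact forall_congr' fun hD => h _ (goodTrace_trace hD p.pt_mem)
  exact ⟨fun p => (key p).1, fun p => (key p).2⟩

/-! ### Block sequences -/

/-- The query at point `j` of a block. -/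
def Block.get (b : Block U B) (j : ℕ) : DomainQuery U B :=
  (b.first :: b.rest).getD j DomainQuery.top

/-- The index of the last point of a block. -/
def Block.len (b : Block U B) : ℕ := b.rest.length

theorem Block.get_zero (b : Block U B) : b.get 0 = b.first := rfl

theorem Block.last_cons (r x : DomainQuery U B) (l : List (DomainQuery U B)) :
    (Block.mk r (x :: l)).last = (Block.mk x l).last := by
  cases l <;> simp [Block.last, List.getLastD_eq_getLast?, List.getLast?_cons]

theorem Block.get_len (b : Block U B) : b.get b.len = b.last := by
  obtain ⟨r, l⟩ := b
  induction l generalizing r with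
  | nil => rfl
  | cons x l ih => rw [Block.last_cons, ← ih]; rfl

theorem Block.last_of_len {b : Block U B} (h : b.len = 0) : b.last = b.first := by
  rw [← b.get_len, h, Block.get_zero]

theorem Block.len_eq_zero {b : Block U B} : b.len = 0 ↔ b.Primitive := List.length_eq_zero_iff

/-- The block is true at time `ℓ`. -/
def Block.HoldsAt (b : Block U B) (V : Trace U B) (ℓ : ℕ) : Prop :=
  ∀ j ≤ b.len, V (ℓ + j) (b.get j)

theorem Block.holdsAt_nil {V : Trace U B} {ℓ : ℕ} {r : DomainQuery U B} :
    (Block.mk r []).HoldsAt V ℓ ↔ V ℓ r := by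
  simp [Block.HoldsAt, Block.len, Block.get]

theorem Block.holdsAt_cons {V : Trace U B} {ℓ : ℕ} {r x : DomainQuery U B}
    {l : List (DomainQuery U B)} :
    (Block.mk r (x :: l)).HoldsAt V ℓ ↔ V ℓ r ∧ (Block.mk x l).HoldsAt V (ℓ + 1) := by
  constructor
  · intro h
    refine ⟨h 0 (Nat.zero_le _), fun j hj => ?_⟩
    have := h (j + 1) (Nat.succ_le_succ hj)
    rw [add_right_comm]
    exact this
  · rintro ⟨h1, h2⟩ j hj
    cases j with
    | zero => exact h1
    | succ j =>
      have := h2 j (Nat.le_of_succ_le_succ hj)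
      rw [add_right_comm] at this
      exact this

theorem Block.HoldsAt.first {b : Block U B} {V : Trace U B} {ℓ : ℕ} (h : b.HoldsAt V ℓ) :
    V ℓ b.first := h 0 (Nat.zero_le _)

/-- The blocks `(d₁, b₁), (d₂, b₂), …` are true after time `e`, where block `i` starts at least
`dᵢ` time points after the end of the preceding one. -/
def BlocksHold (V : Trace U B) : ℕ → List (ℕ × Block U B) → Prop
  | _, [] => True
  | e, (d, b) :: t => ∃ m, e + d ≤ m ∧ b.HoldsAt V m ∧ BlocksHold V (m + b.len) t

/-- The distance `dᵢ` expressed by a connector. -/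
noncomputable def Connector.dist (c : Connector U B) : ℕ := by
  classical exact if c.IsLe then 0 else c.inner.length + 1

theorem Connector.dist_eq_zero {c : Connector U B} : c.dist = 0 ↔ c.IsLe := by
  unfold Connector.dist
  split_ifs with h <;> simp [h]

/-- The intermediate points carry no condition, so they can be packed directly after `ℓ`; only their
number matters. -/
theorem stepsHold_lt {O : Ontology U B} {V : Trace U B} (hV : GoodTrace O V)
    (r : DomainQuery U B) (qs : List (TempOp × DomainQuery U B))
    (l : List (TimeRel × DomainQuery U B)) (h1 : ∀ s ∈ l, s.1 = .lt)
    (h2 : ∀ s ∈ l, IsTop O s.2) : ∀ ℓ,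
    StepsHold V ℓ ((l.map fun s => (s.1.op, s.2)) ++ (TempOp.later, r) :: qs) ↔
      ∃ m, ℓ + (l.length + 1) ≤ m ∧ V m r ∧ StepsHold V m qs := by
  induction l with
  | nil => intro ℓ; simp [StepsHold, TempOp.Rel]
  | cons s l ih =>
    intro ℓ
    obtain ⟨o, x⟩ := s
    have ho : o = .lt := h1 (o, x) List.mem_cons_self
    have hx : IsTop O x := h2 (o, x) List.mem_cons_self
    subst ho
    have ih := ih (fun s hs => h1 s (List.mem_cons_of_mem _ hs))
      (fun s hs => h2 s (List.mem_cons_of_mem _ hs))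
    simp only [List.map_cons, List.cons_append, StepsHold, ih, List.length_cons]
    constructor
    · rintro ⟨m, hm, _, m', hm', h⟩
      have hm : ℓ < m := hm
      exact ⟨m', by omega, h⟩
    · rintro ⟨m', hm', h⟩
      exact ⟨ℓ + 1, Nat.lt_succ_self ℓ, hV.top hx, m', by omega, h⟩

theorem stepsHold_conn {O : Ontology U B} {V : Trace U B} (hV : GoodTrace O V)
    {c : Connector U B} (hc : c.IsLe ∨ c.IsLtSeq) (hf : ∀ s ∈ c.inner, IsTop O s.2)
    (b : Block U B) (qs : List (TempOp × DomainQuery U B)) (ℓ : ℕ) :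
    StepsHold V ℓ (BlockForm.connSteps c b ++ qs) ↔
      ∃ m, ℓ + c.dist ≤ m ∧ V m b.first ∧ StepsHold V m qs := by
  rcases hc with hc | hc
  · rw [Connector.dist_eq_zero.2 hc]
    obtain ⟨h1, h2⟩ := hc
    simp [BlockForm.connSteps, h1, h2, StepsHold, TimeRel.op, TempOp.Rel]
  · have hne : ¬ c.IsLe := by
      intro h; have := h.2; rw [hc.2] at this; cases this
    have hd : c.dist = c.inner.length + 1 := by simp [Connector.dist, hne]
    rw [hd, ← stepsHold_lt hV _ _ _ hc.1 hf]
    simp [BlockForm.connSteps, hc.2, TimeRel.op]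

theorem stepsHold_block (V : Trace U B) (qs : List (TempOp × DomainQuery U B))
    (b : Block U B) (ℓ : ℕ) :
    (V ℓ b.first ∧ StepsHold V ℓ (BlockForm.blockSteps b ++ qs)) ↔
      b.HoldsAt V ℓ ∧ StepsHold V (ℓ + b.len) qs := by
  obtain ⟨r, l⟩ := b
  induction l generalizing r ℓ with
  | nil => simp [Block.holdsAt_nil, BlockForm.blockSteps, Block.len]
  | cons x l ih =>
    have := ih (ℓ + 1) x
    simp only [BlockForm.blockSteps, Block.len, List.map_cons, List.cons_append, StepsHold,
      TempOp.Rel, exists_eq_left, Block.holdsAt_cons, List.length_cons] at this ⊢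
    rw [this, and_assoc, show ℓ + 1 + l.length = ℓ + (l.length + 1) by omega]

theorem stepsHold_flatten {O : Ontology U B} {V : Trace U B} (hV : GoodTrace O V)
    (l : List (Connector U B × Block U B)) (hc : ∀ p ∈ l, p.1.IsLe ∨ p.1.IsLtSeq)
    (hf : ∀ p ∈ l, ∀ s ∈ p.1.inner, IsTop O s.2) : ∀ ℓ,
    StepsHold V ℓ (l.map fun p =>
        BlockForm.connSteps p.1 p.2 ++ BlockForm.blockSteps p.2).flatten ↔
      BlocksHold V ℓ (l.map fun p => (p.1.dist, p.2)) := by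
  induction l with
  | nil => intro ℓ; simp [StepsHold, BlocksHold]
  | cons p l ih =>
    intro ℓ
    have ih := ih (fun p hp => hc p (List.mem_cons_of_mem _ hp))
      (fun p hp => hf p (List.mem_cons_of_mem _ hp))
    simp only [List.map_cons, List.flatten_cons, List.append_assoc, BlocksHold]
    rw [stepsHold_conn hV (hc p List.mem_cons_self) (hf p List.mem_cons_self)]
    simp only [stepsHold_block, ih]

/-! ### Normal form of block sequences -/

/-- The conditions of the normal form on the relation `≤` between `b` and a primitive `b'`, and
on the conjunction that `≤` allows. -/
def Link (O : Ontology U B) (b : Block U B) (p : ℕ × Block U B) : Prop :=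
  p.1 = 0 → (p.2.len = 0 → ¬ Contained O b.last p.2.first) ∧
    Satisfiable O (b.last.conj p.2.first)

/-- The condition of the normal form on the relation `≤` between a primitive `b` and `b'`. -/
def BackLink (O : Ontology U B) (b : Block U B) (p : ℕ × Block U B) : Prop :=
  p.1 = 0 → b.len = 0 → ¬ Contained O p.2.first b.last

/-- The conditions of the normal form on non-initial blocks. -/
def TailNormal (O : Ontology U B) : List (ℕ × Block U B) → Prop
  | [] => True
  | p :: t => ¬ IsTop O p.2.first ∧ ¬ IsTop O p.2.last ∧
      (∀ p' ∈ t.head?, Link O p.2 p' ∧ BackLink O p.2 p') ∧ TailNormal O t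

/-- The sequence with initial block `b` and further blocks `t` is in normal form. -/
structure ListNormal (O : Ontology U B) (b : Block U B) (t : List (ℕ × Block U B)) : Prop where
  last : b.len ≠ 0 → ¬ IsTop O b.last
  link : ∀ p ∈ t.head?, Link O b p
  tail : TailNormal O t

/-- The number of points and steps in the non-initial blocks. -/
def weight (t : List (ℕ × Block U B)) : ℕ := (t.map fun p => max p.1 1 + p.2.len + 1).sum

/-- The queries of `b` belong to `R`. -/
def Block.Over (b : Block U B) (R : Set (DomainQuery U B)) : Prop :=
  b.first ∈ R ∧ ∀ x ∈ b.rest, x ∈ R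

/-- The queries of `t` belong to `R`, and `R` contains `⊤` if `t` requires it. -/
def ListOver (O : Ontology U B) (R : Set (DomainQuery U B)) (t : List (ℕ × Block U B)) : Prop :=
  ∀ p ∈ t, p.2.Over R ∧ (2 ≤ p.1 → ∃ x ∈ R, IsTop O x)

/-- `t'` uses no more resources than `t`. -/
structure Below (O : Ontology U B) (t' t : List (ℕ × Block U B)) : Prop where
  length_le : t'.length ≤ t.length
  weight_le : weight t' ≤ weight t
  res : ∀ R, ListOver O R t → ListOver O R t'
  pos : (∀ p ∈ t, 1 ≤ p.1) → ∀ p ∈ t', 1 ≤ p.1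

theorem Below.refl (O : Ontology U B) (t : List (ℕ × Block U B)) : Below O t t :=
  ⟨le_rfl, le_rfl, fun _ h => h, fun h => h⟩

theorem Below.trans {O : Ontology U B} {t t' t'' : List (ℕ × Block U B)} (h : Below O t t')
    (h' : Below O t' t'') : Below O t t'' :=
  ⟨h.length_le.trans h'.length_le, h.weight_le.trans h'.weight_le,
    fun R hR => h.res R (h'.res R hR), fun hp => h.pos (h'.pos hp)⟩

theorem below_tail (O : Ontology U B) (p : ℕ × Block U B) (t : List (ℕ × Block U B)) :
    Below O t (p :: t) :=
  ⟨by simp, by simp [weight], fun R h q hq => h q (List.mem_cons_of_mem _ hq),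
    fun h q hq => h q (List.mem_cons_of_mem _ hq)⟩

/-- Repairs the link from a primitive block `r` to what follows. A primitive block that follows by
`≤` and is implied by `r` can be evaluated at the point of `r` itself, so it is dropped and the next
block is examined. If `r` is inconsistent with the query that follows by `≤`, the two points cannot
coincide, and `≤` becomes `<`. -/
theorem exists_tailNormal_link (O : Ontology U B) (r : DomainQuery U B)
    (t : List (ℕ × Block U B)) (ht : TailNormal O t) :
    ∃ t', TailNormal O t' ∧ (∀ p ∈ t'.head?, Link O ⟨r, []⟩ p) ∧ Below O t' t ∧
      ∀ V, GoodTrace O V → ∀ e, V e r → (BlocksHold V e t ↔ BlocksHold V e t') := by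
  induction t with
  | nil => exact ⟨[], trivial, by simp, Below.refl O _, fun _ _ _ _ => Iff.rfl⟩
  | cons p t ih =>
    obtain ⟨d, b⟩ := p
    by_cases hd : d = 0
    swap
    · exact ⟨_, ht, by simp [Link, hd], Below.refl O _, fun _ _ _ _ => Iff.rfl⟩
    subst hd
    by_cases h1 : b.len = 0 ∧ Contained O r b.first
    · obtain ⟨t', a1, a2, a3, a4⟩ := ih ht.2.2.2
      refine ⟨t', a1, a2, a3.trans (below_tail O _ _), fun V hV e he => ?_⟩
      rw [← a4 V hV e he]
      simp only [BlocksHold, h1.1]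
      constructor
      · rintro ⟨m, hm, _, h⟩
        cases t with
        | nil => trivial
        | cons p t =>
          obtain ⟨m', hm', h⟩ := h
          exact ⟨m', by omega, h⟩
      · intro h
        refine ⟨e, le_rfl, fun j hj => ?_, h⟩
        rw [h1.1] at hj
        obtain rfl : j = 0 := by omega
        exact hV.mono h1.2 he
    by_cases h2 : Satisfiable O (r.conj b.first)
    · refine ⟨_, ht, ?_, Below.refl O _, fun _ _ _ _ => Iff.rfl⟩
      simp only [List.head?_cons, Option.mem_some_iff]
      rintro _ rfl _
      exact ⟨fun hl hc => h1 ⟨hl, hc⟩, h2⟩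
    -- Passing from distance `0` to `1` leaves the weight unchanged, since `weight` counts `max d
    -- 1`.
    · refine ⟨(1, b) :: t, ht, by simp [Link], ⟨le_rfl, by simp [weight], ?_, ?_⟩, ?_⟩
      · intro R hR p hp
        rcases List.mem_cons.1 hp with rfl | hp
        · exact ⟨(hR (0, b) List.mem_cons_self).1, fun h => absurd h (by norm_num)⟩
        · exact hR p (List.mem_cons_of_mem _ hp)
      · intro h p hp
        rcases List.mem_cons.1 hp with rfl | hp
        · exact le_rfl
        · exact h p (List.mem_cons_of_mem _ hp)
      · intro V hV e he
        simp only [BlocksHold]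
        constructor
        · rintro ⟨m, hm, hb, h⟩
          refine ⟨m, ?_, hb, h⟩
          by_contra hcon
          obtain rfl : m = e := by omega
          exact h2 (hV.sat (hV.conj he hb.first))
        · rintro ⟨m, hm, hb, h⟩
          exact ⟨m, by omega, hb, h⟩

/-- Makes an initial block fit to stand at distance `d` after another block. A trivial first point
only contributes to the distance: it is removed, and `d` grows by one or, if the block was
primitive, by the distance to the next block. A primitive block implied by the query that follows by
`≤` can be moved to the point of that query, so it is dropped and the next block inherits `d`. -/
theorem exists_tailNormal_cons (O : Ontology U B) (t : List (ℕ × Block U B))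
    (l : List (DomainQuery U B)) : ∀ (r : DomainQuery U B) (d : ℕ), ListNormal O ⟨r, l⟩ t →
    ∃ t', TailNormal O t' ∧ Below O t' ((d, ⟨r, l⟩) :: t) ∧
      ∀ V, GoodTrace O V → ∀ e, (BlocksHold V e ((d, ⟨r, l⟩) :: t) ↔ BlocksHold V e t') := by
  induction l with
  | nil =>
    intro r d hN
    by_cases hr : IsTop O r
    · cases t with
      | nil =>
        refine ⟨[], trivial, below_tail O _ _, fun V hV e => ?_⟩
        simp only [BlocksHold, iff_true]
        exact ⟨e + d, le_rfl, Block.holdsAt_nil.2 (hV.top hr), trivial⟩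
      | cons p t =>
        obtain ⟨d', b'⟩ := p
        refine ⟨(d + d', b') :: t, hN.tail, ⟨by simp, ?_, ?_, ?_⟩, fun V hV e => ?_⟩
        · simp only [weight, List.map_cons, List.sum_cons]
          omega
        · intro R hR p hp
          rcases List.mem_cons.1 hp with rfl | hp
          · exact ⟨(hR _ (List.mem_cons_of_mem _ List.mem_cons_self)).1,
              fun _ => ⟨r, (hR _ List.mem_cons_self).1.1, hr⟩⟩
          · exact hR p (List.mem_cons_of_mem _ (List.mem_cons_of_mem _ hp))
        · intro h p hp
          rcases List.mem_cons.1 hp with rfl | hp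
          · exact (h _ List.mem_cons_self).trans (Nat.le_add_right _ _)
          · exact h p (List.mem_cons_of_mem _ (List.mem_cons_of_mem _ hp))
        · simp only [BlocksHold, Block.len, List.length_nil, Nat.add_zero, Block.holdsAt_nil]
          constructor
          · rintro ⟨m, hm, _, m', hm', h⟩
            exact ⟨m', by omega, h⟩
          · rintro ⟨m', hm', h⟩
            exact ⟨e + d, le_rfl, hV.top hr, m', by omega, h⟩
    · have hkeep : (∀ p ∈ t.head?, BackLink O ⟨r, []⟩ p) →
          TailNormal O ((d, ⟨r, []⟩) :: t) := fun h =>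
        ⟨hr, hr, fun p hp => ⟨hN.link p hp, h p hp⟩, hN.tail⟩
      cases t with
      | nil => exact ⟨_, hkeep (by simp), Below.refl O _, fun _ _ _ => Iff.rfl⟩
      | cons p t =>
        obtain ⟨d', b'⟩ := p
        by_cases hb : BackLink O ⟨r, []⟩ (d', b')
        · exact ⟨_, hkeep (by simpa using hb), Below.refl O _, fun _ _ _ => Iff.rfl⟩
        · unfold BackLink at hb
          push Not at hb
          obtain ⟨h0, _, hc⟩ := hb
          simp only at h0
          subst h0
          refine ⟨(d, b') :: t, hN.tail, ⟨by simp, ?_, ?_, ?_⟩, fun V hV e => ?_⟩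
          · simp only [weight, List.map_cons, List.sum_cons]
            omega
          · intro R hR p hp
            rcases List.mem_cons.1 hp with rfl | hp
            · exact ⟨(hR _ (List.mem_cons_of_mem _ List.mem_cons_self)).1,
                (hR _ List.mem_cons_self).2⟩
            · exact hR p (List.mem_cons_of_mem _ (List.mem_cons_of_mem _ hp))
          · intro h p hp
            rcases List.mem_cons.1 hp with rfl | hp
            · exact h (d, ⟨r, []⟩) List.mem_cons_self
            · exact h p (List.mem_cons_of_mem _ (List.mem_cons_of_mem _ hp))
          · simp only [BlocksHold, Block.len, List.length_nil, Nat.add_zero, Block.holdsAt_nil]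
            constructor
            · rintro ⟨m, hm, _, m', hm', h⟩
              exact ⟨m', by omega, h⟩
            · rintro ⟨m', hm', h⟩
              exact ⟨m', hm', hV.mono hc h.1.first, m', le_rfl, h⟩
  | cons x l ih =>
    intro r d hN
    have hlast : ¬ IsTop O (Block.mk r (x :: l)).last := hN.last (by simp [Block.len])
    by_cases hr : IsTop O r
    · have hN' : ListNormal O ⟨x, l⟩ t := by
        refine ⟨fun _ => ?_, fun p hp => ?_, hN.tail⟩
        · rwa [Block.last_cons] at hlast
        · have := hN.link p hp
          unfold Link at this ⊢
          rwa [Block.last_cons] at this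
      obtain ⟨t', a1, a2, a3⟩ := ih x (d + 1) hN'
      refine ⟨t', a1, a2.trans ⟨by simp, ?_, ?_, ?_⟩, fun V hV e => ?_⟩
      · simp only [weight, List.map_cons, List.sum_cons, Block.len, List.length_cons]
        omega
      · intro R hR p hp
        rcases List.mem_cons.1 hp with rfl | hp
        · have := (hR _ List.mem_cons_self).1
          exact ⟨⟨this.2 x List.mem_cons_self, fun y hy => this.2 y (List.mem_cons_of_mem _ hy)⟩,
            fun _ => ⟨r, this.1, hr⟩⟩
        · exact hR p (List.mem_cons_of_mem _ hp)
      · intro h p hp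
        rcases List.mem_cons.1 hp with rfl | hp
        · exact Nat.le_add_left _ _
        · exact h p (List.mem_cons_of_mem _ hp)
      · rw [← a3 V hV]
        simp only [BlocksHold, Block.holdsAt_cons, Block.len, List.length_cons]
        constructor
        · rintro ⟨m, hm, ⟨_, h1⟩, h2⟩
          exact ⟨m + 1, by omega, h1, by rwa [add_right_comm, add_assoc]⟩
        · rintro ⟨m, hm, h1, h2⟩
          obtain ⟨m, rfl⟩ : ∃ k, m = k + 1 := ⟨m - 1, by omega⟩
          exact ⟨m, by omega, ⟨hV.top hr, h1⟩, by rwa [add_right_comm, add_assoc] at h2⟩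
    · refine ⟨(d, ⟨r, x :: l⟩) :: t, ⟨hr, hlast, fun p hp => ⟨hN.link p hp, fun _ h => ?_⟩, hN.tail⟩,
        Below.refl O _, fun _ _ _ => Iff.rfl⟩
      simp [Block.len] at h

/-- `b, t` is a normal form of `r` followed by the steps `qs`, over the same queries. -/
structure IsNormalForm (O : Ontology U B) (r : DomainQuery U B)
    (qs : List (TempOp × DomainQuery U B)) (b : Block U B) (t : List (ℕ × Block U B)) :
    Prop where
  normal : ListNormal O b t
  holds_iff : ∀ V, GoodTrace O V → ∀ ℓ, (V ℓ r ∧ StepsHold V ℓ qs ↔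
    b.HoldsAt V ℓ ∧ BlocksHold V (ℓ + b.len) t)
  length_le : t.length ≤ qs.length
  weight_le : b.len + weight t ≤ 2 * qs.length
  res : ∀ R : Set (DomainQuery U B), r ∈ R → (∀ s ∈ qs, s.2 ∈ R) → b.Over R ∧ ListOver O R t
  pos : (∀ s ∈ qs, s.1 ≠ .nowOrLater) → ∀ p ∈ t, 1 ≤ p.1

/-- Every path query has a normal form. -/
theorem exists_isNormalForm (O : Ontology U B) (qs : List (TempOp × DomainQuery U B)) :
    ∀ r : DomainQuery U B, ∃ b t, IsNormalForm O r qs b t := by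
  induction qs with
  | nil =>
    intro r
    refine ⟨⟨r, []⟩, [], ⟨by simp [Block.len], by simp, trivial⟩, fun V _ ℓ => ?_, le_rfl, by
      simp [weight, Block.len], fun R hr _ => ⟨⟨hr, by simp⟩, by simp [ListOver]⟩, by simp⟩
    simp [StepsHold, BlocksHold, Block.holdsAt_nil]
  | cons s qs ih =>
    intro r
    obtain ⟨o, x⟩ := s
    obtain ⟨b, t, hN, heq, hlen, hw, hover, hpos⟩ := ih x
    -- The case in which the head `r` forms a block of its own; `d` is `0` for `◇_r` and `1`
    -- otherwise.
    have key : ∀ d ≤ 1, (∀ V, GoodTrace O V → ∀ ℓ,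
        (StepsHold V ℓ ((o, x) :: qs) ↔ BlocksHold V ℓ ((d, b) :: t))) →
        (o ≠ .nowOrLater → d = 1) → ∃ b t, IsNormalForm O r ((o, x) :: qs) b t := by
      intro d hd hd' hd1
      obtain ⟨t1, a1, a2, a3⟩ := exists_tailNormal_cons O t b.rest b.first d hN
      obtain ⟨t2, c1, c2, c3, c4⟩ := exists_tailNormal_link O r t1 a1
      have hb := c3.trans a2
      refine ⟨⟨r, []⟩, t2, ⟨by simp [Block.len], c2, c1⟩, fun V hV ℓ => ?_, ?_, ?_, ?_, ?_⟩
      · rw [hd' V hV, Block.holdsAt_nil]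
        refine and_congr_right fun hr => ?_
        exact (a3 V hV ℓ).trans (c4 V hV ℓ hr)
      · have := hb.length_le
        simp only [List.length_cons] at this ⊢
        omega
      · have := hb.weight_le
        simp only [weight, List.map_cons, List.sum_cons, List.length_cons, Block.len,
          List.length_nil] at this hw ⊢
        omega
      · intro R hr hR
        obtain ⟨h1, h2⟩ := hover R (hR _ List.mem_cons_self)
          fun s hs => hR s (List.mem_cons_of_mem _ hs)
        refine ⟨⟨hr, by simp⟩, hb.res R ?_⟩
        intro p hp
        rcases List.mem_cons.1 hp with rfl | hp
        · exact ⟨h1, fun h => by simp only at h; omega⟩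
        · exact h2 p hp
      · intro h
        refine hb.pos fun p hp => ?_
        rcases List.mem_cons.1 hp with rfl | hp
        · exact (hd1 (h _ List.mem_cons_self)).ge
        · exact hpos (fun s hs => h s (List.mem_cons_of_mem _ hs)) p hp
    cases o with
    | next =>
      -- If the block after `◯` is a single trivial point, attaching it to `r` would violate (n1).
      -- But then the point at `ℓ + 1` is always available and the step says no more than `◇`, so
      -- distance `1` can be used.
      by_cases htop : b.len = 0 ∧ IsTop O b.first
      · refine key 1 le_rfl (fun V hV ℓ => ?_) fun _ => rfl
        simp only [StepsHold, TempOp.Rel, exists_eq_left, heq V hV, BlocksHold, htop.1]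
        constructor
        · rintro ⟨h1, h2⟩
          exact ⟨ℓ + 1, le_rfl, h1, h2⟩
        · rintro ⟨m, hm, h1, h2⟩
          refine ⟨fun j hj => ?_, ?_⟩
          · rw [htop.1] at hj
            obtain rfl : j = 0 := by omega
            exact hV.top htop.2
          · cases t with
            | nil => trivial
            | cons p t =>
              obtain ⟨m', hm', h⟩ := h2
              exact ⟨m', by omega, h⟩
      · have hlast : ¬ IsTop O b.last := by
          intro h
          by_cases h0 : b.len = 0
          · exact htop ⟨h0, Block.last_of_len h0 ▸ h⟩
          · exact hN.last h0 h
        have hl : (Block.mk r (b.first :: b.rest)).last = b.last := Block.last_cons _ _ _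
        refine ⟨⟨r, b.first :: b.rest⟩, t, ⟨fun _ => hl ▸ hlast, fun p hp => ?_, hN.tail⟩,
          fun V hV ℓ => ?_, ?_, ?_, ?_, ?_⟩
        · have := hN.link p hp
          unfold Link at this ⊢
          rwa [hl]
        · rw [Block.holdsAt_cons]
          simp only [StepsHold, TempOp.Rel, exists_eq_left, heq V hV, Block.len,
            List.length_cons, and_assoc]
          rw [show ℓ + 1 + b.rest.length = ℓ + (b.rest.length + 1) by omega]
        · simp only [List.length_cons]; omega
        · simp only [List.length_cons, Block.len] at hw ⊢; omega
        · intro R hr hR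
          obtain ⟨h1, h2⟩ := hover R (hR _ List.mem_cons_self)
            fun s hs => hR s (List.mem_cons_of_mem _ hs)
          refine ⟨⟨hr, fun y hy => ?_⟩, h2⟩
          rcases List.mem_cons.1 hy with rfl | hy
          · exact h1.1
          · exact h1.2 y hy
        · intro h
          exact hpos fun s hs => h s (List.mem_cons_of_mem _ hs)
    | later =>
      refine key 1 le_rfl (fun V hV ℓ => ?_) fun _ => rfl
      simp only [StepsHold, TempOp.Rel, heq V hV, BlocksHold, Nat.succ_le_iff]
    | nowOrLater =>
      refine key 0 (Nat.zero_le _) (fun V hV ℓ => ?_) fun h => (h rfl).elim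
      simp only [StepsHold, TempOp.Rel, heq V hV, BlocksHold, Nat.add_zero]

/-! ### Indexed block sequences -/

/-- A sequence of blocks `0, …, n`, where block `i + 1` starts at least `d i` time points after
the end of block `i`. -/
structure BlockSeq (U B : Type) where
  n : ℕ
  blk : ℕ → Block U B
  d : ℕ → ℕ

namespace BlockSeq

/-- The index of the last point of block `i`. -/
abbrev k (q : BlockSeq U B) (i : ℕ) : ℕ := (q.blk i).len

/-- The blocks are true in `V` at the time points given by `s`. -/
structure Matches (q : BlockSeq U B) (V : Trace U B) (s : ℕ → ℕ) : Prop where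
  zero : s 0 = 0
  step : ∀ i < q.n, s i + q.k i + q.d i ≤ s (i + 1)
  holds : ∀ i ≤ q.n, (q.blk i).HoldsAt V (s i)

/-- Normal form. -/
structure Normal (q : BlockSeq U B) (O : Ontology U B) : Prop where
  first : ∀ i ≤ q.n, 0 < i → ¬ IsTop O (q.blk i).first
  last : ∀ i ≤ q.n, 0 < i ∨ 0 < q.k i → ¬ IsTop O (q.blk i).last
  link : ∀ i < q.n, q.d i = 0 → q.k (i + 1) = 0 →
    ¬ Contained O (q.blk i).last (q.blk (i + 1)).first
  back : ∀ i < q.n, 0 < i → q.d i = 0 → q.k i = 0 →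
    ¬ Contained O (q.blk (i + 1)).first (q.blk i).last
  sat : ∀ i < q.n, q.d i = 0 → Satisfiable O ((q.blk i).last.conj (q.blk (i + 1)).first)

/-- The indexed form of a list of blocks. -/
def ofList (b : Block U B) (t : List (ℕ × Block U B)) : BlockSeq U B where
  n := t.length
  blk i := (b :: t.map Prod.snd).getD i ⟨DomainQuery.top, []⟩
  d i := (t.map Prod.fst).getD i 0

theorem ofList_blk_succ {b : Block U B} {t : List (ℕ × Block U B)} {i : ℕ} (h : i < t.length) :
    (ofList b t).blk (i + 1) = t[i].2 := by
  simp [ofList, h]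

theorem ofList_d {b : Block U B} {t : List (ℕ × Block U B)} {i : ℕ} (h : i < t.length) :
    (ofList b t).d i = t[i].1 := by
  simp [ofList, h]

theorem blocksHold_iff (V : Trace U B) (t : List (ℕ × Block U B)) : ∀ (b : Block U B) (ℓ : ℕ),
    b.HoldsAt V ℓ ∧ BlocksHold V (ℓ + b.len) t ↔ ∃ s : ℕ → ℕ, s 0 = ℓ ∧
      (∀ i < (ofList b t).n, s i + (ofList b t).k i + (ofList b t).d i ≤ s (i + 1)) ∧
      ∀ i ≤ (ofList b t).n, ((ofList b t).blk i).HoldsAt V (s i) := by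
  induction t with
  | nil =>
    intro b ℓ
    constructor
    · rintro ⟨h, _⟩
      exact ⟨fun _ => ℓ, rfl, fun i hi => absurd hi (Nat.not_lt_zero i), fun i hi => by
        obtain rfl := Nat.le_zero.1 hi
        exact h⟩
    · rintro ⟨s, rfl, _, h⟩
      exact ⟨h 0 le_rfl, trivial⟩
  | cons p t ih =>
    intro b ℓ
    obtain ⟨d, b'⟩ := p
    simp only [BlocksHold, ih]
    constructor
    · rintro ⟨h, m, hm, s, rfl, h1, h2⟩
      refine ⟨fun i => Nat.casesOn i ℓ s, rfl, fun i hi => ?_, fun i hi => ?_⟩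
      · cases i with
        | zero => exact hm
        | succ i => exact h1 i (Nat.lt_of_succ_lt_succ hi)
      · cases i with
        | zero => exact h
        | succ i => exact h2 i (Nat.le_of_succ_le_succ hi)
    · rintro ⟨s, rfl, h1, h2⟩
      exact ⟨h2 0 (Nat.zero_le _), s 1, h1 0 (Nat.succ_pos _), fun i => s (i + 1), rfl,
        fun i hi => h1 (i + 1) (Nat.succ_lt_succ hi),
        fun i hi => h2 (i + 1) (Nat.succ_le_succ hi)⟩

theorem ofList_matches (V : Trace U B) (b : Block U B) (t : List (ℕ × Block U B)) :
    b.HoldsAt V 0 ∧ BlocksHold V (0 + b.len) t ↔ ∃ s, (ofList b t).Matches V s := by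
  rw [blocksHold_iff]
  exact ⟨fun ⟨s, h1, h2, h3⟩ => ⟨s, h1, h2, h3⟩, fun ⟨s, h1, h2, h3⟩ => ⟨s, h1, h2, h3⟩⟩

theorem tailNormal_getElem {O : Ontology U B} {t : List (ℕ × Block U B)} (ht : TailNormal O t) :
    (∀ i (h : i < t.length), ¬ IsTop O t[i].2.first ∧ ¬ IsTop O t[i].2.last) ∧
    ∀ i (h : i + 1 < t.length), Link O t[i].2 t[i + 1] ∧ BackLink O t[i].2 t[i + 1] := by
  induction t with
  | nil => simp
  | cons p t ih =>
    obtain ⟨h1, h2⟩ := ih ht.2.2.2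
    refine ⟨fun i h => ?_, fun i h => ?_⟩
    · cases i with
      | zero => exact ⟨ht.1, ht.2.1⟩
      | succ i => exact h1 i (Nat.lt_of_succ_lt_succ h)
    · cases i with
      | zero =>
        cases t with
        | nil => simp at h
        | cons p' t => exact ht.2.2.1 p' rfl
      | succ i => exact h2 i (Nat.lt_of_succ_lt_succ h)

theorem ofList_normal {O : Ontology U B} {b : Block U B} {t : List (ℕ × Block U B)}
    (h : ListNormal O b t) : (ofList b t).Normal O := by
  obtain ⟨h1, h2⟩ := tailNormal_getElem h.tail
  have hn : (ofList b t).n = t.length := rfl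
  have hlink : ∀ i (hi : i < t.length), Link O ((ofList b t).blk i) t[i] := by
    intro i hi
    cases i with
    | zero =>
      cases t with
      | nil => simp at hi
      | cons p t => exact h.link p rfl
    | succ i =>
      rw [ofList_blk_succ (Nat.lt_of_succ_lt hi)]
      exact (h2 i hi).1
  refine ⟨fun i hi h0 => ?_, fun i hi h0 => ?_, fun i hi hd hk => ?_, fun i hi h0 hd hk => ?_,
    fun i hi hd => ?_⟩
  · obtain ⟨i, rfl⟩ := Nat.exists_eq_succ_of_ne_zero h0.ne'
    rw [ofList_blk_succ hi]
    exact (h1 i hi).1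
  · cases i with
    | zero => exact h.last (h0.resolve_left (lt_irrefl 0)).ne'
    | succ i =>
      rw [ofList_blk_succ hi]
      exact (h1 i hi).2
  · rw [k, ofList_blk_succ hi] at hk
    rw [ofList_d hi] at hd
    rw [ofList_blk_succ hi]
    exact (hlink i hi hd).1 hk
  · obtain ⟨i, rfl⟩ := Nat.exists_eq_succ_of_ne_zero h0.ne'
    rw [ofList_d hi] at hd
    rw [k, ofList_blk_succ (Nat.lt_of_succ_lt hi)] at hk
    rw [ofList_blk_succ hi, ofList_blk_succ (Nat.lt_of_succ_lt hi)]
    exact (h2 i hi).2 hd hk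
  · rw [ofList_d hi] at hd
    rw [ofList_blk_succ hi]
    exact (hlink i hi hd).2

theorem Matches.congr {q q' : BlockSeq U B} {V : Trace U B} {s : ℕ → ℕ} (h : q.Matches V s)
    (hn : q.n = q'.n) (hb : ∀ i ≤ q.n, q.blk i = q'.blk i) (hd : ∀ i < q.n, q.d i = q'.d i) :
    q'.Matches V s := by
  refine ⟨h.zero, fun i hi => ?_, fun i hi => ?_⟩
  · rw [← hn] at hi
    rw [k, ← hb i hi.le, ← hd i hi]
    exact h.step i hi
  · rw [← hn] at hi
    rw [← hb i hi]
    exact h.holds i hi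

/-- The block sequence of a block form. -/
noncomputable def ofForm (F : BlockForm U B) : BlockSeq U B where
  n := F.n
  blk i := if h : i < F.n + 1 then F.block ⟨i, h⟩ else ⟨DomainQuery.top, []⟩
  d i := if h : i < F.n then (F.conn ⟨i, h⟩).dist else 0

theorem ofForm_blk (F : BlockForm U B) (i : Fin (F.n + 1)) : (ofForm F).blk i = F.block i :=
  dif_pos i.2

theorem ofForm_d (F : BlockForm U B) (i : Fin F.n) : (ofForm F).d i = (F.conn i).dist :=
  dif_pos i.2

theorem toPath_holdsIn {O : Ontology U B} {V : Trace U B} (hV : GoodTrace O V)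
    {F : BlockForm U B} (hf : F.FreeInner O) (h2 : ∀ i, (F.conn i).IsLe ∨ (F.conn i).IsLtSeq) :
    F.toPath.HoldsIn V ↔ ∃ s, (ofForm F).Matches V s := by
  let l : List (Connector U B × Block U B) := List.ofFn fun i : Fin F.n => (F.conn i, F.block i.succ)
  have hl : (List.ofFn fun i : Fin F.n => BlockForm.connSteps (F.conn i) (F.block i.succ) ++
      BlockForm.blockSteps (F.block i.succ)) =
      l.map fun p => BlockForm.connSteps p.1 p.2 ++ BlockForm.blockSteps p.2 := by
    simp [l, List.map_ofFn, Function.comp_def]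
  have hmem : ∀ p ∈ l, ∃ i, p = (F.conn i, F.block i.succ) := by
    intro p hp
    obtain ⟨i, rfl⟩ := (List.mem_ofFn' _ _).1 hp
    exact ⟨i, rfl⟩
  unfold PathQuery.HoldsIn BlockForm.toPath
  rw [hl, stepsHold_block, stepsHold_flatten hV, ofList_matches]
  · have hlen : l.length = F.n := by simp [l]
    set t := l.map fun p => (p.1.dist, p.2) with ht
    have htl : t.length = F.n := by simp [ht, hlen]
    have hn : (ofList (F.block 0) t).n = (ofForm F).n := htl
    have hget : ∀ (i : ℕ) (h : i < F.n) (h' : i < t.length),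
        t[i] = ((F.conn ⟨i, h⟩).dist, F.block (Fin.succ ⟨i, h⟩)) := by
      intro i h h'
      simp [ht, l]
    have hb : ∀ i ≤ F.n, (ofList (F.block 0) t).blk i = (ofForm F).blk i := by
      intro i hi
      cases i with
      | zero => exact (ofForm_blk F 0).symm
      | succ i =>
        have h' : i < t.length := htl ▸ hi
        rw [ofList_blk_succ h', hget i hi h']
        exact (ofForm_blk F (Fin.succ ⟨i, hi⟩)).symm
    have hd : ∀ i < F.n, (ofList (F.block 0) t).d i = (ofForm F).d i := by
      intro i hi
      have h' : i < t.length := htl ▸ hi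
      rw [ofList_d h', hget i hi h']
      exact (ofForm_d F ⟨i, hi⟩).symm
    constructor
    · rintro ⟨s, hs⟩
      exact ⟨s, hs.congr hn (fun i hi => hb i (hi.trans_eq hn)) fun i hi => hd i (hi.trans_eq hn)⟩
    · rintro ⟨s, hs⟩
      exact ⟨s, hs.congr hn.symm (fun i hi => (hb i hi).symm) (fun i hi => (hd i hi).symm)⟩
  · intro p hp
    obtain ⟨i, rfl⟩ := hmem p hp
    exact h2 i
  · intro p hp
    obtain ⟨i, rfl⟩ := hmem p hp
    exact hf i

theorem ofForm_normal {O : Ontology U B} {F : BlockForm U B} (h : F.IsNormal O) :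
    (ofForm F).Normal O := by
  have hblk := ofForm_blk F
  have hb : ∀ i (hi : i ≤ F.n), (ofForm F).blk i = F.block ⟨i, Nat.lt_succ_of_le hi⟩ :=
    fun i hi => hblk ⟨i, _⟩
  have hd : ∀ i (hi : i < F.n), (ofForm F).d i = (F.conn ⟨i, hi⟩).dist :=
    fun i hi => ofForm_d F ⟨i, hi⟩
  refine ⟨fun i hi h0 => ?_, fun i hi h0 => ?_, fun i hi h0 hk => ?_, fun i hi hp h0 hk => ?_,
    fun i hi h0 => ?_⟩
  · rw [hb i hi]
    exact h.n1_first _ (by simpa [Fin.ext_iff] using h0.ne')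
  · rw [k, hb i hi] at h0
    rw [hb i hi]
    refine h.n1_last _ (h0.imp (fun h => by simpa [Fin.ext_iff] using h.ne') fun h => ?_)
    rw [← Block.len_eq_zero]
    exact h.ne'
  · rw [hd i hi, Connector.dist_eq_zero] at h0
    rw [k, hb (i + 1) hi, Block.len_eq_zero] at hk
    rw [hb (i + 1) hi, hb i hi.le]
    exact h.n3 ⟨i, hi⟩ hk h0
  · rw [hd i hi, Connector.dist_eq_zero] at h0
    rw [k, hb i hi.le, Block.len_eq_zero] at hk
    rw [hb (i + 1) hi, hb i hi.le]
    exact h.n4 ⟨i, hi⟩ (by simpa [Fin.ext_iff] using hp.ne') hk h0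
  · rw [hd i hi, Connector.dist_eq_zero] at h0
    rw [hb (i + 1) hi, hb i hi.le]
    exact h.n5 ⟨i, hi⟩ h0

/-- A connector of distance `d`, using the query `τ` at the intermediate points. -/
def connOf (τ : DomainQuery U B) : ℕ → Connector U B
  | 0 => ⟨[], .le⟩
  | d + 1 => ⟨List.replicate d (.lt, τ), .lt⟩

theorem connOf_isLe (τ : DomainQuery U B) (d : ℕ) : (connOf τ d).IsLe ↔ d = 0 := by
  cases d <;> simp [connOf, Connector.IsLe]

theorem connOf_dist (τ : DomainQuery U B) (d : ℕ) : (connOf τ d).dist = d := by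
  unfold Connector.dist
  simp only [connOf_isLe]
  cases d <;> simp [connOf]

theorem connOf_or (τ : DomainQuery U B) (d : ℕ) :
    (connOf τ d).IsLe ∨ (connOf τ d).IsLtSeq := by
  cases d with
  | zero => exact Or.inl ⟨rfl, rfl⟩
  | succ d => exact Or.inr ⟨fun s hs => by rw [List.eq_of_mem_replicate hs], rfl⟩

theorem mem_connOf_inner {τ : DomainQuery U B} {d : ℕ} {s : TimeRel × DomainQuery U B}
    (hs : s ∈ (connOf τ d).inner) : s.2 = τ ∧ 2 ≤ d := by
  cases d with
  | zero => simp [connOf] at hs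
  | succ d =>
    simp only [connOf, List.mem_replicate] at hs
    exact ⟨by rw [hs.2], by omega⟩

/-- A block form of a block sequence. -/
def toForm (q : BlockSeq U B) (τ : DomainQuery U B) : BlockForm U B where
  n := q.n
  block i := q.blk i
  conn i := connOf τ (q.d i)

/-- The queries of the sequence belong to `R`. -/
def Over (q : BlockSeq U B) (R : Set (DomainQuery U B)) : Prop := ∀ i ≤ q.n, (q.blk i).Over R

theorem toForm_mem {q : BlockSeq U B} {R : Set (DomainQuery U B)} (hq : q.Over R)
    {τ : DomainQuery U B} (hτ : ∀ i < q.n, 2 ≤ q.d i → τ ∈ R) :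
    (q.toForm τ).toPath ∈ LTLp Set.univ R := by
  refine ⟨(hq 0 (Nat.zero_le _)).1, fun s hs => ⟨Set.mem_univ _, ?_⟩⟩
  have hblock : ∀ i ≤ q.n, ∀ s ∈ BlockForm.blockSteps (q.blk i), s.2 ∈ R := by
    intro i hi s hs
    obtain ⟨r, hr, rfl⟩ := List.mem_map.1 hs
    exact (hq i hi).2 r hr
  rcases List.mem_append.1 hs with hs | hs
  · exact hblock 0 (Nat.zero_le _) s hs
  · obtain ⟨l, hl, hs⟩ := List.mem_flatten.1 hs
    obtain ⟨i, rfl⟩ := (List.mem_ofFn' _ _).1 hl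
    have hi : (i : ℕ) < q.n := i.2
    rcases List.mem_append.1 hs with hs | hs
    · rcases List.mem_append.1 hs with hs | hs
      · obtain ⟨x, hx, rfl⟩ := List.mem_map.1 hs
        obtain ⟨h1, h2⟩ := mem_connOf_inner hx
        exact h1 ▸ hτ i hi h2
      · rw [List.mem_singleton.1 hs]
        exact (hq (i + 1) hi).1
    · exact hblock (i + 1) hi s hs

theorem toForm_freeInner {O : Ontology U B} {q : BlockSeq U B} {τ : DomainQuery U B}
    (hτ : ∀ i < q.n, 2 ≤ q.d i → IsTop O τ) : (q.toForm τ).FreeInner O := by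
  intro i s hs
  obtain ⟨h1, h2⟩ := mem_connOf_inner hs
  exact h1 ▸ hτ i i.2 h2

theorem toForm_isNormal {O : Ontology U B} {q : BlockSeq U B} (h : q.Normal O)
    {τ : DomainQuery U B} (hτ : ∀ i < q.n, 2 ≤ q.d i → IsTop O τ) :
    (q.toForm τ).IsNormal O where
  free := toForm_freeInner hτ
  n1_first i hi := h.first i (Nat.le_of_lt_succ i.2) (Nat.pos_of_ne_zero fun h => hi (Fin.ext h))
  n1_last i hi := h.last i (Nat.le_of_lt_succ i.2)
    (hi.imp (fun hi => Nat.pos_of_ne_zero fun h => hi (Fin.ext h)) fun hi =>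
      Nat.pos_of_ne_zero fun h => hi (Block.len_eq_zero.1 h))
  n2 _ := connOf_or τ _
  n3 i hi hc := h.link i i.2 ((connOf_isLe τ _).1 hc) (Block.len_eq_zero.2 hi)
  n4 i h0 hi hc := h.back i i.2 (Nat.pos_of_ne_zero fun h => h0 (Fin.ext h))
    ((connOf_isLe τ _).1 hc) (Block.len_eq_zero.2 hi)
  n5 i hc := h.sat i i.2 ((connOf_isLe τ _).1 hc)

theorem toForm_holdsIn {O : Ontology U B} {V : Trace U B} (hV : GoodTrace O V)
    {q : BlockSeq U B} {τ : DomainQuery U B} (hτ : ∀ i < q.n, 2 ≤ q.d i → IsTop O τ) :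
    (q.toForm τ).toPath.HoldsIn V ↔ ∃ s, q.Matches V s := by
  rw [toPath_holdsIn hV (toForm_freeInner hτ) fun _ => connOf_or τ _]
  have hb : ∀ i ≤ q.n, (ofForm (q.toForm τ)).blk i = q.blk i := fun i hi =>
    ofForm_blk (q.toForm τ) ⟨i, Nat.lt_succ_of_le hi⟩
  have hd : ∀ i < q.n, (ofForm (q.toForm τ)).d i = q.d i := fun i hi =>
    (ofForm_d (q.toForm τ) ⟨i, hi⟩).trans (connOf_dist τ _)
  constructor
  · rintro ⟨s, hs⟩
    exact ⟨s, hs.congr rfl hb hd⟩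
  · rintro ⟨s, hs⟩
    exact ⟨s, hs.congr rfl (fun i hi => (hb i hi).symm) fun i hi => (hd i hi).symm⟩

end BlockSeq

namespace BlockSeq

/-! ### Rigidity of normal forms -/

theorem Matches.first {q : BlockSeq U B} {V : Trace U B} {s : ℕ → ℕ} (h : q.Matches V s) {i : ℕ}
    (hi : i ≤ q.n) : V (s i) (q.blk i).first := (h.holds i hi).first

theorem Matches.last {q : BlockSeq U B} {V : Trace U B} {s : ℕ → ℕ} (h : q.Matches V s) {i : ℕ}
    (hi : i ≤ q.n) : V (s i + q.k i) (q.blk i).last := by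
  rw [← Block.get_len]
  exact h.holds i hi _ le_rfl

theorem Matches.mono {q : BlockSeq U B} {V : Trace U B} {s : ℕ → ℕ} (h : q.Matches V s) {i j : ℕ}
    (hij : i < j) (hj : j ≤ q.n) : s i + q.k i ≤ s j := by
  induction j, hij using Nat.le_induction with
  | base => have := h.step i hj; simp only [Nat.succ_eq_add_one]; omega
  | succ j hij ih =>
    have h1 := ih (by omega)
    have h2 := h.step j hj
    omega

/-- Blocks cannot be matched too early. By induction block `i + 1` starts no earlier than the end of
block `i` in `V`, and its first query is not trivial, so it does not start in the gap. It could
start exactly at that end point, with `d i = 0`. If it is primitive, (n3) excludes this, because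
everything true there follows from the last query of block `i`; if it is not, its non-trivial last
point would fall into the gap, which is longer than the block. -/
theorem Normal.le_of_left {q : BlockSeq U B} {O : Ontology U B} (hq : q.Normal O) {V : Trace U B}
    {π s : ℕ → ℕ} {c : ℕ} (hc : c ≤ q.n) (h0 : π 0 = 0)
    (hsep : ∀ i < c, π i + q.k i + q.k (i + 1) < π (i + 1))
    (hend : ∀ i < c, ∀ r, V (π i + q.k i) r → Contained O (q.blk i).last r)
    (hgap : ∀ i < c, ∀ p r, π i + q.k i < p → p < π (i + 1) → V p r → IsTop O r)
    (hs : q.Matches V s) : ∀ i ≤ c, π i ≤ s i := by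
  intro i
  induction i with
  | zero => intro _; simp [h0]
  | succ i ih =>
    intro hi
    have h1 := ih (by omega)
    have h2 := hs.step i (by omega)
    have h3 := hsep i hi
    by_contra hlt
    have hfirst := hs.first (i := i + 1) (by omega)
    have hlast := hs.last (i := i + 1) (by omega)
    rcases (show π i + q.k i ≤ s (i + 1) by omega).eq_or_lt with he | hl
    · rw [← he] at hfirst
      have hk : q.k (i + 1) ≠ 0 := fun hk =>
        hq.link i (by omega) (by omega) hk (hend i hi _ hfirst)
      exact hq.last (i + 1) (by omega) (Or.inl (Nat.succ_pos i))
        (hgap i hi _ _ (by omega) (by omega) hlast)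
    · exact hq.first (i + 1) (by omega) (Nat.succ_pos i) (hgap i hi _ _ hl (by omega) hfirst)

/-- The mirror image of `Normal.le_of_left`, by induction from the last block downwards, with (n4)
in place of (n3). Block `0` is exempt from (n4) and from the first half of (n1), but it is pinned to
time `0`. `E c` is left free so that it can be the end of a modified part. -/
theorem Normal.le_of_right {q : BlockSeq U B} {O : Ontology U B} (hq : q.Normal O) {V : Trace U B}
    {ρ E s : ℕ → ℕ} {c : ℕ}
    (hE : ∀ i ≤ q.n, c < i → E i = ρ i + q.k i)
    (hsep : ∀ i < q.n, c ≤ i → E i + q.k i < ρ (i + 1))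
    (hstart : ∀ i ≤ q.n, c < i → ∀ r, V (ρ i) r → Contained O (q.blk i).first r)
    (hgap : ∀ i < q.n, c ≤ i → ∀ p r, E i < p → p < ρ (i + 1) → V p r → IsTop O r)
    (hfin : ∀ p r, E q.n < p → V p r → IsTop O r)
    (hs : q.Matches V s) : ∀ i ≤ q.n, c ≤ i → s i + q.k i ≤ E i := by
  have key : ∀ m i, i + m = q.n → c ≤ i → s i + q.k i ≤ E i := by
    intro m
    induction m with
    | zero =>
      intro i hi hci
      obtain rfl : i = q.n := hi
      by_contra hlt
      by_cases h0 : 0 < q.n ∨ 0 < q.k q.n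
      · exact hq.last _ le_rfl h0 (hfin _ _ (by omega) (hs.last le_rfl))
      · push Not at h0
        have : s q.n = 0 := by rw [Nat.le_zero.1 h0.1]; exact hs.zero
        omega
    | succ m ih =>
      intro i hi hci
      have h1 := ih (i + 1) (by omega) (by omega)
      rw [hE (i + 1) (by omega) (by omega)] at h1
      have h2 := hs.step i (by omega)
      have h3 := hsep i (by omega) hci
      by_contra hlt
      have hlast := hs.last (i := i) (by omega)
      by_cases h0 : i = 0
      · have h00 : s i = 0 := by rw [h0]; exact hs.zero
        by_cases hk : q.k i = 0
        · omega
        · exact hq.last i (by omega) (Or.inr (by omega))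
            (hgap i (by omega) hci _ _ (by omega) (by omega) hlast)
      rcases (show s i + q.k i ≤ ρ (i + 1) by omega).eq_or_lt with he | hl
      · rw [he] at hlast
        have hk : q.k i ≠ 0 := fun hk => hq.back i (by omega) (by omega) (by omega) hk
          (hstart (i + 1) (by omega) (by omega) _ hlast)
        exact hq.first i (by omega) (by omega)
          (hgap i (by omega) hci _ _ (by omega) (by omega) (hs.first (by omega)))
      · exact hq.last i (by omega) (Or.inl (by omega))
          (hgap i (by omega) hci _ _ (by omega) hl hlast)
  intro i hi hci
  exact key (q.n - i) i (by omega) hci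

/-! ### Words -/

/-- The trace of a word of data instances, with respect to the individual `0`. -/
def wordTrace (O : Ontology U B) (w : ℕ → DataInstance U B) : Trace U B :=
  fun p r => Entails O (w p) r 0

/-- The starting points of the blocks when they are separated by `G` empty time points. -/
def pos (q : BlockSeq U B) (G : ℕ) : ℕ → ℕ
  | 0 => 0
  | i + 1 => q.pos G i + q.k i + G + 1

theorem pos_lt (q : BlockSeq U B) (G : ℕ) {i j : ℕ} (h : i < j) :
    q.pos G i + q.k i + G < q.pos G j := by
  induction j, h using Nat.le_induction with
  | base => simp [pos]
  | succ j _ ih => simp only [pos]; omega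

theorem pos_unique (q : BlockSeq U B) (G : ℕ) {i j a b : ℕ} (ha : a ≤ q.k i) (hb : b ≤ q.k j)
    (h : q.pos G i + a = q.pos G j + b) : i = j ∧ a = b := by
  rcases lt_trichotomy i j with hij | rfl | hij
  · have := q.pos_lt G hij; omega
  · exact ⟨rfl, by omega⟩
  · have := q.pos_lt G hij; omega

/-- Letters for the queries of a block sequence. -/
structure Coding (O : Ontology U B) (Q : Set (DomainQuery U B)) (S : ℕ) (q : BlockSeq U B) where
  hat : DomainQuery U B → DataInstance U B
  neg : DomainQuery U B → Finset (DataInstance U B)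
  split : ∀ i ≤ q.n, ∀ j ≤ q.k i,
    IsSplit O Q S ((q.blk i).get j) (hat ((q.blk i).get j)) (neg ((q.blk i).get j))
  split_conj : ∀ i < q.n, Satisfiable O ((q.blk i).last.conj (q.blk (i + 1)).first) →
    IsSplit O Q S ((q.blk i).last.conj (q.blk (i + 1)).first)
      (hat ((q.blk i).last.conj (q.blk (i + 1)).first))
      (neg ((q.blk i).last.conj (q.blk (i + 1)).first))

/-- The word `w` with the letters from `a` to `b - 1` replaced by `M 0, …, M (m - 1)`. -/
def splice (w : ℕ → DataInstance U B) (a : ℕ) (M : ℕ → DataInstance U B) (m b : ℕ) :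
    ℕ → DataInstance U B :=
  fun p => if p < a then w p else if p < a + m then M (p - a) else w (p - (a + m) + b)

theorem splice_left {w : ℕ → DataInstance U B} {a : ℕ} {M : ℕ → DataInstance U B} {m b p : ℕ}
    (h : p < a) : splice w a M m b p = w p := if_pos h

theorem splice_mid {w : ℕ → DataInstance U B} {a : ℕ} {M : ℕ → DataInstance U B} {m b p : ℕ}
    (h : p < m) : splice w a M m b (a + p) = M p := by
  simp [splice, h]

theorem splice_right {w : ℕ → DataInstance U B} {a : ℕ} {M : ℕ → DataInstance U B} {m b p : ℕ}
    (h : a + m ≤ p) : splice w a M m b p = w (p - (a + m) + b) := by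
  rw [splice, if_neg (by omega), if_neg (by omega)]

/-- The blocks of `p` have the same lengths as those of `q` and are stronger. -/
structure Stronger (O : Ontology U B) (p q : BlockSeq U B) : Prop where
  n_eq : p.n = q.n
  k_eq : ∀ i ≤ q.n, p.k i = q.k i
  contained : ∀ i ≤ q.n, ∀ j ≤ q.k i, Contained O ((p.blk i).get j) ((q.blk i).get j)

theorem Stronger.refl (O : Ontology U B) (q : BlockSeq U B) : Stronger O q q :=
  ⟨rfl, fun _ _ => rfl, fun _ _ _ _ => Contained.refl O _⟩

namespace Coding

variable {O : Ontology U B} {Q : Set (DomainQuery U B)} {S : ℕ} {q : BlockSeq U B}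

/-- The letter of point `j` of block `i`. -/
def h (C : Coding O Q S q) (i j : ℕ) : DataInstance U B := C.hat ((q.blk i).get j)

theorem entails_h (C : Coding O Q S q) {i j : ℕ} (hi : i ≤ q.n) (hj : j ≤ q.k i)
    {r : DomainQuery U B} : Entails O (C.h i j) r 0 ↔ Contained O ((q.blk i).get j) r :=
  (C.split i hi j hj).entails_iff r

open Classical in
/-- The word that consists of the blocks of `q` separated by `G` empty time points. -/
noncomputable def std (C : Coding O Q S q) (G : ℕ) : ℕ → DataInstance U B := fun p =>
  if h : ∃ x : ℕ × ℕ, x.1 ≤ q.n ∧ x.2 ≤ q.k x.1 ∧ p = q.pos G x.1 + x.2 then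
    C.h h.choose.1 h.choose.2
  else emptyLetter U B S

theorem std_block (C : Coding O Q S q) (G : ℕ) {i j : ℕ} (hi : i ≤ q.n) (hj : j ≤ q.k i) :
    C.std G (q.pos G i + j) = C.h i j := by
  have hex : ∃ x : ℕ × ℕ, x.1 ≤ q.n ∧ x.2 ≤ q.k x.1 ∧ q.pos G i + j = q.pos G x.1 + x.2 :=
    ⟨(i, j), hi, hj, rfl⟩
  obtain ⟨_, h2, h3⟩ := hex.choose_spec
  obtain ⟨e1, e2⟩ := q.pos_unique G hj h2 h3
  rw [std, dif_pos hex, ← e1, ← e2]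

theorem std_gap (C : Coding O Q S q) (G : ℕ) {i p : ℕ} (hp : q.pos G i + q.k i < p)
    (hp' : p < q.pos G (i + 1)) : C.std G p = emptyLetter U B S := by
  rw [std, dif_neg]
  rintro ⟨⟨i', j'⟩, _, h2, rfl⟩
  simp only at h2 hp hp'
  rcases lt_trichotomy i i' with h | rfl | h
  · rcases (Nat.succ_le_of_lt h).eq_or_lt with rfl | h
    · simp only [Nat.succ_eq_add_one] at hp'; omega
    · have := q.pos_lt G h
      simp only [Nat.succ_eq_add_one] at this; omega
  · omega
  · have := q.pos_lt G h; omega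

theorem std_end (C : Coding O Q S q) (G : ℕ) {p : ℕ} (hp : q.pos G q.n + q.k q.n < p) :
    C.std G p = emptyLetter U B S := by
  rw [std, dif_neg]
  rintro ⟨⟨i', j'⟩, h1, h2, rfl⟩
  simp only at h1 h2 hp
  rcases h1.eq_or_lt with rfl | h
  · omega
  · have := q.pos_lt G h; omega

theorem std_of_not_isTop (C : Coding O Q S q) {G p : ℕ} {r : DomainQuery U B}
    (h : wordTrace O (C.std G) p r) (hr : ¬ IsTop O r) :
    ∃ i j, i ≤ q.n ∧ j ≤ q.k i ∧ p = q.pos G i + j := by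
  unfold wordTrace std at h
  split_ifs at h with hx
  · obtain ⟨⟨i, j⟩, h'⟩ := hx
    exact ⟨i, j, h'⟩
  · exact (hr (entails_empty_iff.1 h)).elim

theorem std_contained (C : Coding O Q S q) {G i j : ℕ} {r : DomainQuery U B} (hi : i ≤ q.n)
    (hj : j ≤ q.k i) : wordTrace O (C.std G) (q.pos G i + j) r ↔
      Contained O ((q.blk i).get j) r := by
  rw [wordTrace, C.std_block G hi hj, C.entails_h hi hj]

theorem std_matches (C : Coding O Q S q) {G : ℕ} (hG : ∀ i < q.n, q.d i ≤ G + 1) :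
    q.Matches (wordTrace O (C.std G)) (q.pos G) where
  zero := rfl
  step i hi := by simp only [pos]; have := hG i hi; omega
  holds i hi j hj := (C.std_contained hi hj).2 (Contained.refl O _)

/-- The word `std` with the blocks from `c` to `c'` replaced by `M 0, …, M (m - 1)`. -/
noncomputable def modify (C : Coding O Q S q) (G c c' : ℕ) (M : ℕ → DataInstance U B) (m : ℕ) :
    ℕ → DataInstance U B :=
  splice (C.std G) (q.pos G c) M m (q.pos G c' + q.k c' + 1)

/-- A normal form matches a modified word only with the modified blocks inside the
modified part. -/
theorem modify_rigid (C : Coding O Q S q) {p : BlockSeq U B} (hp : p.Normal O)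
    (hpq : Stronger O p q) {G c c' m : ℕ} (hcc : c ≤ c') (hc : c' ≤ q.n) (hm : 1 ≤ m)
    (hG : ∀ i ≤ q.n, q.k i ≤ G) {M : ℕ → DataInstance U B} {s : ℕ → ℕ}
    (hs : p.Matches (wordTrace O (C.modify G c c' M m)) s) :
    q.pos G c ≤ s c ∧ s c' + q.k c' < q.pos G c + m := by
  have hlast : ∀ i ≤ q.n, Contained O (p.blk i).last (q.blk i).last := by
    intro i hi
    rw [← Block.get_len, ← Block.get_len, show (p.blk i).len = (q.blk i).len from hpq.k_eq i hi]
    exact hpq.contained i hi _ le_rfl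
  have hfirst : ∀ i ≤ q.n, Contained O (p.blk i).first (q.blk i).first := fun i hi =>
    hpq.contained i hi 0 (Nat.zero_le _)
  constructor
  · refine hp.le_of_left (π := q.pos G) (hpq.n_eq ▸ hcc.trans hc) rfl (fun i hi => ?_)
      (fun i hi r hr => ?_) (fun i hi x r h1 h2 hr => ?_) hs c le_rfl
    · rw [hpq.k_eq i (by omega), hpq.k_eq (i + 1) (by omega)]
      have := hG (i + 1) (by omega)
      simp only [pos]
      omega
    · rw [hpq.k_eq i (by omega)] at hr
      have := q.pos_lt G hi
      rw [wordTrace, modify, splice_left (by omega)] at hr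
      have := (C.std_contained (by omega) le_rfl).1 hr
      rw [Block.get_len] at this
      exact (hlast i (by omega)).trans this
    · rw [hpq.k_eq i (by omega)] at h1
      have hle : q.pos G (i + 1) ≤ q.pos G c := by
        rcases (Nat.succ_le_of_lt hi).eq_or_lt with rfl | h
        · exact le_rfl
        · have := q.pos_lt G h
          simp only [Nat.succ_eq_add_one] at this
          omega
      rw [wordTrace, modify, splice_left (by omega), C.std_gap G h1 h2] at hr
      exact entails_empty_iff.1 hr
  -- The point `b` of `std` is the first one after block `c'`; in the modified word it is moved to
  -- `a`.
  · let b := q.pos G c' + q.k c' + 1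
    let a := q.pos G c + m
    have hb : ∀ i, c' < i → b + G ≤ q.pos G i := fun i hi => by
      have := q.pos_lt G hi
      simp only [b]; omega
    have hright : ∀ x, b ≤ x →
        C.modify G c c' M m (x - b + a) = C.std G x := fun x hx => by
      rw [modify, splice_right (by omega)]
      congr 1
      omega
    let ρ : ℕ → ℕ := fun i => q.pos G i - b + a
    -- At `c'` the bound is the last point of the modified part, afterwards the end of the shifted
    -- block; smaller indices are irrelevant.
    let E : ℕ → ℕ := fun i => if i ≤ c' then a - 1 else ρ i + q.k i
    have hEc : E c' = a - 1 := if_pos le_rfl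
    have hE : ∀ i, c' < i → E i = ρ i + q.k i := fun i hi => if_neg (by omega)
    have hE' : ∀ i, c' ≤ i → i ≤ q.n → E i + b = q.pos G i + q.k i + a ∧ a - 1 ≤ E i := by
      intro i hi hin
      rcases hi.eq_or_lt with rfl | hi
      · rw [hEc]; simp only [a, b]; omega
      · rw [hE i hi]
        have := hb i hi
        simp only [ρ, a]
        omega
    have hgap : ∀ x r, E c' < x → wordTrace O (C.modify G c c' M m) x r →
        Entails O (C.std G (x - a + b)) r 0 := by
      intro x r hx hr
      rw [wordTrace, modify, splice_right (by rw [hEc] at hx; simp only [a] at hx; omega)] at hr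
      exact hr
    have hk : ∀ i ≤ q.n, p.k i = q.k i := hpq.k_eq
    have := hp.le_of_right (ρ := ρ) (E := E) (c := c') (fun i hi hci => ?_) (fun i hi hci => ?_)
      (fun i hi hci r hr => ?_) (fun i hi hci x r h1 h2 hr => ?_) (fun x r h1 hr => ?_) hs c'
      (hpq.n_eq ▸ hc) le_rfl
    · rw [hk c' hc, hEc] at this
      simp only [a] at this
      omega
    · rw [hpq.n_eq] at hi
      rw [hk i hi, hE i hci]
    · rw [hpq.n_eq] at hi
      rw [hk i hi.le]
      have h1 := hE' i hci hi.le
      have h2 := hG i hi.le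
      have h3 := hb (i + 1) (by omega)
      simp only [ρ]
      simp only [pos] at h3 ⊢
      omega
    · rw [hpq.n_eq] at hi
      have h3 := hb i hci
      rw [wordTrace, show ρ i = q.pos G i - b + a from rfl, hright _ (by omega)] at hr
      have := (C.std_contained (G := G) (j := 0) hi (Nat.zero_le _)).1 hr
      exact (hfirst i hi).trans this
    · rw [hpq.n_eq] at hi
      have h3 := hE' i hci hi.le
      have h4 := hE' c' le_rfl hc
      have h5 := hb (i + 1) (by omega)
      have h6 : E c' ≤ E i := by rw [hEc]; exact h3.2
      have := hgap x r (by omega) hr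
      simp only [ρ] at h2
      rw [C.std_gap G (i := i) (by omega) (by omega)] at this
      exact entails_empty_iff.1 this
    · rw [hpq.n_eq] at h1
      have h3 := hE' q.n hc le_rfl
      have h6 : E c' ≤ E q.n := by rw [hEc]; exact h3.2
      have := hgap x r (by omega) hr
      rw [C.std_end G (by omega)] at this
      exact entails_empty_iff.1 this

/-- Rigidity for the modification of a single block. -/
theorem modify_matches (C : Coding O Q S q) (hq : q.Normal O) {G c m : ℕ} (hc : c ≤ q.n)
    (hm : 1 ≤ m) (hG : ∀ i ≤ q.n, q.k i ≤ G) {M : ℕ → DataInstance U B}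
    (hs : ∃ s, q.Matches (wordTrace O (C.modify G c c M m)) s) :
    ∃ u, u + q.k c < m ∧ (c = 0 → u = 0) ∧
      ∀ j ≤ q.k c, Entails O (M (u + j)) ((q.blk c).get j) 0 := by
  obtain ⟨s, hs⟩ := hs
  obtain ⟨h1, h2⟩ := C.modify_rigid hq (Stronger.refl O q) le_rfl hc hm hG hs
  refine ⟨s c - q.pos G c, by omega, fun h => ?_, fun j hj => ?_⟩
  · rw [h, hs.zero]; simp
  · have := hs.holds c hc j hj
    rw [wordTrace, modify, show s c + j = q.pos G c + (s c - q.pos G c + j) by omega,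
      splice_mid (by omega)] at this
    exact this

end Coding

end BlockSeq

namespace BlockSeq

namespace Coding

variable {O : Ontology U B} {Q : Set (DomainQuery U B)} {S : ℕ} {q : BlockSeq U B}

/-! ### The modified words -/

/-- Point `j` of a block is replaced by the letter `x`. -/
def pointWord (C : Coding O Q S q) (c j : ℕ) (x : DataInstance U B) : ℕ → DataInstance U B :=
  fun p => if p = j then x else C.h c p

/-- A block without its last point, and then the block without its first point. -/
def splitWord (C : Coding O Q S q) (G c : ℕ) : ℕ → DataInstance U B :=
  fun p => if p < q.k c then C.h c p else if p < q.k c + G then emptyLetter U B S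
    else C.h c (p - (q.k c + G) + 1)

/-- The first point of a block, and then the block with first letter `x`. -/
def firstWord (C : Coding O Q S q) (G c : ℕ) (x : DataInstance U B) : ℕ → DataInstance U B :=
  fun p => if p = 0 then C.h c 0 else if p < G + 1 then emptyLetter U B S
    else if p = G + 1 then x else C.h c (p - (G + 1))

/-- A block with last letter `x`, and then its last point. -/
def lastWord (C : Coding O Q S q) (G c : ℕ) (x : DataInstance U B) : ℕ → DataInstance U B :=
  fun p => if p < q.k c then C.h c p else if p = q.k c then x
    else if p < q.k c + 1 + G then emptyLetter U B S else C.h c (q.k c)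

/-- The letters of a list in cyclic order. -/
def cycleWord (S : ℕ) (xs : List (DataInstance U B)) : ℕ → DataInstance U B :=
  fun p => xs.getD (p % xs.length) (emptyLetter U B S)

/-- Block `c` and block `c + 1` at distance `e`. -/
def gapWord (C : Coding O Q S q) (c e : ℕ) : ℕ → DataInstance U B :=
  fun p => if p < q.k c then C.h c p
    else if p = q.k c then
      if e = 0 then C.hat ((q.blk c).last.conj (q.blk (c + 1)).first) else C.h c p
    else if p < q.k c + e then emptyLetter U B S else C.h (c + 1) (p - (q.k c + e))

theorem not_empty_entails {r : DomainQuery U B} (hr : ¬ IsTop O r) :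
    ¬ Entails O (emptyLetter U B S) r 0 := fun h => hr (entails_empty_iff.1 h)

theorem not_matches_pointWord (C : Coding O Q S q) (hq : q.Normal O) {G c j : ℕ} (hc : c ≤ q.n)
    (hG : ∀ i ≤ q.n, q.k i ≤ G) (hj : j ≤ q.k c) {x : DataInstance U B}
    (hx : ¬ Entails O x ((q.blk c).get j) 0) :
    ¬ ∃ s, q.Matches (wordTrace O (C.modify G c c (C.pointWord c j x) (q.k c + 1))) s := by
  intro hs
  obtain ⟨u, h1, _, h2⟩ := C.modify_matches hq hc (by omega) hG hs
  -- The modified part has exactly as many points as block `c`, so the block cannot be shifted.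
  obtain rfl : u = 0 := by omega
  have := h2 j hj
  rw [Nat.zero_add, pointWord, if_pos rfl] at this
  exact hx this

theorem first_last (hq : q.Normal O) {c : ℕ} (hc : c ≤ q.n) {M : ℕ → DataInstance U B} {u : ℕ}
    (h : ∀ j ≤ q.k c, Entails O (M (u + j)) ((q.blk c).get j) 0) :
    (0 < c → M u ≠ emptyLetter U B S) ∧ (0 < c ∨ 0 < q.k c → M (u + q.k c) ≠ emptyLetter U B S) := by
  refine ⟨fun h0 he => ?_, fun h0 he => ?_⟩
  · have := h 0 (Nat.zero_le _)
    rw [Nat.add_zero, he] at this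
    exact not_empty_entails (hq.first c hc h0) this
  · have := h _ le_rfl
    rw [he] at this
    refine not_empty_entails (S := S) (hq.last c hc h0) ?_
    rwa [← Block.get_len]

/-- Neither half contains the whole block. If the block starts in the first half, it ends among the
`G ≥ k` empty points; otherwise the length of the word forces it to start among them. The initial
block cannot move at all. -/
theorem not_matches_splitWord (C : Coding O Q S q) (hq : q.Normal O) {G c : ℕ} (hc : c ≤ q.n)
    (hG : ∀ i ≤ q.n, q.k i ≤ G) (hk : 0 < q.k c) :
    ¬ ∃ s, q.Matches (wordTrace O (C.modify G c c (C.splitWord G c) (2 * q.k c + G))) s := by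
  intro hs
  obtain ⟨u, h1, h0, h2⟩ := C.modify_matches hq hc (by omega) hG hs
  obtain ⟨h3, h4⟩ := first_last (S := S) hq hc h2
  have h5 := hG c hc
  by_cases hu : u < q.k c
  · refine h4 (Or.inr hk) ?_
    rw [splitWord, if_neg (by omega), if_pos (by omega)]
  · refine h3 (Nat.pos_of_ne_zero fun h => by have := h0 h; omega) ?_
    rw [splitWord, if_neg (by omega), if_pos (by omega)]

/-- Started at the isolated first letter, the block ends among the `G` empty points, and it cannot
start at an empty point. The only other position that fits reads `x` as first letter; it is not
available to the initial block, so in that case `x` is arbitrary. -/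
theorem not_matches_firstWord (C : Coding O Q S q) (hq : q.Normal O) {G c : ℕ} (hc : c ≤ q.n)
    (hG : ∀ i ≤ q.n, q.k i ≤ G) (hk : 0 < q.k c) {x : DataInstance U B}
    (hx : 0 < c → ¬ Entails O x (q.blk c).first 0) :
    ¬ ∃ s, q.Matches (wordTrace O (C.modify G c c (C.firstWord G c x) (q.k c + G + 2))) s := by
  intro hs
  obtain ⟨u, h1, h0, h2⟩ := C.modify_matches hq hc (by omega) hG hs
  obtain ⟨h3, h4⟩ := first_last (S := S) hq hc h2
  have h5 := hG c hc
  by_cases hu : u = 0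
  · refine h4 (Or.inr hk) ?_
    rw [firstWord, if_neg (by omega), if_pos (by omega)]
  · have hc0 : 0 < c := Nat.pos_of_ne_zero fun h => hu (h0 h)
    by_cases hu' : u < G + 1
    · refine h3 hc0 ?_
      rw [firstWord, if_neg (by omega), if_pos (by omega)]
    · obtain rfl : u = G + 1 := by omega
      have := h2 0 (Nat.zero_le _)
      rw [Nat.add_zero, firstWord, if_neg (by omega), if_neg (by omega), if_pos rfl] at this
      exact hx hc0 this

/-- Unshifted, the block reads `x` as last letter. A shift by at most `k` moves the last point to an
empty letter, and a larger one moves the first point there; the initial block cannot be shifted. -/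
theorem not_matches_lastWord (C : Coding O Q S q) (hq : q.Normal O) {G c : ℕ} (hc : c ≤ q.n)
    (hG : ∀ i ≤ q.n, q.k i ≤ G) (hk : c = 0 ∨ 0 < q.k c) {x : DataInstance U B}
    (hx : ¬ Entails O x (q.blk c).last 0) :
    ¬ ∃ s, q.Matches (wordTrace O (C.modify G c c (C.lastWord G c x) (q.k c + G + 2))) s := by
  intro hs
  obtain ⟨u, h1, h0, h2⟩ := C.modify_matches hq hc (by omega) hG hs
  obtain ⟨h3, h4⟩ := first_last (S := S) hq hc h2
  have h5 := hG c hc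
  by_cases hu : u = 0
  · have := h2 _ le_rfl
    rw [hu, Nat.zero_add, lastWord, if_neg (by omega), if_pos rfl, Block.get_len] at this
    exact hx this
  · have hc0 : 0 < c := Nat.pos_of_ne_zero fun h => hu (h0 h)
    have hk : 0 < q.k c := hk.resolve_left hc0.ne'
    by_cases hu' : u ≤ q.k c
    · refine h4 (Or.inr hk) ?_
      rw [lastWord, if_neg (by omega), if_neg (by omega), if_pos (by omega)]
    · refine h3 hc0 ?_
      rw [lastWord, if_neg (by omega), if_neg (by omega), if_pos (by omega)]

theorem not_matches_cycleWord (C : Coding O Q S q) (hq : q.Normal O) {G c N : ℕ} (hc : c ≤ q.n)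
    (hG : ∀ i ≤ q.n, q.k i ≤ G) {xs : List (DataInstance U B)}
    (hxs : ∀ x ∈ xs, ¬ Entails O x (q.blk c).first 0) (hm : 1 ≤ N * xs.length) :
    ¬ ∃ s, q.Matches (wordTrace O (C.modify G c c (cycleWord S xs) (N * xs.length))) s := by
  intro hs
  obtain ⟨u, h1, h0, h2⟩ := C.modify_matches hq hc hm hG hs
  have := h2 0 (Nat.zero_le _)
  have hl : 0 < xs.length := Nat.pos_of_ne_zero fun h => by simp [h] at hm
  have hlt : u % xs.length < xs.length := Nat.mod_lt _ hl
  rw [Nat.add_zero, cycleWord, List.getD_eq_getElem _ _ hlt] at this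
  exact hxs _ (List.getElem_mem hlt) this

/-- By rigidity both blocks lie within the modified part, whose length leaves room for a distance of
at most `e`. -/
theorem le_of_matches_gapWord (C : Coding O Q S q) {p : BlockSeq U B} (hp : p.Normal O)
    (hpq : Stronger O p q) {G c e : ℕ} (hc : c < q.n) (hG : ∀ i ≤ q.n, q.k i ≤ G)
    (hs : ∃ s, p.Matches (wordTrace O
      (C.modify G c (c + 1) (C.gapWord c e) (q.k c + e + q.k (c + 1) + 1))) s) :
    p.d c ≤ e := by
  obtain ⟨s, hs⟩ := hs
  obtain ⟨h1, h2⟩ := C.modify_rigid hp hpq (c' := c + 1) (Nat.le_succ c) hc (by omega) hG hs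
  have := hs.step c (by rw [hpq.n_eq]; exact hc)
  rw [hpq.k_eq c hc.le] at this
  omega

theorem matches_gapWord (C : Coding O Q S q) {p : BlockSeq U B} (hpq : Stronger O q p)
    {G c e : ℕ} (hc : c < q.n) (hd : ∀ i < q.n, p.d i ≤ G + 1) (hde : p.d c ≤ e)
    (hsat : e = 0 → Satisfiable O ((q.blk c).last.conj (q.blk (c + 1)).first)) :
    ∃ s, p.Matches (wordTrace O
      (C.modify G c (c + 1) (C.gapWord c e) (q.k c + e + q.k (c + 1) + 1))) s := by
  have hn := hpq.n_eq
  have hk : ∀ i ≤ q.n, p.k i = q.k i := fun i hi => (hpq.k_eq i (hn ▸ hi)).symm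
  have hcont : ∀ i ≤ q.n, ∀ j ≤ q.k i, Contained O ((q.blk i).get j) ((p.blk i).get j) :=
    fun i hi j hj => hpq.contained i (hn ▸ hi) j (by rw [hk i hi]; exact hj)
  have hhat : ∀ i ≤ q.n, ∀ j ≤ q.k i, Entails O (C.h i j) ((p.blk i).get j) 0 :=
    fun i hi j hj => (C.entails_h hi hj).2 (hcont i hi j hj)
  have hle : ∀ i, c < i → q.pos G (c + 1) ≤ q.pos G i := by
    intro i hi
    rcases (Nat.succ_le_of_lt hi).eq_or_lt with rfl | h
    · exact le_rfl
    · have := q.pos_lt G h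
      simp only [Nat.succ_eq_add_one] at this; omega
  -- The match sends blocks up to `c` to their standard positions and translates the remaining ones
  -- so that block `c + 1` comes at distance `e`. For `e = 0` the two blocks share the letter of the
  -- conjunction.
  have hpos : q.pos G (c + 1) = q.pos G c + q.k c + G + 1 := rfl
  refine ⟨fun i => if i ≤ c then q.pos G i else q.pos G i - q.pos G (c + 1) +
    (q.pos G c + q.k c + e), ?_, fun i hi => ?_, fun i hi j hj => ?_⟩
  · simp [pos]
  · rw [← hn] at hi
    rw [hk i hi.le]
    have h1 := hd i hi
    have h2 : q.pos G (i + 1) = q.pos G i + q.k i + G + 1 := rfl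
    rcases lt_trichotomy i c with h | rfl | h
    · rw [if_pos (by omega), if_pos (by omega)]; omega
    · rw [if_pos (by omega), if_neg (by omega)]; omega
    · rw [if_neg (by omega), if_neg (by omega)]
      have := hle i h
      omega
  · rw [← hn] at hi
    have hj' : j ≤ q.k i := by rw [← hk i hi]; exact hj
    unfold wordTrace modify
    by_cases h : i < c
    · have := q.pos_lt G h
      rw [if_pos h.le, splice_left (by omega), C.std_block G hi hj']
      exact hhat i hi j hj'
    · by_cases h' : i = c
      · subst h'
        rw [if_pos le_rfl, splice_mid (by omega), gapWord]
        split_ifs with h1 h2 h3 h4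
        · exact hhat i hi j hj'
        · subst h2
          have hc1 := (C.split_conj i hc (hsat h3)).entails_iff ((p.blk i).get (q.k i))
          refine hc1.2 ((contained_conj_left O _ _).trans ?_)
          rw [← Block.get_len]
          exact hcont i hi _ le_rfl
        · exact hhat i hi j hj'
        · omega
        · omega
      · have hci : c < i := by omega
        rw [if_neg (by omega)]
        rcases (Nat.succ_le_of_lt hci).eq_or_lt with rfl | h2
        · simp only [Nat.succ_eq_add_one, Nat.sub_self, Nat.zero_add] at hj' ⊢
          rw [show q.pos G c + q.k c + e + j = q.pos G c + (q.k c + e + j) by omega,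
            splice_mid (by omega), gapWord, if_neg (by omega)]
          split_ifs with h1 h2 h3
          · obtain rfl : j = 0 := by omega
            have hc1 := (C.split_conj c hc (hsat h2)).entails_iff ((p.blk (c + 1)).get 0)
            exact hc1.2 ((contained_conj_right O _ _).trans (hcont (c + 1) hi 0 (Nat.zero_le _)))
          · omega
          · omega
          · rw [show q.k c + e + j - (q.k c + e) = j by omega]
            exact hhat (c + 1) hi j hj'
        · have h3 := q.pos_lt G h2
          simp only [Nat.succ_eq_add_one] at h3
          rw [splice_right (by omega)]
          rw [show q.pos G i - q.pos G (c + 1) + (q.pos G c + q.k c + e) + j -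
            (q.pos G c + (q.k c + e + q.k (c + 1) + 1)) + (q.pos G (c + 1) + q.k (c + 1) + 1)
            = q.pos G i + j by omega, C.std_block G hi hj']
          exact hhat i hi j hj'

/-! ### Other queries in the modified words -/

/-- Every block of `p` lies within one block of `q`. -/
theorem exists_region (C : Coding O Q S q) {p : BlockSeq U B} (hp : p.Normal O) {G : ℕ}
    {s : ℕ → ℕ} (hs : p.Matches (wordTrace O (C.std G)) s) (hpk : ∀ l ≤ p.n, p.k l ≤ G) :
    ∀ l ≤ p.n, ∃ i ≤ q.n, q.pos G i ≤ s l ∧ s l + p.k l ≤ q.pos G i + q.k i := by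
  intro l hl
  have h1 : ∃ i j, i ≤ q.n ∧ j ≤ q.k i ∧ s l = q.pos G i + j := by
    by_cases h0 : l = 0
    · exact ⟨0, 0, Nat.zero_le _, Nat.zero_le _, by rw [h0, hs.zero]; rfl⟩
    · exact C.std_of_not_isTop (hs.first hl) (hp.first l hl (by omega))
  obtain ⟨i, j, hi, hj, hij⟩ := h1
  refine ⟨i, hi, by omega, ?_⟩
  by_cases h0 : p.k l = 0
  · omega
  · obtain ⟨i', j', hi', hj', hij'⟩ :=
      C.std_of_not_isTop (hs.last hl) (hp.last l hl (Or.inr (by omega)))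
    have := hpk l hl
    rcases lt_trichotomy i i' with h | rfl | h
    · have := q.pos_lt G h; omega
    · omega
    · have := q.pos_lt G h; omega

/-- If the blocks of `p` in block `c` of `q` can be moved to `M`, then `p` matches the modified
word. -/
theorem matches_modify (C : Coding O Q S q) {p : BlockSeq U B} {G : ℕ} {s : ℕ → ℕ}
    (hs : p.Matches (wordTrace O (C.std G)) s)
    (hr : ∀ l ≤ p.n, ∃ i ≤ q.n, q.pos G i ≤ s l ∧ s l + p.k l ≤ q.pos G i + q.k i)
    (hd : ∀ l < p.n, p.d l ≤ G + 1) {c : ℕ} {M : ℕ → DataInstance U B} {m : ℕ}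
    (u : ℕ → ℕ) (hu0 : c = 0 → u 0 = 0)
    (hlen : ∀ l ≤ p.n, q.pos G c ≤ s l → s l + p.k l ≤ q.pos G c + q.k c → u l + p.k l < m)
    (hhold : ∀ l ≤ p.n, q.pos G c ≤ s l → s l + p.k l ≤ q.pos G c + q.k c →
      ∀ j ≤ p.k l, Entails O (M (u l + j)) ((p.blk l).get j) 0)
    (hstep : ∀ l < p.n, q.pos G c ≤ s l → s (l + 1) + p.k (l + 1) ≤ q.pos G c + q.k c →
      u l + p.k l + p.d l ≤ u (l + 1)) :
    ∃ s, p.Matches (wordTrace O (C.modify G c c M m)) s := by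
  -- Every block of `p` lies left of, inside or right of block `c` of `q`, and `G` empty points
  -- separate these regions. They absorb any distance `d ≤ G + 1`, so only steps inside the region
  -- of `c` have to be assumed.
  have hcases : ∀ l ≤ p.n, (s l + p.k l + G < q.pos G c) ∨
      (q.pos G c ≤ s l ∧ s l + p.k l ≤ q.pos G c + q.k c) ∨ q.pos G c + q.k c + G < s l := by
    intro l hl
    obtain ⟨i, hi, h1, h2⟩ := hr l hl
    rcases lt_trichotomy i c with h | rfl | h
    · have := q.pos_lt G h; omega
    · exact Or.inr (Or.inl ⟨h1, h2⟩)
    · have := q.pos_lt G h; omega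
  refine ⟨fun l => if s l < q.pos G c then s l else if s l ≤ q.pos G c + q.k c then
    q.pos G c + u l else s l - (q.pos G c + q.k c + 1) + (q.pos G c + m), ?_, fun l hl => ?_,
    fun l hl j hj => ?_⟩
  · simp only [hs.zero]
    split_ifs with h1 h2
    · rfl
    · have h0 : c = 0 := by
        by_contra hne
        have := q.pos_lt G (Nat.pos_of_ne_zero hne)
        omega
      rw [hu0 h0, h0]; rfl
    · omega
  · have hst := hs.step l hl
    have hdl := hd l hl
    rcases hcases l hl.le with h | ⟨h, h'⟩ | h <;>
      rcases hcases (l + 1) hl with g | ⟨g, g'⟩ | g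
    · rw [if_pos (by omega), if_pos (by omega)]; exact hst
    · rw [if_pos (by omega), if_neg (by omega), if_pos (by omega)]; omega
    · rw [if_pos (by omega), if_neg (by omega), if_neg (by omega)]; omega
    · omega
    · rw [if_neg (by omega), if_pos (by omega), if_neg (by omega), if_pos (by omega)]
      have := hstep l hl h g'
      omega
    · rw [if_neg (by omega), if_pos (by omega), if_neg (by omega), if_neg (by omega)]
      have := hlen l hl.le h h'
      omega
    · omega
    · omega
    · rw [if_neg (by omega), if_neg (by omega), if_neg (by omega), if_neg (by omega)]
      omega
  · have hh := hs.holds l hl j hj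
    have hj' : j ≤ p.k l := hj
    unfold wordTrace modify at *
    rcases hcases l hl with h | ⟨h, h'⟩ | h
    · rw [if_pos (by omega), splice_left (by omega)]
      exact hh
    · have := hlen l hl h h'
      rw [if_neg (by omega), if_pos (by omega), add_assoc (q.pos G c) (u l), splice_mid (by omega)]
      exact hhold l hl h h' j hj
    · rw [if_neg (by omega), if_neg (by omega), splice_right (by omega),
        show s l - (q.pos G c + q.k c + 1) + (q.pos G c + m) + j - (q.pos G c + m) +
          (q.pos G c + q.k c + 1) = s l + j by omega]
      exact hh

end Coding

end BlockSeq

/-- `Contained` compares entailment from data, whereas satisfiability speaks of models. Containment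
reduction connects the two: a satisfiable `q` has satisfiable data `q̂` that entails `q`, hence also
`s`. -/
theorem satisfiable_mono {O : Ontology U B} (hO : AdmitsContainmentReduction O)
    {r s : DomainQuery U B} (h : Contained O r s) (hr : Satisfiable O r) : Satisfiable O s := by
  cases r with
  | bot =>
    obtain ⟨I, _, d, hd⟩ := hr
    exact hd.elim
  | cq q =>
    obtain ⟨p, hp⟩ := hO q
    exact satisfiable_of_entails (hp.sat_iff.1 hr)
      (h p ((hp.contained_iff hr q).1 (Contained.refl O _)))

/-! ### Candidate words, and the normal forms that agree with `q` on them -/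

namespace BlockSeq

theorem pos_add_le (q : BlockSeq U B) (G : ℕ) {i j : ℕ} (h : i ≤ j) :
    q.pos G i + q.k i ≤ q.pos G j + q.k j := by
  rcases h.eq_or_lt with rfl | h
  · exact le_rfl
  · have := q.pos_lt G h; omega

theorem Over.get_mem {q : BlockSeq U B} {R : Set (DomainQuery U B)} (h : q.Over R) {i j : ℕ}
    (hi : i ≤ q.n) (hj : j ≤ q.k i) : (q.blk i).get j ∈ R := by
  cases j with
  | zero => exact (h i hi).1
  | succ j =>
    have hlt : j < (q.blk i).rest.length := hj
    have : (q.blk i).get (j + 1) = (q.blk i).rest[j] := by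
      simp [Block.get, hlt]
    rw [this]
    exact (h i hi).2 _ (List.getElem_mem hlt)

namespace Coding

variable {O : Ontology U B} {Q : Set (DomainQuery U B)} {S : ℕ} {q : BlockSeq U B}

/-- The words from which the examples are built. -/
inductive Candidate (C : Coding O Q S q) (G₀ G N : ℕ) : (ℕ → DataInstance U B) → Prop
  | short : Candidate C G₀ G N (C.std G₀)
  | long : Candidate C G₀ G N (C.std G)
  | point (c j : ℕ) (x : DataInstance U B) (hc : c ≤ q.n) (hj : j ≤ q.k c)
      (hx : x = emptyLetter U B S ∨ x ∈ C.neg ((q.blk c).get j)) :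
      Candidate C G₀ G N (C.modify G c c (C.pointWord c j x) (q.k c + 1))
  | split (c : ℕ) (hc : c ≤ q.n) :
      Candidate C G₀ G N (C.modify G c c (C.splitWord G c) (2 * q.k c + G))
  | first (c : ℕ) (x : DataInstance U B) (hc : c ≤ q.n)
      (hx : x = C.h c 0 ∨ x ∈ C.neg ((q.blk c).get 0)) :
      Candidate C G₀ G N (C.modify G c c (C.firstWord G c x) (q.k c + G + 2))
  | last (c : ℕ) (x : DataInstance U B) (hc : c ≤ q.n)
      (hx : x ∈ C.neg ((q.blk c).get (q.k c))) :
      Candidate C G₀ G N (C.modify G c c (C.lastWord G c x) (q.k c + G + 2))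
  | cycle (c : ℕ) (hc : c ≤ q.n) :
      Candidate C G₀ G N (C.modify G c c
        (cycleWord S (emptyLetter U B S :: (C.neg ((q.blk c).get 0)).toList))
        (N * ((C.neg ((q.blk c).get 0)).card + 1)))
  | gap (c e : ℕ) (hc : c < q.n) (he : e ≤ q.d c)
      (hsat : e = 0 → Satisfiable O ((q.blk c).last.conj (q.blk (c + 1)).first)) :
      Candidate C G₀ G N
        (C.modify G c (c + 1) (C.gapWord c e) (q.k c + e + q.k (c + 1) + 1))

/-- A placement of the blocks of `p` within the blocks of `q`. -/
structure Placement (C : Coding O Q S q) (p : BlockSeq U B) (G : ℕ) (s : ℕ → ℕ) : Prop where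
  normal : p.Normal O
  isMatch : p.Matches (wordTrace O (C.std G)) s
  region : ∀ l ≤ p.n, ∃ i ≤ q.n, q.pos G i ≤ s l ∧ s l + p.k l ≤ q.pos G i + q.k i
  dist : ∀ l < p.n, p.d l ≤ G + 1

namespace Placement

variable {C : Coding O Q S q} {p : BlockSeq U B} {G : ℕ} {s : ℕ → ℕ}

/-- Block `c` of `p` agrees with block `c` of `q`. -/
structure Fixed (_ : Placement C p G s) (c : ℕ) : Prop where
  le : c ≤ p.n
  start : s c = q.pos G c
  k_eq : p.k c = q.k c
  contained : ∀ j ≤ q.k c, Contained O ((p.blk c).get j) ((q.blk c).get j)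

theorem get_contained (P : Placement C p G s) {c l j o : ℕ} (hc : c ≤ q.n) (hl : l ≤ p.n)
    (hj : j ≤ p.k l) (ho : s l = q.pos G c + o) (hk : o + j ≤ q.k c) :
    Contained O ((q.blk c).get (o + j)) ((p.blk l).get j) := by
  have := P.isMatch.holds l hl j hj
  rw [ho, add_assoc] at this
  exact (C.std_contained hc hk).1 this

/-- If the next block of `p` still met block `c` of `q`, it would be a primitive block at the last
point of block `c`, linked by `≤`. What holds there follows from the last query of block `c` of `p`,
because block `c` is fixed; this contradicts (n3) for `p`. -/
theorem next_start (P : Placement C p G s) {c : ℕ} (hc : c ≤ q.n) (hF : P.Fixed c)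
    (hn : c < p.n) : c < q.n ∧ q.pos G (c + 1) ≤ s (c + 1) := by
  have h1 := P.isMatch.step c hn
  rw [hF.start, hF.k_eq] at h1
  obtain ⟨i, hi, h2, h3⟩ := P.region (c + 1) hn
  rcases lt_trichotomy i c with h | rfl | h
  · have := q.pos_lt G h; omega
  · exfalso
    have h0 : s (i + 1) = q.pos G i + q.k i := by omega
    refine P.normal.link i hn (by omega) (by omega) ?_
    have h4 := P.get_contained (j := 0) hc hn (Nat.zero_le _) h0 (by omega)
    have h5 := hF.contained _ le_rfl
    rw [← hF.k_eq, Block.get_len, hF.k_eq] at h5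
    exact h5.trans h4
  · refine ⟨by omega, ?_⟩
    rcases (Nat.succ_le_of_lt h).eq_or_lt with rfl | h
    · exact h2
    · have := q.pos_lt G h
      simp only [Nat.succ_eq_add_one] at this
      omega

/-- A block of `p` that uses the first letter of block `c` has to start there. If there is none,
that letter can be erased without affecting `p`, while `q` is destroyed. -/
theorem exists_start (P : Placement C p G s) (hq : q.Normal O) (hG : ∀ i ≤ q.n, q.k i ≤ G)
    {N G₀ : ℕ} (hagree : ∀ w, C.Candidate G₀ G N w →
      (∃ s, p.Matches (wordTrace O w) s) → ∃ s, q.Matches (wordTrace O w) s)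
    {c : ℕ} (hc : c ≤ q.n) : ∃ l ≤ p.n, s l = q.pos G c := by
  by_cases h0 : c = 0
  · exact ⟨0, Nat.zero_le _, by rw [P.isMatch.zero, h0]; rfl⟩
  by_contra! hcon
  refine C.not_matches_pointWord hq hc hG (Nat.zero_le (q.k c)) (x := emptyLetter U B S)
    (not_empty_entails (hq.first c hc (by omega)))
    (hagree _ (.point c 0 _ hc (Nat.zero_le _) (Or.inl rfl)) ?_)
  refine C.matches_modify P.isMatch P.region P.dist (fun l => s l - q.pos G c) (fun h => (h0 h).elim)
    (fun l hl h1 h2 => by omega) (fun l hl h1 h2 j hj => ?_) (fun l hl h1 h2 => ?_)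
  · have := hcon l hl
    rw [pointWord, if_neg (by omega), C.entails_h hc (by omega)]
    exact P.get_contained hc hl hj (by omega) (by omega)
  · have := P.isMatch.step l hl
    omega

/-- The block of `p` that starts together with block `c` has index at least `c`, as earlier blocks
are fixed elsewhere; hence block `c` of `p` starts no later. By `next_start` it starts no earlier.
-/
theorem start_eq (P : Placement C p G s) (hq : q.Normal O) (hG : ∀ i ≤ q.n, q.k i ≤ G)
    {N G₀ : ℕ} (hagree : ∀ w, C.Candidate G₀ G N w →
      (∃ s, p.Matches (wordTrace O w) s) → ∃ s, q.Matches (wordTrace O w) s)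
    {c : ℕ} (hc : c ≤ q.n) (hF : ∀ i < c, P.Fixed i) : c ≤ p.n ∧ s c = q.pos G c := by
  cases c with
  | zero => exact ⟨Nat.zero_le _, P.isMatch.zero⟩
  | succ c =>
    obtain ⟨l, hl, hsl⟩ := P.exists_start hq hG hagree hc
    have hcl : c + 1 ≤ l := by
      by_contra hlt
      have := (hF l (by omega)).start
      have := q.pos_lt G (show l < c + 1 by omega)
      omega
    refine ⟨hcl.trans hl, le_antisymm ?_ ?_⟩
    · rcases hcl.eq_or_lt with rfl | h
      · exact hsl.le
      · have := P.isMatch.mono h hl; omega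
    · exact (P.next_start (by omega) (hF c (by omega)) (by omega)).2

/-- Otherwise every block of `p` inside block `c` misses its first or its last point, and fits into
one of the two halves of `splitWord`. -/
theorem exists_cover (P : Placement C p G s) (hq : q.Normal O) (hG : ∀ i ≤ q.n, q.k i ≤ G)
    {N G₀ : ℕ} (hagree : ∀ w, C.Candidate G₀ G N w →
      (∃ s, p.Matches (wordTrace O w) s) → ∃ s, q.Matches (wordTrace O w) s)
    {c : ℕ} (hc : c ≤ q.n) (hk : 0 < q.k c) :
    ∃ l ≤ p.n, s l = q.pos G c ∧ p.k l = q.k c := by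
  by_contra! hcon
  have hGc := hG c hc
  refine C.not_matches_splitWord hq hc hG hk (hagree _ (.split c hc) ?_)
  refine C.matches_modify P.isMatch P.region P.dist
    -- The second half starts at `k + G` with point `1` of the block, so its point `o` is found at
    -- `o + (k + G - 1)`.
    (fun l => if s l = q.pos G c then 0 else s l - q.pos G c + (q.k c + G - 1)) (fun h => ?_)
    (fun l hl h1 h2 => ?_) (fun l hl h1 h2 j hj => ?_) (fun l hl h1 h2 => ?_)
  · subst h
    exact if_pos P.isMatch.zero
  · have := hcon l hl
    split_ifs with h
    · have := this h; omega
    · omega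
  · have hj' : j ≤ p.k l := hj
    have := hcon l hl
    split_ifs with h
    · have := this h
      rw [splitWord, if_pos (by omega), C.entails_h hc (by omega)]
      exact P.get_contained hc hl hj (by omega) (by omega)
    · rw [splitWord, if_neg (by omega), if_neg (by omega),
        show s l - q.pos G c + (q.k c + G - 1) + j - (q.k c + G) + 1 = s l - q.pos G c + j by omega,
        C.entails_h hc (by omega)]
      exact P.get_contained hc hl hj (by omega) (by omega)
  · have hst := P.isMatch.step l hl
    have := P.dist l hl
    have := hcon l hl.le
    split_ifs with h3 h4 h4 <;> omega

/-- Blocks of `p` before the covering block `l` are primitive and stay at the isolated first letter.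
All others move to the copy of the block, where only `l` reads `x`: the later ones start at the last
point. For `c = 0` block `0` of `p` must stay at time `0`, hence `0 < l`. -/
theorem matches_firstWord (P : Placement C p G s) {c l : ℕ} (hc : c ≤ q.n) (hk : 0 < q.k c)
    (hl : l ≤ p.n) (hsl : s l = q.pos G c) (hkl : p.k l = q.k c) (h0 : c = 0 → 0 < l)
    {x : DataInstance U B} (hx : Entails O x (p.blk l).first 0) :
    ∃ s, p.Matches (wordTrace O (C.modify G c c (C.firstWord G c x) (q.k c + G + 2))) s := by
  have hbefore : ∀ i < l, q.pos G c ≤ s i → s i = q.pos G c ∧ p.k i = 0 := by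
    intro i hi h
    have := P.isMatch.mono hi hl
    omega
  have hafter : ∀ i, l < i → i ≤ p.n → q.pos G c + q.k c ≤ s i := by
    intro i hi h
    have := P.isMatch.mono hi h
    omega
  refine C.matches_modify P.isMatch P.region P.dist
    (fun i => if i < l then 0 else s i - q.pos G c + (G + 1)) (fun h => if_pos (h0 h))
    (fun i hi h1 h2 => ?_) (fun i hi h1 h2 j hj => ?_) (fun i hi h1 h2 => ?_)
  · split_ifs with h
    · have := hbefore i h h1; omega
    · omega
  · have hj' : j ≤ p.k i := hj
    split_ifs with h
    · have := hbefore i h h1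
      obtain rfl : j = 0 := by omega
      rw [firstWord, if_pos rfl, C.entails_h hc (by omega)]
      exact P.get_contained hc hi hj (by omega) (by omega)
    · rw [firstWord, if_neg (by omega), if_neg (by omega)]
      by_cases hil : i = l
      · subst hil
        by_cases hj0 : j = 0
        · subst hj0
          rw [if_pos (by omega)]
          exact hx
        · rw [if_neg (by omega),
            show s i - q.pos G c + (G + 1) + j - (G + 1) = s i - q.pos G c + j by omega,
            C.entails_h hc (by omega)]
          exact P.get_contained hc hi hj (by omega) (by omega)
      · have := hafter i (by omega) hi
        rw [if_neg (by omega),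
          show s i - q.pos G c + (G + 1) + j - (G + 1) = s i - q.pos G c + j by omega,
          C.entails_h hc (by omega)]
        exact P.get_contained hc hi hj (by omega) (by omega)
  · have hst := P.isMatch.step i hi
    have := P.dist i hi
    split_ifs with h3 h4
    · have h5 := hbefore i h3 h1
      have h6 := hbefore (i + 1) h4 (by omega)
      omega
    · have h5 := hbefore i h3 h1
      omega
    · omega
    · omega

/-- Suppose that block `c` of `q` is covered by a block `l > c` of `p`. Unless the first query of
`l` implies that of block `c`, some negative letter satisfies the former only, and `firstWord`
separates `p` from `q`; for `c = 0` the original letter already does. If the implication holds,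
block `l - 1` of `p` is primitive at the same point and implied by the first query of `l`, contrary
to (n4). -/
theorem cover_eq (P : Placement C p G s) (hq : q.Normal O) (hG : ∀ i ≤ q.n, q.k i ≤ G)
    {N G₀ : ℕ} (hpQ : p.Over Q) (hagree : ∀ w, C.Candidate G₀ G N w →
      (∃ s, p.Matches (wordTrace O w) s) → ∃ s, q.Matches (wordTrace O w) s)
    {c : ℕ} (hc : c ≤ q.n) (hF : ∀ i < c, P.Fixed i) (hk : 0 < q.k c) :
    p.k c = q.k c := by
  obtain ⟨l, hl, hsl, hkl⟩ := P.exists_cover hq hG hagree hc hk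
  obtain ⟨hcn, hsc⟩ := P.start_eq hq hG hagree hc hF
  rcases lt_trichotomy l c with h | rfl | h
  · have := (hF l h).start
    have := q.pos_lt G h
    omega
  · exact hkl
  exfalso
  by_cases h0 : c = 0
  · subst h0
    have hx : Entails O (C.h 0 0) (p.blk l).first 0 :=
      (C.entails_h hc (Nat.zero_le _)).2
        (P.get_contained hc hl (Nat.zero_le _) hsl (by omega))
    exact C.not_matches_firstWord hq hc hG hk (fun h => absurd h (lt_irrefl 0))
      (hagree _ (.first 0 _ hc (Or.inl rfl))
        (P.matches_firstWord hc hk hl hsl hkl (fun _ => h) hx))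
  · have hcont : Contained O (p.blk l).first (q.blk c).first := by
      by_contra hcon
      obtain ⟨x, hx, hx'⟩ := (C.split c hc 0 (Nat.zero_le _)).neg_of _ (hpQ l hl).1
        (P.get_contained (j := 0) hc hl (Nat.zero_le _) hsl (by omega)) hcon
      exact C.not_matches_firstWord hq hc hG hk
        (fun _ => (C.split c hc 0 (Nat.zero_le _)).neg_not x hx)
        (hagree _ (.first c x hc (Or.inr hx))
          (P.matches_firstWord hc hk hl hsl hkl (fun h => (h0 h).elim) hx'))
    obtain ⟨l, rfl⟩ : ∃ l', l = l' + 1 := ⟨l - 1, by omega⟩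
    have h1 : q.pos G c ≤ s l := by
      rcases (show c ≤ l by omega).eq_or_lt with rfl | h
      · exact hsc.ge
      · have := P.isMatch.mono h (by omega); omega
    have h2 := P.isMatch.step l hl
    have hk0 : p.k l = 0 := by omega
    refine P.normal.back l hl (by omega) (by omega) hk0 (hcont.trans ?_)
    have := P.get_contained (j := 0) (o := 0) hc (show l ≤ p.n by omega) (Nat.zero_le _)
      (by omega) (by omega)
    rw [Block.last_of_len hk0]
    exact this

/-- If a query of block `c` of `p` is strictly weaker than its counterpart in `q`, a negative letter
can replace the latter. Other blocks of `p` in this region are primitive and sit at the last point.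
They do not notice a change elsewhere, and for a change of the last point `lastWord` offers them a
separate copy of the original letter. -/
theorem fixed_of_pos (P : Placement C p G s) (hq : q.Normal O) (hG : ∀ i ≤ q.n, q.k i ≤ G)
    {N G₀ : ℕ} (hpQ : p.Over Q) (hagree : ∀ w, C.Candidate G₀ G N w →
      (∃ s, p.Matches (wordTrace O w) s) → ∃ s, q.Matches (wordTrace O w) s)
    {c : ℕ} (hc : c ≤ q.n) (hF : ∀ i < c, P.Fixed i) (hk : c = 0 ∨ 0 < q.k c) : P.Fixed c := by
  obtain ⟨hcn, hsc⟩ := P.start_eq hq hG hagree hc hF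
  have hkc : p.k c = q.k c := by
    by_cases h : q.k c = 0
    · obtain ⟨i, hi, h1, h2⟩ := P.region c hcn
      obtain rfl := hk.resolve_right (by omega)
      rcases Nat.eq_zero_or_pos i with rfl | hi0
      · have : q.pos G 0 = 0 := rfl
        omega
      · have := q.pos_lt G hi0
        omega
    · exact P.cover_eq hq hG hpQ hagree hc hF (by omega)
  have hbefore : ∀ i < c, s i < q.pos G c := by
    intro i hi
    have := (hF i hi).start
    have := q.pos_lt G hi
    omega
  have hafter : ∀ i, c < i → i ≤ p.n → q.pos G c + q.k c ≤ s i := by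
    intro i hi h
    have := P.isMatch.mono hi h
    omega
  refine ⟨hcn, hsc, hkc, fun j hj => ?_⟩
  by_contra hcon
  obtain ⟨x, hx, hx'⟩ := (C.split c hc j hj).neg_of _ (hpQ.get_mem hcn (hkc.ge.trans' hj))
    (by have := P.get_contained (o := 0) (j := j) hc hcn (by omega) (by omega) (by omega)
        rwa [Nat.zero_add] at this) hcon
  have hxn := (C.split c hc j hj).neg_not x hx
  rcases hj.eq_or_lt with rfl | hjk
  · rw [Block.get_len] at hxn
    refine C.not_matches_lastWord hq hc hG hk hxn (hagree _ (.last c x hc hx) ?_)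
    refine C.matches_modify P.isMatch P.region P.dist
      (fun i => if i = c then 0 else q.k c + 1 + G) (fun h => if_pos h.symm)
      (fun i hi h1 h2 => ?_) (fun i hi h1 h2 j hj => ?_) (fun i hi h1 h2 => ?_)
    · split_ifs with h
      · subst h; omega
      · have := hbefore i
        have := hafter i
        omega
    · have hj' : j ≤ p.k i := hj
      split_ifs with h
      · subst h
        rw [Nat.zero_add, lastWord]
        split_ifs with h3 h4 h5
        · rw [C.entails_h hc (by omega)]
          have := P.get_contained (o := 0) (j := j) hc hcn (by omega) (by omega) (by omega)
          rwa [Nat.zero_add] at this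
        · rw [h4]; exact hx'
        · omega
        · omega
      · have h3 := hbefore i
        have h4 := hafter i (by omega) hi
        obtain rfl : j = 0 := by omega
        rw [lastWord, if_neg (by omega), if_neg (by omega), if_neg (by omega),
          C.entails_h hc le_rfl]
        exact P.get_contained (o := q.k c) hc hi hj (by omega) (by omega)
    · have hst := P.isMatch.step i hi
      have := P.dist i hi
      have h3 := hbefore i
      split_ifs with h4 h5
      · omega
      · subst h4; omega
      · have := hafter i (by omega) hi.le
        omega
      · have := hafter i (by omega) hi.le
        omega
  · refine C.not_matches_pointWord hq hc hG hj hxn (hagree _ (.point c j x hc hj (Or.inr hx)) ?_)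
    refine C.matches_modify P.isMatch P.region P.dist (fun l => s l - q.pos G c)
      (fun h => by subst h; simp [P.isMatch.zero])
      (fun l hl h1 h2 => by omega) (fun l hl h1 h2 j' hj' => ?_) (fun l hl h1 h2 => ?_)
    · have hj'' : j' ≤ p.k l := hj'
      rw [pointWord]
      split_ifs with h
      · obtain rfl : l = c := by
          have h3 := hbefore l
          have h4 := hafter l
          omega
        obtain rfl : j' = j := by omega
        exact hx'
      · rw [C.entails_h hc (by omega)]
        exact P.get_contained hc hl hj' (by omega) (by omega)
    · have := P.isMatch.step l hl
      omega

theorem matches_pointWord_zero (P : Placement C p G s) {c : ℕ} (hk : q.k c = 0)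
    {x : DataInstance U B}
    (hx : ∀ l ≤ p.n, s l = q.pos G c → Entails O x (p.blk l).first 0) :
    ∃ s, p.Matches (wordTrace O (C.modify G c c (C.pointWord c 0 x) (q.k c + 1))) s := by
  refine C.matches_modify P.isMatch P.region P.dist (fun _ => 0)
    (fun _ => rfl) (fun l hl h1 h2 => by omega) (fun l hl h1 h2 j hj => ?_) (fun l hl h1 h2 => ?_)
  · have hj' : j ≤ p.k l := hj
    obtain rfl : j = 0 := by omega
    rw [pointWord, if_pos (by omega)]
    exact hx l hl (by omega)
  · have := P.isMatch.step l hl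
    omega

/-- The decisive case. The blocks of `p` at the point of block `c` form a chain of primitive blocks
linked by `≤`, starting with block `c` of `p`. If that one is strictly weaker than the query of `q`,
so are all of them, and each alternative of `halt` provides a word that satisfies the chain but not
`q`. -/
theorem fixed_of_primitive (P : Placement C p G s) (hq : q.Normal O)
    (hG : ∀ i ≤ q.n, q.k i ≤ G) (hQ : ConjClosed Q)
    {N G₀ : ℕ} (hpQ : p.Over Q) (hagree : ∀ w, C.Candidate G₀ G N w →
      (∃ s, p.Matches (wordTrace O w) s) → ∃ s, q.Matches (wordTrace O w) s)
    {c : ℕ} (hc : c ≤ q.n) (hF : ∀ i < c, P.Fixed i) (h0 : 0 < c) (hk : q.k c = 0)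
    (halt : ¬ MeetReducible O Q (q.blk c).first ∨ (∀ l < p.n, 1 ≤ p.d l) ∨ p.n < N) :
    P.Fixed c := by
  obtain ⟨hcn, hsc⟩ := P.start_eq hq hG hagree hc hF
  have hge : ∀ l ≤ p.n, s l = q.pos G c → c ≤ l := by
    intro l hl hsl
    by_contra hlt
    have := (hF l (by omega)).start
    have := q.pos_lt G (show l < c by omega)
    omega
  have hk0 : ∀ l ≤ p.n, s l = q.pos G c → p.k l = 0 := by
    intro l hl hsl
    obtain ⟨i, hi, h1, h2⟩ := P.region l hl
    obtain rfl : i = c := by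
      rcases lt_trichotomy i c with h | rfl | h
      · have := q.pos_lt G h; omega
      · rfl
      · have := q.pos_lt G h; omega
    omega
  have hstrong : ∀ l ≤ p.n, s l = q.pos G c → Contained O (q.blk c).first (p.blk l).first :=
    fun l hl hsl => P.get_contained (j := 0) (o := 0) hc hl (Nat.zero_le _) hsl (by omega)
  have hkc := (hk0 c hcn hsc).trans hk.symm
  suffices hcont : Contained O (p.blk c).first (q.blk c).first by
    refine ⟨hcn, hsc, hkc, fun j hj => ?_⟩
    obtain rfl : j = 0 := by omega
    exact hcont
  by_contra hcon
  -- If block `l > c` of `p` implied the query of `q`, it would also imply block `l - 1` of `p`,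
  -- which sits at the same point; (n4) forbids this.
  have hall : ∀ l ≤ p.n, s l = q.pos G c → ¬ Contained O (p.blk l).first (q.blk c).first := by
    intro l hl hsl hl'
    have hcl := hge l hl hsl
    rcases hcl.eq_or_lt with rfl | h
    · exact hcon hl'
    obtain ⟨l, rfl⟩ : ∃ l', l = l' + 1 := ⟨l - 1, by omega⟩
    have h2 := P.isMatch.step l hl
    have h1 : q.pos G c ≤ s l := by
      rcases (show c ≤ l by omega).eq_or_lt with rfl | h
      · exact hsc.ge
      · have := P.isMatch.mono h (by omega); omega
    have hsl' : s l = q.pos G c := by omega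
    have hkl := hk0 l (by omega) hsl'
    refine P.normal.back l hl (by omega) (by omega) hkl (hl'.trans ?_)
    rw [Block.last_of_len hkl]
    exact hstrong l (by omega) hsl'
  have hsplit := C.split c hc 0 (Nat.zero_le _)
  have hpoint : ∀ y ∈ Q, Contained O (q.blk c).first y → ¬ Contained O y (q.blk c).first →
      (∀ l ≤ p.n, s l = q.pos G c → Contained O y (p.blk l).first) → False := by
    intro y hy h1 h2 h3
    obtain ⟨x, hx, hx'⟩ := hsplit.neg_of y hy h1 h2
    refine C.not_matches_pointWord hq hc hG (Nat.zero_le _) (hsplit.neg_not x hx)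
      (hagree _ (.point c 0 x hc (Nat.zero_le _) (Or.inr hx))
        (P.matches_pointWord_zero hk fun l hl hsl => (h3 l hl hsl).entails ?_ hx'))
    rw [(hsplit.neg_letter x hx).ind_eq]; simp
  rcases halt with hirr | hlt | hN
  -- Without meet-reducibility, the conjunction of two strictly weaker queries of `Q` is strictly
  -- weaker. Hence so is the conjunction of the whole chain, and one negative letter entails all of
  -- it.
  · have hfin : ∀ t : Finset ℕ, (∀ l ∈ t, l ≤ p.n ∧ s l = q.pos G c) →
        ∃ y ∈ Q, Contained O (q.blk c).first y ∧ ¬ Contained O y (q.blk c).first ∧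
          ∀ l ∈ t, Contained O y (p.blk l).first := by
      intro t
      induction t using Finset.induction_on with
      | empty =>
        intro _
        exact ⟨_, (hpQ c hcn).1, hstrong c hcn hsc, hcon, by simp⟩
      | insert l t _ ih =>
        intro ht
        obtain ⟨y, hy, h1, h2, h3⟩ := ih fun l hl => ht l (Finset.mem_insert_of_mem hl)
        obtain ⟨hl, hsl⟩ := ht l (Finset.mem_insert_self _ _)
        refine ⟨y.conj (p.blk l).first, hQ _ hy _ (hpQ l hl).1,
          contained_conj h1 (hstrong l hl hsl), fun h => ?_, fun l' hl' => ?_⟩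
        · exact hirr ⟨y, hy, _, (hpQ l hl).1, ⟨contained_conj h1 (hstrong l hl hsl), h⟩,
            fun e => h2 e.2, fun e => hall l hl hsl e.2⟩
        · rcases Finset.mem_insert.1 hl' with rfl | hl'
          · exact contained_conj_right O _ _
          · exact (contained_conj_left O _ _).trans (h3 l' hl')
    classical
    obtain ⟨y, hy, h1, h2, h3⟩ := hfin
      ((Finset.range (p.n + 1)).filter fun l => s l = q.pos G c) fun l hl => by
        rw [Finset.mem_filter, Finset.mem_range] at hl
        exact ⟨Nat.le_of_lt_succ hl.1, hl.2⟩
    exact hpoint y hy h1 h2 fun l hl hsl =>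
      h3 l (Finset.mem_filter.2 ⟨Finset.mem_range.2 (Nat.lt_succ_of_le hl), hsl⟩)
  · refine hpoint _ (hpQ c hcn).1 (hstrong c hcn hsc) hcon fun l hl hsl => ?_
    obtain rfl : l = c := by
      by_contra hne
      have h1 := hge l hl hsl
      have h2 := P.isMatch.step c (by omega)
      have h3 := hlt c (by omega)
      rcases (show c + 1 ≤ l by omega).eq_or_lt with rfl | h
      · omega
      · have := P.isMatch.mono h hl; omega
    exact Contained.refl O _
  -- The empty letter only keeps the list non-empty.
  · set xs := emptyLetter U B S :: (C.neg ((q.blk c).get 0)).toList with hxs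
    have hlen : xs.length = (C.neg ((q.blk c).get 0)).card + 1 := by simp [hxs]
    have hne : ∀ x ∈ xs, ¬ Entails O x (q.blk c).first 0 := by
      intro x hx
      rcases List.mem_cons.1 hx with rfl | hx
      · exact not_empty_entails (hq.first c hc h0)
      · exact hsplit.neg_not x (Finset.mem_toList.1 hx)
    have hidx : ∀ l, ∃ i, i < xs.length ∧ (l ≤ p.n → s l = q.pos G c →
        Entails O (xs.getD i (emptyLetter U B S)) (p.blk l).first 0) := by
      intro l
      by_cases hl : l ≤ p.n ∧ s l = q.pos G c
      · obtain ⟨x, hx, hx'⟩ := hsplit.neg_of _ (hpQ l hl.1).1 (hstrong l hl.1 hl.2)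
          (hall l hl.1 hl.2)
        obtain ⟨i, hi, rfl⟩ := List.getElem_of_mem
          (show x ∈ xs from List.mem_cons_of_mem _ (Finset.mem_toList.2 hx))
        exact ⟨i, hi, fun _ _ => by rw [List.getD_eq_getElem _ _ hi]; exact hx'⟩
      · exact ⟨0, by simp [hxs], fun h1 h2 => (hl ⟨h1, h2⟩).elim⟩
    choose f hf hf' using hidx
    have hm : 1 ≤ N * xs.length := Nat.mul_pos (by omega) (by rw [hlen]; omega)
    have hcand := hagree _ (.cycle c hc)
    rw [← hlen] at hcand
    refine C.not_matches_cycleWord hq hc hG hne hm (hcand ?_)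
    -- Block `l` of the chain goes to round `l - c` of the cycle, at the index `f l` of a negative
    -- letter that entails its query. Successive blocks use successive rounds, so the order is
    -- respected, and `p.n < N` rounds are available.
    refine C.matches_modify P.isMatch P.region P.dist (fun l => (l - c) * xs.length + f l)
      (fun h => by omega) (fun l hl h1 h2 => ?_) (fun l hl h1 h2 j hj => ?_)
      (fun l hl h1 h2 => ?_)
    · have := hk0 l hl (by omega)
      have h3 := hf l
      have h4 : (l - c + 1) * xs.length ≤ N * xs.length := Nat.mul_le_mul_right _ (by omega)
      rw [Nat.add_mul, Nat.one_mul] at h4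
      omega
    · have hj' : j ≤ p.k l := hj
      have := hk0 l hl (by omega)
      obtain rfl : j = 0 := by omega
      rw [Nat.add_zero, cycleWord, Nat.mul_comm, Nat.mul_add_mod, Nat.mod_eq_of_lt (hf l)]
      exact hf' l hl (by omega)
    · have hst := P.isMatch.step l hl
      have h3 := hk0 l hl.le (by omega)
      have h4 := hge l hl.le (by omega)
      have h5 := hf l
      have h6 : (l + 1 - c) * xs.length = (l - c) * xs.length + xs.length := by
        rw [show l + 1 - c = l - c + 1 by omega, Nat.add_mul, Nat.one_mul]
      omega

end Placement

/-- A normal form that agrees with `q` on the candidate words is isomorphic to `q`. -/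
theorem stronger_of_agree (C : Coding O Q S q) (hO : AdmitsContainmentReduction O)
    (hQ : ConjClosed Q) (hq : q.Normal O) {p : BlockSeq U B} (hp : p.Normal O) (hpQ : p.Over Q)
    {G₀ G N : ℕ} (hd : ∀ i < q.n, q.d i ≤ G₀ + 1) (hGG : G₀ ≤ G)
    (hG : q.pos G₀ q.n + q.k q.n ≤ G)
    (hagree : ∀ w, C.Candidate G₀ G N w →
      ((∃ s, q.Matches (wordTrace O w) s) ↔ ∃ s, p.Matches (wordTrace O w) s))
    (halt : ∀ c ≤ q.n, 0 < c → q.k c = 0 →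
      ¬ MeetReducible O Q (q.blk c).first ∨ (∀ l < p.n, 1 ≤ p.d l) ∨ p.n < N) :
    Stronger O p q ∧ Stronger O q p ∧ ∀ i < q.n, p.d i = q.d i := by
  have hkG : ∀ i ≤ q.n, q.k i ≤ G := fun i hi => by
    have := q.pos_add_le G₀ hi; omega
  -- The word with gaps `G₀` is trivial after time `G`, and the last query of `p` is not trivial
  -- unless `p` is a single point. So the lengths and distances of `p` are bounded by `G`, which
  -- depends on `q` only; the gaps of the long word are therefore wide enough for `p` as well.
  have hbound : (∀ l ≤ p.n, p.k l ≤ G) ∧ ∀ l < p.n, p.d l ≤ G := by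
    obtain ⟨s, hs⟩ := (hagree _ .short).1 ⟨_, C.std_matches hd⟩
    by_cases h0 : p.n = 0 ∧ p.k 0 = 0
    · refine ⟨fun l hl => ?_, fun l hl => by omega⟩
      obtain rfl : l = 0 := by omega
      omega
    have hlast : ¬ IsTop O (p.blk p.n).last := by
      refine hp.last _ le_rfl ?_
      rcases Nat.eq_zero_or_pos p.n with h | h
      · rw [h] at h0 ⊢; omega
      · exact Or.inl h
    have hend : s p.n + p.k p.n ≤ G := by
      by_contra hlt
      have := hs.last le_rfl
      rw [wordTrace, C.std_end G₀ (by omega)] at this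
      exact not_empty_entails hlast this
    refine ⟨fun l hl => ?_, fun l hl => ?_⟩
    · rcases hl.eq_or_lt with rfl | h
      · omega
      · have := hs.mono h le_rfl; omega
    · have h1 := hs.step l hl
      rcases (Nat.succ_le_of_lt hl).eq_or_lt with h | h
      · simp only [Nat.succ_eq_add_one] at h
        rw [h] at h1; omega
      · have := hs.mono h le_rfl
        simp only [Nat.succ_eq_add_one] at this
        omega
  obtain ⟨s, hs⟩ := (hagree _ .long).1 ⟨_, C.std_matches fun i hi => (hd i hi).trans (by omega)⟩
  have P : Placement C p G s := ⟨hp, hs, C.exists_region hp hs hbound.1,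
    fun l hl => (hbound.2 l hl).trans (by omega)⟩
  have hag := fun w hw => (hagree w hw).2
  have hfix : ∀ c, c ≤ q.n → P.Fixed c := by
    intro c
    induction c using Nat.strong_induction_on with
    | _ c ih =>
      intro hc
      have hF : ∀ i < c, P.Fixed i := fun i hi => ih i hi (by omega)
      by_cases h : c = 0 ∨ 0 < q.k c
      · exact P.fixed_of_pos hq hkG hpQ hag hc hF h
      · push Not at h
        exact P.fixed_of_primitive hq hkG hQ hpQ hag hc hF (by omega) (by omega)
          (halt c hc (by omega) (by omega))
  have hn : p.n = q.n := by
    refine le_antisymm ?_ (hfix q.n le_rfl).le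
    by_contra hlt
    have := (P.next_start le_rfl (hfix q.n le_rfl) (by omega)).1
    omega
  have h1 : Stronger O p q := ⟨hn, fun i hi => (hfix i hi).k_eq, fun i hi => (hfix i hi).contained⟩
  have h2 : Stronger O q p := by
    refine ⟨hn.symm, fun i hi => ((hfix i (hn ▸ hi)).k_eq).symm, fun i hi j hj => ?_⟩
    have hF := hfix i (hn ▸ hi)
    have := P.get_contained (o := 0) (j := j) (hn ▸ hi) hi hj (by rw [hF.start]; rfl)
      (by rw [← hF.k_eq]; omega)
    rwa [Nat.zero_add] at this
  refine ⟨h1, h2, fun c hc => ?_⟩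
  have hqd : ∀ i < q.n, q.d i ≤ G + 1 := fun i hi => (hd i hi).trans (by omega)
  have hpd : ∀ i < q.n, p.d i ≤ G + 1 := fun i hi => (hbound.2 i (by omega)).trans (by omega)
  -- The gap word with `e = q.d c` is matched by `q`, hence by `p`. If `p.d c` were smaller, the
  -- word with `e = q.d c - 1` would be matched by `p` but not by `q`; for `e = 0` the letter needed
  -- exists by (n5) for `p`.
  have hle : p.d c ≤ q.d c :=
    C.le_of_matches_gapWord hp h1 hc hkG ((hagree _ (.gap c (q.d c) hc le_rfl (hq.sat c hc))).1
      (C.matches_gapWord (Stronger.refl O q) hc hqd le_rfl (hq.sat c hc)))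
  by_contra hne
  have hsat : q.d c - 1 = 0 → Satisfiable O ((q.blk c).last.conj (q.blk (c + 1)).first) := by
    intro h
    refine satisfiable_mono hO ?_ (hp.sat c (by omega) (by omega))
    refine contained_conj ((contained_conj_left O _ _).trans ?_)
      ((contained_conj_right O _ _).trans (h1.contained (c + 1) hc 0 (Nat.zero_le _)))
    have := h1.contained c hc.le _ le_rfl
    rwa [← h1.k_eq c hc.le, Block.get_len, h1.k_eq c hc.le, Block.get_len] at this
  have := C.le_of_matches_gapWord hq (Stronger.refl O q) hc hkG
    ((hagree _ (.gap c (q.d c - 1) hc (Nat.sub_le _ _) hsat)).2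
      (C.matches_gapWord h2 hc hpd (by omega) hsat))
  omega

end Coding

/-- Isomorphic block sequences match at the same time points. -/
theorem Stronger.matches {O : Ontology U B} {p q : BlockSeq U B} (h : Stronger O p q)
    (hd : ∀ i < q.n, p.d i = q.d i) {V : Trace U B} (hV : GoodTrace O V) {s : ℕ → ℕ}
    (hs : p.Matches V s) : q.Matches V s where
  zero := hs.zero
  step i hi := by
    rw [← h.k_eq i hi.le, ← hd i hi]
    exact hs.step i (h.n_eq ▸ hi)
  holds i hi j hj := hV.mono (h.contained i hi j hj)
    (hs.holds i (h.n_eq ▸ hi) j ((h.k_eq i hi).ge.trans' hj))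

end BlockSeq

/-! ### From words to temporal data -/

/-- A finite word of letters. -/
structure IsWord (O : Ontology U B) (S L : ℕ) (w : ℕ → DataInstance U B) : Prop where
  letter : ∀ p, IsLetter O S (w p)
  empty : ∀ p, L < p → w p = emptyLetter U B S

/-- The temporal data instance of a word. -/
def IsWord.toData {O : Ontology U B} {S L : ℕ} {w : ℕ → DataInstance U B} (hw : IsWord O S L w) :
    PointedTemporalData U B where
  data := ⟨L, fun i => w i, fun i => by rw [(hw.letter _).ind_eq, (hw.letter _).ind_eq]⟩
  pt := 0
  pt_mem := by
    change 0 ∈ (w _).ind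
    rw [(hw.letter _).ind_eq]; simp

namespace IsWord

variable {O : Ontology U B} {S L : ℕ} {w : ℕ → DataInstance U B}

theorem sat (hw : IsWord O S L w) : hw.toData.data.SatisfiableWrt O := fun i => (hw.letter i).sat

theorem trace_eq (hw : IsWord O S L w) :
    hw.toData.data.trace O hw.toData.pt = BlockSeq.wordTrace O w := by
  funext ℓ r
  unfold TemporalData.trace BlockSeq.wordTrace TemporalData.slice
  split_ifs with h
  · rfl
  · refine propext ⟨fun h' => ?_, fun h' => ?_⟩
    · refine (isTop_of_entails_trivialOn h').entails ?_
      rw [(hw.letter _).ind_eq]; simp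
    · rw [hw.empty ℓ (by
        have : ¬ ℓ < L + 1 := h
        omega)] at h'
      refine (entails_empty_iff.1 h').entails ?_
      exact (ind_trivialOn _ _).symm ▸ hw.toData.pt_mem

theorem entailedAt_iff (hw : IsWord O S L w) (q : PathQuery U B) :
    q.EntailedAt O hw.toData.data 0 hw.toData.pt ↔ q.HoldsIn (BlockSeq.wordTrace O w) := by
  rw [PathQuery.entailedAt_iff, hw.trace_eq]
  exact ⟨fun h => h hw.sat, fun h _ => h⟩

theorem goodTrace (hw : IsWord O S L w) : GoodTrace O (BlockSeq.wordTrace O w) := by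
  rw [← hw.trace_eq]
  exact goodTrace_trace hw.sat hw.toData.pt_mem

theorem size_le (hw : IsWord O S L w) : hw.toData.data.size ≤ (L + 1) * (3 * S + 1) := by
  have : hw.toData.data.size ≤ ∑ _ : Fin (L + 1), (3 * S + 1) :=
    Finset.sum_le_sum fun i _ => (hw.letter i).size_le
  simpa using this

theorem mono (hw : IsWord O S L w) {L' : ℕ} (h : L ≤ L') : IsWord O S L' w :=
  ⟨hw.letter, fun p hp => hw.empty p (by omega)⟩

end IsWord

/-- Finitely many words give an example set that is fit by the queries that agree with `q`
on them. -/
theorem exists_examples {O : Ontology U B} {S L : ℕ} (ws : List (ℕ → DataInstance U B))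
    (hws : ∀ w ∈ ws, IsWord O S L w) (q : PathQuery U B) :
    ∃ E : TemporalExamples U B, E.size ≤ ws.length * ((L + 1) * (3 * S + 1)) ∧
      ∀ q' : PathQuery U B, E.FitBy O q' ↔ ∀ w ∈ ws,
        (q.HoldsIn (BlockSeq.wordTrace O w) ↔ q'.HoldsIn (BlockSeq.wordTrace O w)) := by
  classical
  let D : Finset (PointedTemporalData U B) :=
    (ws.attach.map fun w => (hws w.1 w.2).toData).toFinset
  have hD : ∀ p, p ∈ D ↔ ∃ w, ∃ hw : w ∈ ws, p = (hws w hw).toData := by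
    intro p
    simp only [D, List.mem_toFinset, List.mem_map, List.mem_attach, true_and, Subtype.exists]
    exact ⟨fun ⟨w, hw, h⟩ => ⟨w, hw, h.symm⟩, fun ⟨w, hw, h⟩ => ⟨w, hw, h.symm⟩⟩
  let ent : PathQuery U B → PointedTemporalData U B → Prop :=
    fun q p => q.EntailedAt O p.data 0 p.pt
  -- The words are sorted by `q` itself, so fitting `E` means agreeing with `q` on every word.
  refine ⟨⟨D.filter (ent q), D.filter fun p => ¬ ent q p⟩, ?_, fun q' => ?_⟩
  · unfold TemporalExamples.size
    simp only
    rw [Finset.sum_filter_add_sum_filter_not D (ent q) fun p => p.data.size]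
    calc _ ≤ D.card • ((L + 1) * (3 * S + 1)) := by
          refine Finset.sum_le_card_nsmul _ _ _ fun p hp => ?_
          obtain ⟨w, hw, rfl⟩ := (hD p).1 hp
          exact (hws w hw).size_le
      _ ≤ _ := by
          rw [smul_eq_mul]
          refine Nat.mul_le_mul_right _ ((List.toFinset_card_le _).trans ?_)
          simp
  · unfold TemporalExamples.FitBy
    simp only [Finset.mem_filter, and_imp]
    constructor
    · rintro ⟨h1, h2⟩ w hw
      have hp := (hD _).2 ⟨w, hw, rfl⟩
      rw [← (hws w hw).entailedAt_iff, ← (hws w hw).entailedAt_iff]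
      by_cases h : ent q (hws w hw).toData
      · exact iff_of_true h (h1 _ hp h)
      · exact iff_of_false h (h2 _ hp h)
    · intro h
      refine ⟨fun p hp hq => ?_, fun p hp hq => ?_⟩
      · obtain ⟨w, hw, rfl⟩ := (hD p).1 hp
        exact ((hws w hw).entailedAt_iff q').2 ((h w hw).1 (((hws w hw).entailedAt_iff q).1 hq))
      · obtain ⟨w, hw, rfl⟩ := (hD p).1 hp
        rw [(hws w hw).entailedAt_iff, ← h w hw, ← (hws w hw).entailedAt_iff]
        exact hq

namespace BlockSeq

/-- A bound on the number of blocks, their lengths and their distances. -/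
structure BoundedBy (q : BlockSeq U B) (W : ℕ) : Prop where
  n_lt : q.n < W
  k_lt : ∀ i ≤ q.n, q.k i < W
  d_lt : ∀ i < q.n, q.d i < W

theorem BoundedBy.pos_le {q : BlockSeq U B} {W : ℕ} (h : q.BoundedBy W) (G : ℕ) {i : ℕ}
    (hi : i ≤ q.n) : q.pos G i ≤ i * (W + G) := by
  induction i with
  | zero => simp [pos]
  | succ i ih =>
    have h1 := ih (by omega)
    have h2 := h.k_lt i (by omega)
    rw [Nat.add_mul, Nat.one_mul]
    simp only [pos]
    omega

theorem BoundedBy.end_le {q : BlockSeq U B} {W : ℕ} (h : q.BoundedBy W) (G : ℕ) {i : ℕ}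
    (hi : i ≤ q.n) : q.pos G i + q.k i ≤ W * (W + G) := by
  have h1 := h.pos_le G hi
  have h2 := h.k_lt i hi
  have h3 := h.n_lt
  have h4 : (i + 1) * (W + G) ≤ W * (W + G) := Nat.mul_le_mul_right _ (by omega)
  rw [Nat.add_mul, Nat.one_mul] at h4
  omega

namespace Coding

variable {O : Ontology U B} {Q : Set (DomainQuery U B)} {S : ℕ} {q : BlockSeq U B}

theorem isLetter_h (C : Coding O Q S q) {i j : ℕ} (hi : i ≤ q.n) (hj : j ≤ q.k i) :
    IsLetter O S (C.h i j) := (C.split i hi j hj).letter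

theorem isLetter_empty (C : Coding O Q S q) : IsLetter O S (emptyLetter U B S) :=
  TemporalQuery.isLetter_empty (C.isLetter_h (Nat.zero_le _) (Nat.zero_le (q.k 0))).sat S

theorem isWord_std (C : Coding O Q S q) (G : ℕ) :
    IsWord O S (q.pos G q.n + q.k q.n) (C.std G) := by
  refine ⟨fun p => ?_, fun p hp => C.std_end G hp⟩
  unfold std
  split_ifs with h
  · exact C.isLetter_h h.choose_spec.1 h.choose_spec.2.1
  · exact C.isLetter_empty

theorem isWord_modify (C : Coding O Q S q) {G c c' m : ℕ} {M : ℕ → DataInstance U B}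
    (hcn : c ≤ q.n) (hc : c ≤ c') (hM : ∀ p < m, IsLetter O S (M p)) :
    IsWord O S (q.pos G q.n + q.k q.n + m) (C.modify G c c' M m) := by
  have h := C.isWord_std G
  refine ⟨fun p => ?_, fun p hp => ?_⟩
  · unfold modify splice
    split_ifs with h1 h2
    · exact h.letter _
    · exact hM _ (by omega)
    · exact h.letter _
  · have h1 := q.pos_add_le G hc
    have h2 := q.pos_add_le G hcn
    rw [modify, splice_right (by omega)]
    exact h.empty _ (by omega)

/-- The bound on the length of the candidate words. -/
def lengthBound (W S G N : ℕ) : ℕ := W * (W + G) + (3 * W + G + 2 + N * (S + 1))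

theorem Candidate.isWord {C : Coding O Q S q} {W G₀ G N : ℕ} (hW : q.BoundedBy W) (hGG : G₀ ≤ G)
    {w : ℕ → DataInstance U B} (hw : C.Candidate G₀ G N w) :
    IsWord O S (lengthBound W S G N) w := by
  have hend := hW.end_le G le_rfl
  have hk := hW.k_lt
  have he := C.isLetter_empty
  have hneg : ∀ {c j : ℕ}, c ≤ q.n → j ≤ q.k c → ∀ x ∈ C.neg ((q.blk c).get j),
      IsLetter O S x := fun hc hj => (C.split _ hc _ hj).neg_letter
  unfold lengthBound
  cases hw with
  | short =>
    refine (C.isWord_std G₀).mono ?_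
    have h1 := hW.end_le G₀ le_rfl
    have h2 : W * (W + G₀) ≤ W * (W + G) := Nat.mul_le_mul_left _ (by omega)
    omega
  | long => exact (C.isWord_std G).mono (by omega)
  | point c j x hc hj hx =>
    have := hk c hc
    refine (C.isWord_modify hc le_rfl fun p hp => ?_).mono (by omega)
    unfold pointWord
    split_ifs
    · rcases hx with rfl | hx
      · exact he
      · exact hneg hc hj x hx
    · exact C.isLetter_h hc (by omega)
  | split c hc =>
    have := hk c hc
    refine (C.isWord_modify hc le_rfl fun p hp => ?_).mono (by omega)
    unfold splitWord
    split_ifs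
    · exact C.isLetter_h hc (by omega)
    · exact he
    · exact C.isLetter_h hc (by omega)
  | first c x hc hx =>
    have := hk c hc
    refine (C.isWord_modify hc le_rfl fun p hp => ?_).mono (by omega)
    unfold firstWord
    split_ifs
    · exact C.isLetter_h hc (by omega)
    · exact he
    · rcases hx with rfl | hx
      · exact C.isLetter_h hc (by omega)
      · exact hneg hc (Nat.zero_le _) x hx
    · exact C.isLetter_h hc (by omega)
  | last c x hc hx =>
    have := hk c hc
    refine (C.isWord_modify hc le_rfl fun p hp => ?_).mono (by omega)
    unfold lastWord
    split_ifs
    · exact C.isLetter_h hc (by omega)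
    · exact hneg hc le_rfl x hx
    · exact he
    · exact C.isLetter_h hc (by omega)
  | cycle c hc =>
    have h1 := (C.split c hc 0 (Nat.zero_le _)).card_le
    have h2 : N * ((C.neg ((q.blk c).get 0)).card + 1) ≤ N * (S + 1) :=
      Nat.mul_le_mul_left _ (by omega)
    refine (C.isWord_modify hc le_rfl fun p hp => ?_).mono (by omega)
    unfold cycleWord
    have hmem : ∀ x ∈ emptyLetter U B S :: (C.neg ((q.blk c).get 0)).toList, IsLetter O S x := by
      intro x hx
      rcases List.mem_cons.1 hx with rfl | hx
      · exact he
      · exact hneg hc (Nat.zero_le _) x (Finset.mem_toList.1 hx)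
    rw [List.getD_eq_getElem _ _ (Nat.mod_lt _ (by simp))]
    exact hmem _ (List.getElem_mem _)
  | gap c e hc he' hsat =>
    have := hk c hc.le
    have := hk (c + 1) hc
    have := hW.d_lt c hc
    refine (C.isWord_modify hc.le (Nat.le_succ c) fun p hp => ?_).mono (by omega)
    unfold gapWord
    split_ifs with h1 h2 h3
    · exact C.isLetter_h hc.le (by omega)
    · exact (C.split_conj c hc (hsat h3)).letter
    · exact C.isLetter_h hc.le (by omega)
    · exact he
    · exact C.isLetter_h hc (by omega)

theorem length_flatMap_le {α β : Type*} (l : List α) (f : α → List β) (b : ℕ)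
    (h : ∀ a ∈ l, (f a).length ≤ b) : (l.flatMap f).length ≤ l.length * b := by
  rw [List.length_flatMap]
  simpa using List.sum_le_card_nsmul (l.map fun a => (f a).length) b (by simpa using h)

/-- The bound on the number of candidate words. -/
def countBound (W S : ℕ) : ℕ := 2 + W * (W * (S + 1) + (2 * S + 3)) + W * W

theorem exists_candidates (C : Coding O Q S q) {W : ℕ} (hW : q.BoundedBy W) (G₀ G N : ℕ) :
    ∃ ws : List (ℕ → DataInstance U B), ws.length ≤ countBound W S ∧
      ∀ w, w ∈ ws ↔ C.Candidate G₀ G N w := by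
  classical
  let pts : ℕ → List (ℕ → DataInstance U B) := fun c => (List.range (q.k c + 1)).flatMap fun j =>
    (emptyLetter U B S :: (C.neg ((q.blk c).get j)).toList).map fun x =>
      C.modify G c c (C.pointWord c j x) (q.k c + 1)
  let rest : ℕ → List (ℕ → DataInstance U B) := fun c =>
    [C.modify G c c (C.splitWord G c) (2 * q.k c + G), C.modify G c c
        (cycleWord S (emptyLetter U B S :: (C.neg ((q.blk c).get 0)).toList))
        (N * ((C.neg ((q.blk c).get 0)).card + 1))] ++
      ((C.h c 0 :: (C.neg ((q.blk c).get 0)).toList).map fun x =>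
        C.modify G c c (C.firstWord G c x) (q.k c + G + 2)) ++
      ((C.neg ((q.blk c).get (q.k c))).toList.map fun x =>
        C.modify G c c (C.lastWord G c x) (q.k c + G + 2))
  let gaps : List (ℕ → DataInstance U B) := (List.range q.n).flatMap fun c =>
    (List.range (q.d c + 1)).map fun e =>
      C.modify G c (c + 1) (C.gapWord c e) (q.k c + e + q.k (c + 1) + 1)
  let ws := [C.std G₀, C.std G] ++ ((List.range (q.n + 1)).flatMap fun c => pts c ++ rest c) ++ gaps
  -- The list ignores the satisfiability condition on gap words; filtering restores it.
  refine ⟨ws.filter fun w => C.Candidate G₀ G N w, (List.length_filter_le _ _).trans ?_,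
    fun w => ?_⟩
  · have hcard : ∀ c ≤ q.n, ∀ j ≤ q.k c, (C.neg ((q.blk c).get j)).card ≤ S :=
      fun c hc j hj => (C.split c hc j hj).card_le
    have h1 : ∀ c ≤ q.n, (pts c).length ≤ W * (S + 1) := by
      intro c hc
      refine (length_flatMap_le _ _ (S + 1) fun j hj => ?_).trans
        (Nat.mul_le_mul_right _ ?_)
      · have := hcard c hc j (Nat.le_of_lt_succ (List.mem_range.1 hj))
        simpa using this
      · have := hW.k_lt c hc
        rw [List.length_range]; omega
    have h2 : ∀ c ≤ q.n, (rest c).length ≤ 2 * S + 3 := by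
      intro c hc
      have a1 := hcard c hc 0 (Nat.zero_le _)
      have a2 := hcard c hc _ le_rfl
      simp only [rest, List.length_append, List.length_cons, List.length_nil, List.length_map,
        Finset.length_toList]
      omega
    have h3 : ((List.range (q.n + 1)).flatMap fun c => pts c ++ rest c).length ≤
        W * (W * (S + 1) + (2 * S + 3)) := by
      refine (length_flatMap_le _ _ (W * (S + 1) + (2 * S + 3)) fun c hc => ?_).trans
        (Nat.mul_le_mul_right _ ?_)
      · have hc := Nat.le_of_lt_succ (List.mem_range.1 hc)
        rw [List.length_append]
        exact add_le_add (h1 c hc) (h2 c hc)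
      · have := hW.n_lt
        rw [List.length_range]; omega
    have h4 : gaps.length ≤ W * W := by
      refine (length_flatMap_le _ _ W fun c hc => ?_).trans (Nat.mul_le_mul_right _ ?_)
      · have := hW.d_lt c (List.mem_range.1 hc)
        simp only [List.length_map, List.length_range]
        omega
      · have := hW.n_lt
        rw [List.length_range]; omega
    simp only [ws, List.length_append, List.length_cons, List.length_nil] at *
    unfold countBound
    omega
  · rw [List.mem_filter, decide_eq_true_iff]
    refine ⟨fun h => h.2, fun h => ⟨?_, h⟩⟩
    have hpr : ∀ c ≤ q.n, ∀ w, w ∈ pts c ++ rest c → w ∈ ws := by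
      intro c hc w hw
      refine List.mem_append_left _ (List.mem_append_right _ ?_)
      exact List.mem_flatMap.2 ⟨c, List.mem_range.2 (Nat.lt_succ_of_le hc), hw⟩
    cases h with
    | short => simp [ws]
    | long => simp [ws]
    | point c j x hc hj hx =>
      refine hpr c hc _ (List.mem_append_left _ (List.mem_flatMap.2 ⟨j, List.mem_range.2
        (Nat.lt_succ_of_le hj), List.mem_map.2 ⟨x, ?_, rfl⟩⟩))
      simpa using hx
    | split c hc => exact hpr c hc _ (List.mem_append_right _ (by simp [rest]))
    | first c x hc hx =>
      refine hpr c hc _ (List.mem_append_right _ (List.mem_append_left _ (List.mem_append_right _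
        (List.mem_map.2 ⟨x, ?_, rfl⟩))))
      simpa using hx
    | last c x hc hx =>
      refine hpr c hc _ (List.mem_append_right _ (List.mem_append_right _
        (List.mem_map.2 ⟨x, ?_, rfl⟩)))
      simpa using hx
    | cycle c hc => exact hpr c hc _ (List.mem_append_right _ (by simp [rest]))
    | gap c e hc he hsat =>
      refine List.mem_append_right _ (List.mem_flatMap.2 ⟨c, List.mem_range.2 hc,
        List.mem_map.2 ⟨e, List.mem_range.2 (Nat.lt_succ_of_le he), rfl⟩⟩)

end Coding

/-! ### Characterisations of normal forms -/

/-- The size bound for characterisations. -/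
def sizeBound (W S N : ℕ) : ℕ :=
  Coding.countBound W S * ((Coding.lengthBound W S (W * (W + W)) N + 1) * (3 * S + 1))

/-- A normal form of a path query. -/
theorem exists_normal (O : Ontology U B) (q : PathQuery U B) :
    ∃ b : BlockSeq U B, b.Normal O ∧
      (∀ V, GoodTrace O V → (q.HoldsIn V ↔ ∃ s, b.Matches V s)) ∧
      b.BoundedBy (2 * q.depth + 1) ∧ b.n ≤ q.depth ∧
      (∀ R : Set (DomainQuery U B), q.head ∈ R → (∀ s ∈ q.tail, s.2 ∈ R) → b.Over R ∧
        ∀ i < b.n, 2 ≤ b.d i → ∃ x ∈ R, IsTop O x) ∧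
      ((∀ s ∈ q.tail, s.1 ≠ .nowOrLater) → ∀ i < b.n, 1 ≤ b.d i) := by
  obtain ⟨b, t, h⟩ := exists_isNormalForm O q.tail q.head
  have hmem : ∀ p ∈ t, max p.1 1 + p.2.len + 1 ≤ weight t := fun p hp =>
    List.le_sum_of_mem (List.mem_map_of_mem (f := fun p => max p.1 1 + p.2.len + 1) hp)
  have hw := h.weight_le
  have hl := h.length_le
  refine ⟨ofList b t, ofList_normal h.normal, fun V hV => ?_, ⟨?_, fun i hi => ?_, fun i hi => ?_⟩,
    h.length_le, fun R h1 h2 => ?_, fun hpos i hi => ?_⟩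
  · rw [← ofList_matches]
    exact h.holds_iff V hV 0
  · show t.length < 2 * q.tail.length + 1
    omega
  · show _ < 2 * q.tail.length + 1
    cases i with
    | zero => show b.len < _; omega
    | succ i =>
      rw [k, ofList_blk_succ hi]
      have := hmem _ (List.getElem_mem (show i < t.length from hi))
      omega
  · show _ < 2 * q.tail.length + 1
    rw [ofList_d hi]
    have := hmem _ (List.getElem_mem (show i < t.length from hi))
    omega
  · obtain ⟨h3, h4⟩ := h.res R h1 h2
    refine ⟨fun i hi => ?_, fun i hi hd => ?_⟩
    · cases i with
      | zero => exact h3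
      | succ i =>
        rw [ofList_blk_succ hi]
        exact (h4 _ (List.getElem_mem (show i < t.length from hi))).1
    · rw [ofList_d hi] at hd
      exact (h4 _ (List.getElem_mem (show i < t.length from hi))).2 hd
  · rw [ofList_d hi]
    exact h.pos hpos _ (List.getElem_mem (show i < t.length from hi))

/-- Every query of the sequence and of its `≤`-conjunctions that is satisfiable has letters of
size bounded by `S`. -/
structure Codable (O : Ontology U B) (Q : Set (DomainQuery U B)) (S : ℕ) (q : BlockSeq U B) :
    Prop where
  point : ∀ i ≤ q.n, ∀ j ≤ q.k i, ∃ h N, IsSplit O Q S ((q.blk i).get j) h N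
  conj : ∀ i < q.n, Satisfiable O ((q.blk i).last.conj (q.blk (i + 1)).first) →
    ∃ h N, IsSplit O Q S ((q.blk i).last.conj (q.blk (i + 1)).first) h N

theorem Codable.exists_coding {O : Ontology U B} {Q : Set (DomainQuery U B)} {S : ℕ}
    {q : BlockSeq U B} (h : Codable O Q S q) : Nonempty (Coding O Q S q) := by
  classical
  have : ∀ r : DomainQuery U B, ∃ x : DataInstance U B × Finset (DataInstance U B),
      (∃ h N, IsSplit O Q S r h N) → IsSplit O Q S r x.1 x.2 := by
    intro r
    by_cases hr : ∃ h N, IsSplit O Q S r h N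
    · obtain ⟨h, N, hN⟩ := hr
      exact ⟨(h, N), fun _ => hN⟩
    · exact ⟨(⟨{Atom.top 0}, Finset.singleton_nonempty _⟩, ∅), fun h => (hr h).elim⟩
  choose f hf using this
  exact ⟨⟨fun r => (f r).1, fun r => (f r).2, fun i hi j hj => hf _ (h.point i hi j hj),
    fun i hi hs => hf _ (h.conj i hi hs)⟩⟩

/-- `q'` is put into normal form as well, so that `stronger_of_agree` applies. The short word has
gaps `G₀ = W`, and by `end_le` it ends by time `W * (W + W)`, which is taken as the gap `G` of all
other words. -/
theorem exists_characterises {O : Ontology U B} (hO : AdmitsContainmentReduction O)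
    {Q : Set (DomainQuery U B)} (hQ : ConjClosed Q) {q : PathQuery U B} {b : BlockSeq U B}
    (hb : b.Normal O) (hqb : ∀ V, GoodTrace O V → (q.HoldsIn V ↔ ∃ s, b.Matches V s))
    {W S N : ℕ} (hW : b.BoundedBy W) (hS : Codable O Q S b) {K : Set (PathQuery U B)}
    (hK : K ⊆ LTLp Set.univ Q)
    (halt : ∀ c ≤ b.n, 0 < c → b.k c = 0 → ¬ MeetReducible O Q (b.blk c).first ∨
      (∀ q' ∈ K, ∀ s ∈ q'.tail, s.1 ≠ .nowOrLater) ∨ ∀ q' ∈ K, q'.depth < N) :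
    ∃ E : TemporalExamples U B, E.Characterises O K q ∧ E.size ≤ sizeBound W S N := by
  obtain ⟨C⟩ := hS.exists_coding
  have hW0 : 0 < W := (Nat.zero_le _).trans_lt hW.n_lt
  have hGG : W ≤ W * (W + W) := Nat.le_mul_of_pos_right W (by omega)
  obtain ⟨ws, hlen, hws⟩ := C.exists_candidates hW W (W * (W + W)) N
  have hword : ∀ w ∈ ws, IsWord O S (Coding.lengthBound W S (W * (W + W)) N) w :=
    fun w hw => ((hws w).1 hw).isWord hW hGG
  obtain ⟨E, hE, hfit⟩ := exists_examples ws hword q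
  refine ⟨E, ⟨(hfit q).2 fun w _ => Iff.rfl, fun q' hq' hq'E => ?_⟩,
    hE.trans (Nat.mul_le_mul_right _ hlen)⟩
  obtain ⟨b', hb', hqb', _, hdepth, hres, hpos⟩ := exists_normal O q'
  have hq'Q := hK hq'
  obtain ⟨h1, h2, h3⟩ := C.stronger_of_agree (p := b') (G₀ := W) (G := W * (W + W)) (N := N) hO hQ
    hb hb' (hres Q hq'Q.1 fun s hs => (hq'Q.2 s hs).2).1
    (fun i hi => (hW.d_lt i hi).le.trans (Nat.le_succ _)) hGG (hW.end_le W le_rfl)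
    (fun w hw => by
      have hw' := (hws w).2 hw
      have hV := (hword w hw').goodTrace
      rw [← hqb _ hV, ← hqb' _ hV]
      exact (hfit q').1 hq'E w hw')
    (fun c hc h0 hk => (halt c hc h0 hk).imp id
      (Or.imp (fun h => hpos (h q' hq')) fun h => hdepth.trans_lt (h q' hq')))
  refine tEquivalent_of_holdsIn fun V hV => ?_
  rw [hqb V hV, hqb' V hV]
  exact ⟨fun ⟨s, hs⟩ => ⟨s, h2.matches (fun i hi => (h3 i (h1.n_eq ▸ hi)).symm) hV hs⟩,
    fun ⟨s, hs⟩ => ⟨s, h1.matches h3 hV hs⟩⟩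

end BlockSeq

namespace BlockSeq

/-! ### Lone conjuncts -/

/-- The sequence `q` with the primitive block `c` replaced by `r₁ ≤ r₂ ≤ r₁ ≤ r₂ ≤ …` with
`2N` blocks. -/
def alternate (q : BlockSeq U B) (c : ℕ) (r₁ r₂ : DomainQuery U B) (N : ℕ) : BlockSeq U B where
  n := q.n + (2 * N - 1)
  blk i := if i < c then q.blk i else if i < c + 2 * N then
    ⟨if (i - c) % 2 = 0 then r₁ else r₂, []⟩ else q.blk (i - (2 * N - 1))
  d i := if i < c then q.d i else if i + 1 < c + 2 * N then 0 else q.d (i - (2 * N - 1))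

section Alternate

variable {q : BlockSeq U B} {c N : ℕ} {r₁ r₂ : DomainQuery U B}

theorem alternate_blk_left {i : ℕ} (h : i < c) : (q.alternate c r₁ r₂ N).blk i = q.blk i :=
  if_pos h

theorem alternate_blk_mid {i : ℕ} (h : c ≤ i) (h' : i < c + 2 * N) :
    (q.alternate c r₁ r₂ N).blk i = ⟨if (i - c) % 2 = 0 then r₁ else r₂, []⟩ := by
  simp only [alternate]
  rw [if_neg (by omega), if_pos h']

theorem alternate_blk_right {i : ℕ} (h : c + 2 * N ≤ i) :
    (q.alternate c r₁ r₂ N).blk i = q.blk (i - (2 * N - 1)) := by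
  simp only [alternate]
  rw [if_neg (by omega), if_neg (by omega)]

theorem alternate_d_left {i : ℕ} (h : i < c) : (q.alternate c r₁ r₂ N).d i = q.d i :=
  if_pos h

theorem alternate_d_mid {i : ℕ} (h : c ≤ i) (h' : i + 1 < c + 2 * N) :
    (q.alternate c r₁ r₂ N).d i = 0 := by
  simp only [alternate]
  rw [if_neg (by omega), if_pos h']

theorem alternate_d_right {i : ℕ} (hN : 1 ≤ N) (h : c + 2 * N ≤ i + 1) :
    (q.alternate c r₁ r₂ N).d i = q.d (i - (2 * N - 1)) := by
  simp only [alternate]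
  rw [if_neg (by omega), if_neg (by omega)]

theorem alternate_k_left {i : ℕ} (h : i < c) : (q.alternate c r₁ r₂ N).k i = q.k i := by
  rw [k, alternate_blk_left h]

theorem alternate_k_mid {i : ℕ} (h : c ≤ i) (h' : i < c + 2 * N) :
    (q.alternate c r₁ r₂ N).k i = 0 := by
  rw [k, alternate_blk_mid h h']
  rfl

theorem alternate_k_right {i : ℕ} (h : c + 2 * N ≤ i) :
    (q.alternate c r₁ r₂ N).k i = q.k (i - (2 * N - 1)) := by
  rw [k, alternate_blk_right h]

/-- The steps of an alternating sequence. -/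
theorem alternate_step {s : ℕ → ℕ} (hN : 1 ≤ N) (hk : q.k c = 0) (hc : c ≤ q.n)
    (h₁ : ∀ i, i + 1 < c → s i + q.k i + q.d i ≤ s (i + 1))
    (h₂ : ∀ i, i + 1 = c → s i + q.k i + q.d i ≤ s c)
    (h₃ : ∀ i, c ≤ i → i + 1 < c + 2 * N → s i ≤ s (i + 1))
    (h₄ : c < q.n → s (c + (2 * N - 1)) + q.d c ≤ s (c + 1 + (2 * N - 1)))
    (h₅ : ∀ i < q.n, c < i →
      s (i + (2 * N - 1)) + q.k i + q.d i ≤ s (i + 1 + (2 * N - 1))) :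
    ∀ i < (q.alternate c r₁ r₂ N).n,
      s i + (q.alternate c r₁ r₂ N).k i + (q.alternate c r₁ r₂ N).d i ≤ s (i + 1) := by
  intro i hi
  have hi' : i < q.n + (2 * N - 1) := hi
  by_cases h1 : i < c
  · rw [alternate_k_left h1, alternate_d_left h1]
    rcases (Nat.succ_le_of_lt h1).eq_or_lt with h | h
    · rw [show i + 1 = c from h]; exact h₂ i h
    · exact h₁ i h
  by_cases h2 : i + 1 < c + 2 * N
  · rw [alternate_k_mid (by omega) (by omega), alternate_d_mid (by omega) h2]
    exact h₃ i (by omega) h2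
  obtain ⟨m, rfl⟩ : ∃ m, i = m + (2 * N - 1) := ⟨i - (2 * N - 1), by omega⟩
  rw [alternate_d_right hN (by omega), Nat.add_sub_cancel, add_right_comm m]
  by_cases h3 : m = c
  · subst h3
    rw [alternate_k_mid (by omega) (by omega)]
    exact h₄ (by omega)
  · rw [alternate_k_right (by omega), Nat.add_sub_cancel]
    exact h₅ m (by omega) (by omega)

theorem alternate_over {R : Set (DomainQuery U B)} (hq : q.Over R)
    (h₁ : r₁ ∈ R) (h₂ : r₂ ∈ R) (hc : c ≤ q.n) : (q.alternate c r₁ r₂ N).Over R := by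
  intro i hi
  have hi' : i ≤ q.n + (2 * N - 1) := hi
  by_cases h1 : i < c
  · rw [alternate_blk_left h1]; exact hq i (by omega)
  by_cases h2 : i < c + 2 * N
  · rw [alternate_blk_mid (by omega) h2]
    refine ⟨?_, by simp⟩
    simp only
    split_ifs <;> assumption
  · rw [alternate_blk_right (by omega)]; exact hq _ (by omega)

theorem alternate_d_exists (hc : c ≤ q.n) (hN : 1 ≤ N) {i : ℕ}
    (hi : i < (q.alternate c r₁ r₂ N).n) (hd : 2 ≤ (q.alternate c r₁ r₂ N).d i) :
    ∃ i' < q.n, 2 ≤ q.d i' := by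
  have hi' : i < q.n + (2 * N - 1) := hi
  by_cases h1 : i < c
  · rw [alternate_d_left h1] at hd; exact ⟨i, by omega, hd⟩
  by_cases h2 : i + 1 < c + 2 * N
  · rw [alternate_d_mid (by omega) h2] at hd; omega
  · rw [alternate_d_right hN (by omega)] at hd
    exact ⟨_, by omega, hd⟩

/-- The alternating sequence is weaker than `q`. -/
theorem Matches.alternate {O : Ontology U B} {V : Trace U B} (hV : GoodTrace O V) {s : ℕ → ℕ}
    (hs : q.Matches V s) (hk : q.k c = 0) (hc : c ≤ q.n) (hc0 : 0 < c) (hN : 1 ≤ N)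
    (h₁ : Contained O (q.blk c).first r₁) (h₂ : Contained O (q.blk c).first r₂) :
    ∃ s, (q.alternate c r₁ r₂ N).Matches V s := by
  refine ⟨fun i => if i < c then s i else if i < c + 2 * N then s c else s (i - (2 * N - 1)),
    ?_, fun i hi => ?_, fun i hi => ?_⟩
  · rw [if_pos hc0]; exact hs.zero
  · refine alternate_step
      (s := fun i => if i < c then s i else if i < c + 2 * N then s c else s (i - (2 * N - 1)))
      hN hk hc (fun i h => ?_) (fun i h => ?_) (fun i h h' => ?_) (fun h => ?_)
      (fun i h h' => ?_) i hi
    · have hst := hs.step i (by omega)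
      rwa [if_pos (by omega), if_pos h]
    · have hst := hs.step i (by omega)
      rw [h] at hst
      rwa [if_pos (by omega), if_neg (by omega), if_pos (by omega)]
    · rw [if_neg (by omega), if_pos (by omega), if_neg (by omega), if_pos h']
    · have hst := hs.step c h
      rw [if_neg (by omega), if_pos (by omega), if_neg (by omega), if_neg (by omega),
        Nat.add_sub_cancel]
      omega
    · have hst := hs.step i h
      rwa [if_neg (by omega), if_neg (by omega), if_neg (by omega), if_neg (by omega),
        Nat.add_sub_cancel, Nat.add_sub_cancel]
  · have hi' : i ≤ q.n + (2 * N - 1) := hi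
    by_cases h1 : i < c
    · rw [alternate_blk_left h1, if_pos h1]; exact hs.holds i (by omega)
    by_cases h2 : i < c + 2 * N
    · rw [alternate_blk_mid (by omega) h2, if_neg h1, if_pos h2, Block.holdsAt_nil]
      split_ifs
      · exact hV.mono h₁ (hs.first hc)
      · exact hV.mono h₂ (hs.first hc)
    · rw [alternate_blk_right (by omega), if_neg h1, if_neg h2]
      exact hs.holds _ (by omega)

/-- A trace that is trivial after time `L` does not distinguish `q` from a long alternating
sequence. -/
theorem Matches.of_alternate {O : Ontology U B} {V : Trace U B} (hV : GoodTrace O V) {L : ℕ}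
    (hL : ∀ p r, L < p → V p r → IsTop O r) {s : ℕ → ℕ}
    (hs : (q.alternate c r₁ r₂ N).Matches V s) (hk : q.k c = 0) (hc : c ≤ q.n) (hc0 : 0 < c)
    (hN : L < N) (hr : Contained O (r₁.conj r₂) (q.blk c).first) (h₂ : ¬ IsTop O r₂) :
    ∃ s, q.Matches V s := by
  have hn : (q.alternate c r₁ r₂ N).n = q.n + (2 * N - 1) := rfl
  have hmid : ∀ p < N, V (s (c + 2 * p)) r₁ ∧ V (s (c + 2 * p + 1)) r₂ := by
    intro p hp
    have h1 := hs.first (i := c + 2 * p) (by omega)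
    have h2 := hs.first (i := c + 2 * p + 1) (by omega)
    rw [alternate_blk_mid (by omega) (by omega), if_pos (by omega)] at h1
    rw [alternate_blk_mid (by omega) (by omega), if_neg (by omega)] at h2
    exact ⟨h1, h2⟩
  have hmono : ∀ i, c ≤ i → i + 1 < c + 2 * N → s i ≤ s (i + 1) := by
    intro i h1 h2
    have := hs.step i (by omega)
    omega
  -- If `r₁` and `r₂` met in none of the `N` rounds, time would advance in each of them, and the
  -- last `r₂` would hold after `L`, where only trivial queries do. At a common point `r₁ ∧ r₂`
  -- holds, so block `c` of `q` can be placed there.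
  have hex : ∃ p < N, s (c + 2 * p) = s (c + 2 * p + 1) := by
    by_contra! hcon
    have hgrow : ∀ p < N, p < s (c + 2 * p + 1) := by
      intro p
      induction p with
      | zero =>
        intro h
        have h1 := hcon 0 h
        have h2 := hmono (c + 2 * 0) (by omega) (by omega)
        omega
      | succ p ih =>
        intro h
        have h1 := ih (by omega)
        have h2 := hmono (c + 2 * p + 1) (by omega) (by omega)
        have h3 := hmono (c + 2 * (p + 1)) (by omega) (by omega)
        have h4 := hcon (p + 1) h
        rw [show c + 2 * p + 1 + 1 = c + 2 * (p + 1) by omega] at h2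
        omega
    exact h₂ (hL _ _ (hgrow L hN) (hmid L hN).2)
  obtain ⟨p, hp, he⟩ := hex
  have hfrom : ∀ i, c ≤ i → i < c + 2 * N → s c ≤ s i := by
    intro i hi
    induction i, hi using Nat.le_induction with
    | base => exact fun _ => le_rfl
    | succ i hi ih =>
      intro h
      exact (ih (by omega)).trans (hmono i hi h)
  have hto : ∀ m i, i + m = c + 2 * N - 1 → c ≤ i → s i ≤ s (c + 2 * N - 1) := by
    intro m
    induction m with
    | zero => intro i hi _; rw [← hi]; exact le_rfl
    | succ m ih =>
      intro i hi hci
      exact (hmono i hci (by omega)).trans (ih (i + 1) (by omega) (by omega))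
  have hp1 := hfrom (c + 2 * p) (by omega) (by omega)
  have hp2 := hto (2 * N - 1 - 2 * p) (c + 2 * p) (by omega) (by omega)
  refine ⟨fun i => if i < c then s i else if i = c then s (c + 2 * p) else s (i + (2 * N - 1)),
    ?_, fun i hi => ?_, fun i hi => ?_⟩
  · rw [if_pos hc0]; exact hs.zero
  · rcases lt_trichotomy i c with h | rfl | h
    · have hst := hs.step i (by omega)
      rw [k, alternate_blk_left h, alternate_d_left h] at hst
      rw [if_pos h]
      split_ifs with h1 h2
      · exact hst
      · rw [h2] at hst; exact hst.trans hp1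
      · omega
    · have hst := hs.step (i + 2 * N - 1) (by omega)
      rw [alternate_d_right (by omega) (by omega),
        show i + 2 * N - 1 - (2 * N - 1) = i by omega] at hst
      rw [if_neg (by omega), if_pos rfl, if_neg (by omega), if_neg (by omega), hk,
        show i + 1 + (2 * N - 1) = i + 2 * N - 1 + 1 by omega]
      omega
    · have hst := hs.step (i + (2 * N - 1)) (by omega)
      rw [k, alternate_blk_right (by omega), alternate_d_right (by omega) (by omega),
        show i + (2 * N - 1) - (2 * N - 1) = i by omega] at hst
      rw [if_neg (by omega), if_neg (by omega), if_neg (by omega), if_neg (by omega),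
        show i + 1 + (2 * N - 1) = i + (2 * N - 1) + 1 by omega]
      exact hst
  · rcases lt_trichotomy i c with h | rfl | h
    · have := hs.holds i (by omega)
      rw [alternate_blk_left h] at this
      rw [if_pos h]
      exact this
    · rw [if_neg (by omega), if_pos rfl]
      intro j hj
      have hj' : j ≤ q.k i := hj
      obtain rfl : j = 0 := by omega
      refine hV.mono hr (hV.conj (hmid p hp).1 ?_)
      rw [he]
      exact (hmid p hp).2
    · have := hs.holds (i + (2 * N - 1)) (by omega)
      rw [alternate_blk_right (by omega),
        show i + (2 * N - 1) - (2 * N - 1) = i by omega] at this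
      rw [if_neg (by omega), if_neg (by omega)]
      exact this

/-- The word in which the letters of `r₁` and `r₂` replace block `c` separates the alternating
sequence from `q`. -/
theorem alternate_matches_word {O : Ontology U B} {Q : Set (DomainQuery U B)} {S G : ℕ}
    (C : Coding O Q S q) (hc : c ≤ q.n) (hc0 : 0 < c) (hN : 1 ≤ N) (hk : q.k c = 0)
    (hd : ∀ i < q.n, q.d i ≤ G + 1) {x₁ x₂ : DataInstance U B} (h₁ : Entails O x₁ r₁ 0)
    (h₂ : Entails O x₂ r₂ 0) :
    ∃ s, (q.alternate c r₁ r₂ N).Matches (wordTrace O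
      (C.modify G c c (fun p => if p % 2 = 0 then x₁ else x₂) (2 * N))) s := by
  have hpos : ∀ i, q.pos G (i + 1) = q.pos G i + q.k i + G + 1 := fun _ => rfl
  refine ⟨fun i => if i < c then q.pos G i else if i < c + 2 * N then q.pos G c + (i - c)
    else q.pos G (i - (2 * N - 1)) + (2 * N - 1), ?_, fun i hi => ?_, fun i hi => ?_⟩
  · rw [if_pos hc0]; rfl
  · refine alternate_step
      (s := fun i => if i < c then q.pos G i else if i < c + 2 * N then q.pos G c + (i - c)
        else q.pos G (i - (2 * N - 1)) + (2 * N - 1))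
      hN hk hc (fun i h => ?_) (fun i h => ?_) (fun i h h' => ?_) (fun h => ?_)
      (fun i h h' => ?_) i hi
    · have h1 := hd i (by omega)
      have h2 := hpos i
      rw [if_pos (by omega), if_pos h]
      omega
    · have h1 := hd i (by omega)
      have h2 := hpos i
      rw [h] at h2
      rw [if_pos (by omega), if_neg (by omega), if_pos (by omega)]
      omega
    · rw [if_neg (by omega), if_pos (by omega), if_neg (by omega), if_pos h']
      omega
    · have h1 := hd c h
      have h2 := hpos c
      rw [if_neg (by omega), if_pos (by omega), if_neg (by omega), if_neg (by omega),
        Nat.add_sub_cancel]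
      omega
    · have h1 := hd i h
      have h2 := hpos i
      rw [if_neg (by omega), if_neg (by omega), if_neg (by omega), if_neg (by omega),
        Nat.add_sub_cancel, Nat.add_sub_cancel]
      omega
  · have hi' : i ≤ q.n + (2 * N - 1) := hi
    have hstd : ∀ i ≤ q.n, ∀ j ≤ q.k i, Entails O (C.std G (q.pos G i + j)) ((q.blk i).get j) 0 :=
      fun i hi j hj => (C.std_contained hi hj).2 (Contained.refl O _)
    by_cases h1 : i < c
    · rw [alternate_blk_left h1, if_pos h1]
      intro j hj
      have hj' : j ≤ q.k i := hj
      have := q.pos_lt G h1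
      rw [wordTrace, Coding.modify, splice_left (by omega)]
      exact hstd i (by omega) j hj
    by_cases h2 : i < c + 2 * N
    · rw [alternate_blk_mid (by omega) h2, if_neg h1, if_pos h2, Block.holdsAt_nil, wordTrace,
        Coding.modify, splice_mid (by omega)]
      split_ifs <;> assumption
    · rw [alternate_blk_right (by omega), if_neg h1, if_neg h2]
      intro j hj
      have := q.pos_lt G (show c < i - (2 * N - 1) by omega)
      rw [wordTrace, Coding.modify, splice_right (by omega),
        show q.pos G (i - (2 * N - 1)) + (2 * N - 1) + j - (q.pos G c + 2 * N) +
          (q.pos G c + q.k c + 1) = q.pos G (i - (2 * N - 1)) + j by omega]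
      exact hstd _ (by omega) j hj

end Alternate

theorem not_matches_alternate_word {O : Ontology U B} {Q : Set (DomainQuery U B)} {S : ℕ}
    {q : BlockSeq U B} (C : Coding O Q S q) (hq : q.Normal O) {G c N : ℕ} (hc : c ≤ q.n)
    (hN : 1 ≤ N) (hG : ∀ i ≤ q.n, q.k i ≤ G) {x₁ x₂ : DataInstance U B}
    (h₁ : ¬ Entails O x₁ (q.blk c).first 0) (h₂ : ¬ Entails O x₂ (q.blk c).first 0) :
    ¬ ∃ s, q.Matches (wordTrace O
      (C.modify G c c (fun p => if p % 2 = 0 then x₁ else x₂) (2 * N))) s := by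
  intro hs
  obtain ⟨u, _, _, h⟩ := C.modify_matches hq hc (by omega) hG hs
  have := h 0 (Nat.zero_le _)
  split_ifs at this
  · exact h₁ this
  · exact h₂ this

/-- A query whose normal form has a lone conjunct is not uniquely characterisable. -/
theorem not_uniquelyCharacterisable {O : Ontology U B} {Q : Set (DomainQuery U B)} {S W : ℕ}
    {q : PathQuery U B} {b : BlockSeq U B} (hb : b.Normal O) (hbQ : b.Over Q)
    (htop : ∀ i < b.n, 2 ≤ b.d i → ∃ x ∈ Q, IsTop O x)
    (hqb : ∀ V, GoodTrace O V → (q.HoldsIn V ↔ ∃ s, b.Matches V s)) (hW : b.BoundedBy W)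
    (hS : Codable O Q S b) {c : ℕ} (hc : c ≤ b.n) (hc0 : 0 < c) (hk : b.k c = 0)
    {r₁ r₂ : DomainQuery U B} (hr₁ : r₁ ∈ Q) (hr₂ : r₂ ∈ Q)
    (he : Equivalent O (b.blk c).first (r₁.conj r₂)) (hn₁ : ¬ Equivalent O (b.blk c).first r₁)
    (hn₂ : ¬ Equivalent O (b.blk c).first r₂)
    (hs₁ : ∃ h N, IsSplit O Q S r₁ h N) (hs₂ : ∃ h N, IsSplit O Q S r₂ h N) :
    ¬ UniquelyCharacterisable O (LTLp Set.univ Q) q := by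
  rintro ⟨E, hfit, hE⟩
  obtain ⟨C⟩ := hS.exists_coding
  obtain ⟨x₁, N₁, hx₁⟩ := hs₁
  obtain ⟨x₂, N₂, hx₂⟩ := hs₂
  have hc₁ : Contained O (b.blk c).first r₁ := he.1.trans (contained_conj_left O _ _)
  have hc₂ : Contained O (b.blk c).first r₂ := he.1.trans (contained_conj_right O _ _)
  have hm₁ : ¬ Contained O r₁ (b.blk c).first := fun h => hn₁ ⟨hc₁, h⟩
  have hm₂ : ¬ Contained O r₂ (b.blk c).first := fun h => hn₂ ⟨hc₂, h⟩
  -- If `r₂` were trivial, `r₁` alone would imply the query of block `c`.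
  have ht₂ : ¬ IsTop O r₂ := fun h =>
    hm₁ ((contained_conj (Contained.refl O r₁) (h.contained r₁)).trans he.2)
  obtain ⟨τ, hτ⟩ : ∃ τ, ∀ i < b.n, 2 ≤ b.d i → τ ∈ Q ∧ IsTop O τ := by
    by_cases h : ∃ i < b.n, 2 ≤ b.d i
    · obtain ⟨i, hi, hd⟩ := h
      obtain ⟨x, hx, hx'⟩ := htop i hi hd
      exact ⟨x, fun _ _ _ => ⟨hx, hx'⟩⟩
    · exact ⟨r₁, fun i hi hd => (h ⟨i, hi, hd⟩).elim⟩
  classical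
  -- `L` bounds the length of every example, so `L + 1` rounds suffice for the pigeonhole argument
  -- on each of them.
  let L := ∑ p ∈ E.pos ∪ E.neg, p.data.max
  let b' := b.alternate c r₁ r₂ (L + 1)
  have hτ' : ∀ i < b'.n, 2 ≤ b'.d i → τ ∈ Q ∧ IsTop O τ := by
    intro i hi hd
    obtain ⟨i', h1, h2⟩ := alternate_d_exists hc (Nat.le_add_left 1 L) hi hd
    exact hτ i' h1 h2
  let q' := (b'.toForm τ).toPath
  have hq'Q : q' ∈ LTLp Set.univ Q :=
    toForm_mem (alternate_over hbQ hr₁ hr₂ hc) fun i hi hd => (hτ' i hi hd).1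
  have hq'b : ∀ V, GoodTrace O V → (q'.HoldsIn V ↔ ∃ s, b'.Matches V s) := fun V hV =>
    toForm_holdsIn hV fun i hi hd => (hτ' i hi hd).2
  have hsame : ∀ p ∈ E.pos ∪ E.neg,
      (q.EntailedAt O p.data 0 p.pt ↔ q'.EntailedAt O p.data 0 p.pt) := by
    intro p hp
    rw [PathQuery.entailedAt_iff, PathQuery.entailedAt_iff]
    refine forall_congr' fun hD => ?_
    have hV := goodTrace_trace hD p.pt_mem
    rw [hqb _ hV, hq'b _ hV]
    refine ⟨fun ⟨s, hs⟩ => hs.alternate hV hk hc hc0 (by omega) hc₁ hc₂, fun ⟨s, hs⟩ => ?_⟩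
    refine hs.of_alternate hV (L := p.data.max) (fun ℓ r hℓ hr => ?_) hk hc hc0 ?_ he.2 ht₂
    · unfold TemporalData.trace TemporalData.slice at hr
      rw [dif_neg (by omega)] at hr
      exact isTop_of_entails_trivialOn hr
    · exact Nat.lt_succ_of_le (Finset.single_le_sum
        (f := fun p : PointedTemporalData U B => p.data.max) (fun _ _ => Nat.zero_le _) hp)
  have hequiv := hE q' hq'Q ⟨fun p hp => (hsame p (Finset.mem_union_left _ hp)).1 (hfit.1 p hp),
    fun p hp h => hfit.2 p hp ((hsame p (Finset.mem_union_right _ hp)).2 h)⟩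
  -- In this word the letters of `r₁` and `r₂` alternate in place of block `c`. Neither entails the
  -- query of block `c`, so by rigidity `q` fails, while the alternating query holds.
  have hword := C.isWord_modify (G := W) (m := 2 * (L + 1))
    (M := fun p => if p % 2 = 0 then x₁ else x₂) hc le_rfl (fun p _ => by
      split_ifs
      · exact hx₁.letter
      · exact hx₂.letter)
  have := hequiv.2 hword.toData
  rw [hword.entailedAt_iff, hword.entailedAt_iff, hqb _ hword.goodTrace,
    hq'b _ hword.goodTrace] at this
  refine not_matches_alternate_word C hb hc (by omega) (fun i hi => (hW.k_lt i hi).le)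
    (fun h => hm₁ ((hx₁.entails_iff _).1 h)) (fun h => hm₂ ((hx₂.entails_iff _).1 h))
    (this (alternate_matches_word C hc hc0 (by omega) hk
      (fun i hi => (hW.d_lt i hi).le.trans (Nat.le_succ _))
      ((hx₁.entails_iff _).2 (Contained.refl O _)) ((hx₂.entails_iff _).2 (Contained.refl O _))))

end BlockSeq

/-! ### Sizes of splits -/

theorem exists_isSplit_of_admits {O : Ontology U B} {Q : Set (DomainQuery U B)}
    (hs : AdmitsSingularPlus O Q) : ∃ g : DomainQuery U B → ℕ, ∀ r ∈ Q, Satisfiable O r →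
      ∀ S, g r ≤ S → ∃ h N, IsSplit O Q S r h N := by
  have : ∀ r : DomainQuery U B, ∃ m, r ∈ Q → Satisfiable O r →
      ∀ S, m ≤ S → ∃ h N, IsSplit O Q S r h N := by
    rintro (q | _)
    · by_cases h : DomainQuery.cq q ∈ Q ∧ Satisfiable O (.cq q)
      · obtain ⟨E, hE⟩ := hs q h.1 h.2
        exact ⟨E.size, fun _ hq S hS => exists_isSplit hq hE hS⟩
      · exact ⟨0, fun h1 h2 => (h ⟨h1, h2⟩).elim⟩
    · exact ⟨0, fun _ ⟨_, _, _, h⟩ => h.elim⟩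
  choose g hg using this
  exact ⟨g, hg⟩

theorem eval_mono (f : Polynomial ℕ) {m n : ℕ} (h : m ≤ n) : f.eval m ≤ f.eval n := by
  simp only [Polynomial.eval_eq_sum_range]
  exact Finset.sum_le_sum fun i _ => Nat.mul_le_mul_left _ (Nat.pow_le_pow_left h i)

theorem exists_isSplit_of_admitsPoly {O : Ontology U B} {Q : Set (DomainQuery U B)}
    (hs : AdmitsPolySingularPlus O Q) : ∃ f : Polynomial ℕ, ∀ r ∈ Q, Satisfiable O r →
      ∀ m, r.size ≤ m → ∃ h N, IsSplit O Q (f.eval m) r h N := by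
  obtain ⟨f, hf⟩ := hs
  refine ⟨f, ?_⟩
  rintro (q | _) hQ hq m hm
  · obtain ⟨E, hE, hS⟩ := hf q hQ hq
    exact exists_isSplit hq hE (hS.trans (eval_mono f hm))
  · obtain ⟨_, _, _, h⟩ := hq
    exact h.elim

/-! ### Path queries -/

theorem TSatisfiable.exists_goodTrace {O : Ontology U B} {q : PathQuery U B}
    (h : TSatisfiable O q) : ∃ V, GoodTrace O V ∧ q.HoldsIn V := by
  obtain ⟨p, hp, hq⟩ := h
  exact ⟨_, goodTrace_trace hp p.pt_mem, (PathQuery.entailedAt_iff _ _ _ _).1 hq hp⟩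

theorem TSatisfiable.of_tEquivalent {O : Ontology U B} {q q' : PathQuery U B}
    (h : TSatisfiable O q) (he : TEquivalent O q q') : TSatisfiable O q' := by
  obtain ⟨p, hp, hq⟩ := h
  exact ⟨p, hp, he.1 p hq⟩

theorem TemporalExamples.Characterises.of_tEquivalent {O : Ontology U B} {E : TemporalExamples U B}
    {K : Set (PathQuery U B)} {q q' : PathQuery U B} (h : E.Characterises O K q)
    (he : TEquivalent O q q') : E.Characterises O K q' := by
  refine ⟨⟨fun p hp => he.1 p (h.1.1 p hp), fun p hp hq => h.1.2 p hp (he.2 p hq)⟩,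
    fun q'' hq'' hE => ?_⟩
  have := h.2 q'' hq'' hE
  exact ⟨fun p hp => this.1 p (he.2 p hp), fun p hp => he.1 p (this.2 p hp)⟩

theorem PathQuery.depth_le_size (q : PathQuery U B) : q.depth ≤ q.size := by
  have : ∀ l : List (TempOp × DomainQuery U B),
      l.length ≤ (l.map fun s => s.2.size + 2).sum := by
    intro l
    induction l with
    | nil => simp
    | cons s l ih =>
      simp only [List.length_cons, List.map_cons, List.sum_cons]
      omega
  exact (this q.tail).trans (Nat.le_add_left _ _)

theorem PathQuery.head_size_le (q : PathQuery U B) : q.head.size ≤ q.size := Nat.le_add_right _ _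

theorem PathQuery.tail_size_le (q : PathQuery U B) {s : TempOp × DomainQuery U B}
    (hs : s ∈ q.tail) : s.2.size ≤ q.size := by
  have := List.le_sum_of_mem
    (List.mem_map_of_mem (f := fun s : TempOp × DomainQuery U B => s.2.size + 2) hs)
  unfold PathQuery.size
  omega

theorem LTLp_mono {Φ Ψ : Set TempOp} (h : Φ ⊆ Ψ) (Q : Set (DomainQuery U B)) :
    LTLp Φ Q ⊆ LTLp Ψ Q :=
  fun _ hq => ⟨hq.1, fun s hs => ⟨h (hq.2 s hs).1, (hq.2 s hs).2⟩⟩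

namespace BlockSeq

theorem BoundedBy.mono {b : BlockSeq U B} {W W' : ℕ} (h : b.BoundedBy W) (hW : W ≤ W') :
    b.BoundedBy W' :=
  ⟨h.n_lt.trans_le hW, fun i hi => (h.k_lt i hi).trans_le hW,
    fun i hi => (h.d_lt i hi).trans_le hW⟩

theorem exists_boundedBy (b : BlockSeq U B) : ∃ W, b.BoundedBy W := by
  have h : ∀ (f : ℕ → ℕ) i, i ≤ b.n → f i ≤ ∑ i ∈ Finset.range (b.n + 1), f i := fun f i hi =>
    Finset.single_le_sum (f := f) (fun _ _ => Nat.zero_le _) (Finset.mem_range_succ_iff.2 hi)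
  refine ⟨b.n + ∑ i ∈ Finset.range (b.n + 1), b.k i + ∑ i ∈ Finset.range (b.n + 1), b.d i + 1,
    ?_, fun i hi => ?_, fun i hi => ?_⟩
  · omega
  · have := h b.k i hi
    omega
  · have := h b.d i hi.le
    omega

theorem Over.first_mem {b : BlockSeq U B} {R : Set (DomainQuery U B)} (h : b.Over R) {i : ℕ}
    (hi : i ≤ b.n) : (b.blk i).first ∈ R := (h i hi).1

theorem Over.last_mem {b : BlockSeq U B} {R : Set (DomainQuery U B)} (h : b.Over R) {i : ℕ}
    (hi : i ≤ b.n) : (b.blk i).last ∈ R := by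
  rw [← Block.get_len]
  exact h.get_mem hi le_rfl

/-- Every query of the sequence is satisfiable. -/
def PointsSatisfiable (b : BlockSeq U B) (O : Ontology U B) : Prop :=
  ∀ i ≤ b.n, ∀ j ≤ b.k i, Satisfiable O ((b.blk i).get j)

theorem pointsSatisfiable {O : Ontology U B} {q : PathQuery U B} {b : BlockSeq U B}
    (hqb : ∀ V, GoodTrace O V → (q.HoldsIn V ↔ ∃ s, b.Matches V s)) (hq : TSatisfiable O q) :
    b.PointsSatisfiable O := by
  obtain ⟨V, hV, h⟩ := hq.exists_goodTrace
  obtain ⟨s, hs⟩ := (hqb V hV).1 h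
  exact fun i hi j hj => hV.sat (hs.holds i hi j hj)

theorem exists_codable {O : Ontology U B} {Q : Set (DomainQuery U B)}
    {g : DomainQuery U B → ℕ} (hg : ∀ r ∈ Q, Satisfiable O r →
      ∀ S, g r ≤ S → ∃ h N, IsSplit O Q S r h N) (hQ : ConjClosed Q)
    {b : BlockSeq U B} (hbQ : b.Over Q) (hb : b.PointsSatisfiable O) (S₀ : ℕ) :
    ∃ S, S₀ ≤ S ∧ Codable O Q S b := by
  have h : ∀ (f : ℕ → ℕ) m i, i ≤ m → f i ≤ ∑ i ∈ Finset.range (m + 1), f i := fun f m i hi =>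
    Finset.single_le_sum (f := f) (fun _ _ => Nat.zero_le _) (Finset.mem_range_succ_iff.2 hi)
  refine ⟨S₀ + ∑ i ∈ Finset.range (b.n + 1), ∑ j ∈ Finset.range (b.k i + 1), g ((b.blk i).get j) +
    ∑ i ∈ Finset.range (b.n + 1), g ((b.blk i).last.conj (b.blk (i + 1)).first), by omega,
    fun i hi j hj => hg _ (hbQ.get_mem hi hj) (hb i hi j hj) _ ?_,
    fun i hi hsat => hg _ (hQ _ (hbQ.last_mem hi.le) _ (hbQ.first_mem (i := i + 1) hi)) hsat _ ?_⟩
  · have h1 := h (fun j => g ((b.blk i).get j)) (b.k i) j hj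
    have h2 := h (fun i => ∑ j ∈ Finset.range (b.k i + 1), g ((b.blk i).get j)) b.n i hi
    omega
  · have h1 := h (fun i => g ((b.blk i).last.conj (b.blk (i + 1)).first)) b.n i hi.le
    omega

theorem codable_of_size_le {O : Ontology U B} {Q : Set (DomainQuery U B)} {f : Polynomial ℕ}
    (hf : ∀ r ∈ Q, Satisfiable O r → ∀ m, r.size ≤ m → ∃ h N, IsSplit O Q (f.eval m) r h N)
    (hQ : ConjClosed Q) {b : BlockSeq U B} (hbQ : b.Over Q) (hb : b.PointsSatisfiable O) {m : ℕ}
    (hm : b.Over {r | r.size ≤ m}) : Codable O Q (f.eval (2 * m)) b := by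
  refine ⟨fun i hi j hj => hf _ (hbQ.get_mem hi hj) (hb i hi j hj) _ ?_, fun i hi hsat =>
    hf _ (hQ _ (hbQ.last_mem hi.le) _ (hbQ.first_mem (i := i + 1) hi)) hsat _ ?_⟩
  · have : ((b.blk i).get j).size ≤ m := hm.get_mem hi hj
    omega
  · have h1 : (b.blk i).last.size ≤ m := hm.last_mem hi.le
    have h2 : (b.blk (i + 1)).first.size ≤ m := hm.first_mem hi
    exact (DomainQuery.size_conj _ _).trans (by omega)

/-- The normal form of a uniquely characterisable query has no lone conjuncts. -/
theorem not_meetReducible {O : Ontology U B} (hO : AdmitsContainmentReduction O)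
    {Q : Set (DomainQuery U B)} (hQ : ConjClosed Q) (hs : AdmitsSingularPlus O Q)
    {q : PathQuery U B} {b : BlockSeq U B} (hb : b.Normal O) (hbQ : b.Over Q)
    (htop : ∀ i < b.n, 2 ≤ b.d i → ∃ x ∈ Q, IsTop O x)
    (hqb : ∀ V, GoodTrace O V → (q.HoldsIn V ↔ ∃ s, b.Matches V s)) (hq : TSatisfiable O q)
    (hu : UniquelyCharacterisable O (LTLp Set.univ Q) q) :
    ∀ c ≤ b.n, 0 < c → b.k c = 0 → ¬ MeetReducible O Q (b.blk c).first := by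
  rintro c hc h0 hk ⟨r₁, hr₁, r₂, hr₂, he, hn₁, hn₂⟩
  obtain ⟨W, hW⟩ := exists_boundedBy b
  obtain ⟨g, hg⟩ := exists_isSplit_of_admits hs
  have hsat := pointsSatisfiable hqb hq
  obtain ⟨S, hS₀, hS⟩ := exists_codable hg hQ hbQ hsat (g r₁ + g r₂)
  have hc' : Satisfiable O (b.blk c).first := by
    have := hsat c hc 0 (Nat.zero_le _)
    rwa [Block.get_zero] at this
  refine not_uniquelyCharacterisable hb hbQ htop hqb hW hS hc h0 hk hr₁ hr₂ he hn₁ hn₂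
    (hg r₁ hr₁ (satisfiable_mono hO (he.1.trans (contained_conj_left O _ _)) hc') S (by omega))
    (hg r₂ hr₂ (satisfiable_mono hO (he.1.trans (contained_conj_right O _ _)) hc') S (by omega))
    hu

theorem exists_polynomial_sizeBound (w s n : Polynomial ℕ) :
    ∃ f : Polynomial ℕ, ∀ x, f.eval x = sizeBound (w.eval x) (s.eval x) (n.eval x) :=
  ⟨(2 + w * (w * (s + 1) + (2 * s + 3)) + w * w) *
    ((w * (w + w * (w + w)) + (3 * w + w * (w + w) + 2 + n * (s + 1)) + 1) * (3 * s + 1)),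
    fun x => by simp [sizeBound, Coding.countBound, Coding.lengthBound]⟩

/-- All polynomial bounds at once, with `m` bounding the size of `q` and, if needed, the depth of
its competitors. The normal form of `q` is bounded by `2m + 1`, its `≤`-conjunctions have size at
most `2m`, and `m + 1` rounds defeat queries of depth `m`. For characterisable queries the normal
form of `q` itself is used, which has no lone conjuncts by `not_meetReducible`; a witness of safety
would come without a size bound. -/
theorem exists_poly_characterises {O : Ontology U B} (hO : AdmitsContainmentReduction O)
    {Q : Set (DomainQuery U B)} (hQ : ConjClosed Q) (hs : AdmitsSingularPlus O Q)
    (hp : AdmitsPolySingularPlus O Q) : ∃ f : Polynomial ℕ, ∀ q ∈ LTLp Set.univ Q,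
      TSatisfiable O q → ∀ m, q.size ≤ m → ∀ K ⊆ LTLp Set.univ Q,
      (UniquelyCharacterisable O (LTLp Set.univ Q) q ∨
        (∀ q' ∈ K, ∀ s ∈ q'.tail, s.1 ≠ .nowOrLater) ∨ ∀ q' ∈ K, q'.depth ≤ m) →
      ∃ E : TemporalExamples U B, E.Characterises O K q ∧ E.size ≤ f.eval m := by
  obtain ⟨g, hg⟩ := exists_isSplit_of_admitsPoly hp
  obtain ⟨f, hf⟩ := exists_polynomial_sizeBound (2 * .X + 1) (g.comp (2 * .X)) (.X + 1)
  refine ⟨f, fun q hqQ hq m hm K hK halt => ?_⟩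
  obtain ⟨b, hb, hqb, hW, -, hres, -⟩ := exists_normal O q
  obtain ⟨hbQ, htop⟩ := hres Q hqQ.1 fun s hs => (hqQ.2 s hs).2
  have hsize := (hres {r | r.size ≤ m} (q.head_size_le.trans hm)
    fun s hs => (q.tail_size_le hs).trans hm).1
  have hd := q.depth_le_size
  have hfm : f.eval m = sizeBound (2 * m + 1) (g.eval (2 * m)) (m + 1) := by
    simp [hf]
  rw [hfm]
  refine exists_characterises hO hQ hb hqb (hW.mono (by omega))
    (codable_of_size_le hg hQ hbQ (pointsSatisfiable hqb hq) hsize) hK fun c hc h0 hk => ?_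
  rcases halt with h | h | h
  · exact Or.inl (not_meetReducible hO hQ hs hb hbQ htop hqb hq h c hc h0 hk)
  · exact Or.inr (Or.inl h)
  · exact Or.inr (Or.inr fun q' hq' => Nat.lt_succ_of_le (h q' hq'))

theorem uniquelyCharacterisable {O : Ontology U B} (hO : AdmitsContainmentReduction O)
    {Q : Set (DomainQuery U B)} (hQ : ConjClosed Q) (hs : AdmitsSingularPlus O Q)
    {q : PathQuery U B} {b : BlockSeq U B} (hb : b.Normal O) (hbQ : b.Over Q)
    (hqb : ∀ V, GoodTrace O V → (q.HoldsIn V ↔ ∃ s, b.Matches V s)) (hq : TSatisfiable O q)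
    {K : Set (PathQuery U B)} (hK : K ⊆ LTLp Set.univ Q)
    (halt : ∀ c ≤ b.n, 0 < c → b.k c = 0 → ¬ MeetReducible O Q (b.blk c).first ∨
      ∀ q' ∈ K, ∀ s ∈ q'.tail, s.1 ≠ .nowOrLater) : UniquelyCharacterisable O K q := by
  obtain ⟨W, hW⟩ := exists_boundedBy b
  obtain ⟨g, hg⟩ := exists_isSplit_of_admits hs
  obtain ⟨S, -, hS⟩ := exists_codable hg hQ hbQ (pointsSatisfiable hqb hq) 0
  obtain ⟨E, hE, -⟩ := exists_characterises (N := 0) hO hQ hb hqb hW hS hK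
    fun c hc h0 hk => (halt c hc h0 hk).imp id Or.inl
  exact ⟨E, hE⟩

theorem ofForm_over {F : BlockForm U B} {R : Set (DomainQuery U B)}
    (h : F.toPath ∈ LTLp Set.univ R) : (ofForm F).Over R := by
  have key : ∀ i, (F.block i).Over R := by
    intro i
    cases i using Fin.cases with
    | zero =>
      exact ⟨h.1, fun r hr =>
        (h.2 (.next, r) (List.mem_append_left _ (List.mem_map_of_mem hr))).2⟩
    | succ i =>
      have hmem : ∀ s ∈ BlockForm.connSteps (F.conn i) (F.block i.succ) ++
          BlockForm.blockSteps (F.block i.succ), s.2 ∈ R := fun s hs =>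
        (h.2 s (List.mem_append_right _ (List.mem_flatten.2
          ⟨_, (List.mem_ofFn' _ _).2 ⟨i, rfl⟩, hs⟩))).2
      exact ⟨hmem ((F.conn i).final.op, _) (List.mem_append_left _
          (List.mem_append_right _ (List.mem_singleton.2 rfl))),
        fun r hr => hmem (.next, r) (List.mem_append_right _ (List.mem_map_of_mem hr))⟩
  intro i hi
  exact (ofForm_blk F ⟨i, Nat.lt_succ_of_le hi⟩).symm ▸ key _

/-- The computed normal form is the witness of safety. The query `τ` at the free points of
connectors has to be a trivial query in `Q`; one exists whenever a distance of at least `2` occurs,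
because such distances arise from trivial queries of `q`. -/
theorem safe_of_uniquelyCharacterisable {O : Ontology U B} (hO : AdmitsContainmentReduction O)
    {Q : Set (DomainQuery U B)} (hQ : ConjClosed Q) (hs : AdmitsSingularPlus O Q)
    {q : PathQuery U B} (hqQ : q ∈ LTLp Set.univ Q) (hq : TSatisfiable O q)
    (hu : UniquelyCharacterisable O (LTLp Set.univ Q) q) : Safe O Q q := by
  obtain ⟨b, hb, hqb, -, -, hres, -⟩ := exists_normal O q
  obtain ⟨hbQ, htop⟩ := hres Q hqQ.1 fun s hs => (hqQ.2 s hs).2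
  have hlone := not_meetReducible hO hQ hs hb hbQ htop hqb hq hu
  obtain ⟨τ, hτ⟩ : ∃ τ, ∀ i < b.n, 2 ≤ b.d i → τ ∈ Q ∧ IsTop O τ := by
    by_cases h : ∃ i < b.n, 2 ≤ b.d i
    · obtain ⟨i, hi, hd⟩ := h
      obtain ⟨x, hx, hx'⟩ := htop i hi hd
      exact ⟨x, fun _ _ _ => ⟨hx, hx'⟩⟩
    · exact ⟨q.head, fun i hi hd => (h ⟨i, hi, hd⟩).elim⟩
  refine ⟨b.toForm τ, toForm_mem hbQ fun i hi hd => (hτ i hi hd).1,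
    toForm_isNormal hb fun i hi hd => (hτ i hi hd).2, fun i hi => ?_,
    tEquivalent_of_holdsIn fun V hV => (hqb V hV).trans
      (toForm_holdsIn hV fun i hi hd => (hτ i hi hd).2).symm⟩
  exact hlone i (Nat.le_of_lt_succ i.2) (Nat.pos_of_ne_zero fun h => hi.1 (Fin.ext h))
    (Block.len_eq_zero.2 hi.2.1) hi.2.2

/-- The given normal form without lone conjuncts is characterised, and an example set that
characterises a query characterises all equivalent ones. -/
theorem uniquelyCharacterisable_of_safe {O : Ontology U B} (hO : AdmitsContainmentReduction O)
    {Q : Set (DomainQuery U B)} (hQ : ConjClosed Q) (hs : AdmitsSingularPlus O Q)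
    {q : PathQuery U B} (hq : TSatisfiable O q) (h : Safe O Q q) :
    UniquelyCharacterisable O (LTLp Set.univ Q) q := by
  obtain ⟨F, hFQ, hF, hlone, he⟩ := h
  obtain ⟨E, hE⟩ := uniquelyCharacterisable hO hQ hs (ofForm_normal hF) (ofForm_over hFQ)
    (fun V hV => toPath_holdsIn hV hF.free hF.n2) (hq.of_tEquivalent he) (Set.Subset.refl _)
    fun c hc h0 hk => Or.inl fun hm => by
      have hb := ofForm_blk F ⟨c, Nat.lt_succ_of_le hc⟩
      rw [k, hb] at hk
      rw [hb] at hm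
      exact hlone ⟨c, Nat.lt_succ_of_le hc⟩
        ⟨fun h => h0.ne' (Fin.ext_iff.1 h), Block.len_eq_zero.1 hk, hm⟩
  exact ⟨E, hE.of_tEquivalent ⟨he.2, he.1⟩⟩

end BlockSeq

theorem ne_nowOrLater_of_mem {Q : Set (DomainQuery U B)} {q : PathQuery U B}
    (hq : q ∈ LTLp {TempOp.next, TempOp.later} Q) : ∀ s ∈ q.tail, s.1 ≠ .nowOrLater := by
  intro s hs h
  have := (hq.2 s hs).1
  simp [h] at this

end TemporalQuery

/-! ### The main theorem -/

theorem mainTheorem1 {U B : Type} (O : Ontology U B) (hO : AdmitsContainmentReduction O)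
    (Q : Set (DomainQuery U B)) (hQ : ConjClosed Q) (hs : AdmitsSingularPlus O Q) :
    -- unique characterisability is the same as safety
    (∀ q ∈ LTLp Set.univ Q, TSatisfiable O q →
      (UniquelyCharacterisable O (LTLp Set.univ Q) q ↔ Safe O Q q)) ∧
    -- polynomial size, for characterisable queries
    (AdmitsPolySingularPlus O Q →
      PolyCharacterisable O (LTLp Set.univ Q)
        {q ∈ LTLp Set.univ Q |
          TSatisfiable O q ∧ UniquelyCharacterisable O (LTLp Set.univ Q) q}) ∧
    -- polynomial size, for bounded temporal depth
    (AdmitsPolySingularPlus O Q →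
      PolyCharacterisableBoundedDepth O (LTLp Set.univ Q)) ∧
    -- the class without `nowOrLater`
    (∀ q ∈ LTLp {TempOp.next, TempOp.later} Q, TSatisfiable O q →
      UniquelyCharacterisable O (LTLp {TempOp.next, TempOp.later} Q) q) ∧
    (AdmitsPolySingularPlus O Q →
      PolyCharacterisable O (LTLp {TempOp.next, TempOp.later} Q)
        {q ∈ LTLp {TempOp.next, TempOp.later} Q | TSatisfiable O q}) := by
  refine ⟨fun q hqQ hq => ⟨BlockSeq.safe_of_uniquelyCharacterisable hO hQ hs hqQ hq,
    BlockSeq.uniquelyCharacterisable_of_safe hO hQ hs hq⟩, fun hp => ?_, fun hp => ?_,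
    fun q hqQ hq => ?_, fun hp => ?_⟩
  · obtain ⟨f, hf⟩ := BlockSeq.exists_poly_characterises hO hQ hs hp
    exact ⟨f, fun q ⟨hqQ, hq, hu⟩ =>
      hf q hqQ hq q.size le_rfl _ (Set.Subset.refl _) (Or.inl hu)⟩
  · obtain ⟨f, hf⟩ := BlockSeq.exists_poly_characterises hO hQ hs hp
    exact ⟨f, fun n q hqn hq => hf q hqn.1 hq (q.size + n) (Nat.le_add_right _ _) _
      (fun _ h => h.1) (Or.inr (Or.inr fun q' hq' => hq'.2.trans (Nat.le_add_left _ _)))⟩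
  · obtain ⟨b, hb, hqb, -, -, hres, -⟩ := BlockSeq.exists_normal O q
    exact BlockSeq.uniquelyCharacterisable hO hQ hs hb
      (hres Q hqQ.1 fun s hs => (hqQ.2 s hs).2).1 hqb hq
      (LTLp_mono (Set.subset_univ _) Q) fun c _ _ _ => Or.inr fun q' => ne_nowOrLater_of_mem
  · obtain ⟨f, hf⟩ := BlockSeq.exists_poly_characterises hO hQ hs hp
    exact ⟨f, fun q ⟨hqQ, hq⟩ => hf q (LTLp_mono (Set.subset_univ _) Q hqQ) hq q.size le_rfl _
      (LTLp_mono (Set.subset_univ _) Q) (Or.inr (Or.inl fun q' => ne_nowOrLater_of_mem))⟩
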